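/- Conventions. An oriented link is isotopic to another if some ambient isotopy of $\mathbb{R}^3$ carries the first onto the second, preserving orientations. Let $\sigma_1,\dots,\sigma_{n-1}$ be the standard generators of the braid group on $n$ strings, where in a product $ab$ the braid $a$ is run through first, and in $\sigma_j$ the string going from place $j$ to place $j+1$ passes over the other. Closures of braids are oriented by the direction of the strings. The permutation braid of $\sigma\in S_n$ is the braid in which the string that starts at place $i$ ends at place $\sigma(i)$, any two strings cross at most once, and all crossings have the same sign as those of the generators $\sigma_j$. Lorenz links. Let $n\ge 1$ and let $\sigma\in S_n$ be a permutation without fixed points that is a shuffle, i.e. for some $k$ one has $\sigma(1)<\dots<\sigma(k)$ and $\sigma(k+1)<\dots<\sigma(n)$. The closure of the permutation braid of $\sigma$ is called the Lorenz link with Lorenz vector $\langle\sigma(1)-1,\dots,\sigma(k)-k\rangle$. It is denoted by its vector, and $\langle p_1^{q_1},\dots,p_s^{q_s}\rangle$ denotes the vector in which $p_1$ is repeated $q_1$ times, then $p_2$ is repeated $q_2$ times, and so on. Twisted links. For $s\ge 1$, integers $1\le p_1<p_2<\dots<p_s$ and $q_1,\dots,q_s\ge 1$, the twisted link (T-link)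 $T((p_1,q_1),\dots,(p_s,q_s))$ is the closure of the braid $$(\sigma_1\sigma_2\cdots\sigma_{p_1-1})^{q_1}(\sigma_1\sigma_2\cdots\sigma_{p_2-1})^{q_2}\cdots(\sigma_1\sigma_2\cdots\sigma_{p_s-1})^{q_s}$$ on $n=p_s$ strings. Corollary (Birman–Kofman). The class of Lorenz links coincides, up to isotopy of oriented links, with the class of twisted links. Precisely, for all $s\ge 1$, $1\le p_1<\dots<p_s$ and $q_1,\dots,q_s\ge 1$ there is a Lorenz link $\langle p_1^{q_1},\dots,p_s^{q_s}\rangle$, and every Lorenz link with this vector is isotopic, as an oriented link, to the twisted link $T((p_1,q_1),\dots,(p_s,q_s))$. -/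

import Mathlib

/-- Three-dimensional space `ℝ³`; only its topology is used. -/
abbrev Space : Type := ℝ × ℝ × ℝ

/-- An oriented link in `ℝ³`: finitely many disjoint simple closed curves. Each component is
parametrized by `ℝ/ℤ`, written as a `1`-periodic map on `ℝ`, and is oriented by increasing
parameter. -/
structure OrientedLink where
  /-- The index type of the components. -/
  ι : Type
  finite : Finite ι
  curve : ι → ℝ → Space
  continuous_curve : ∀ c, Continuous (curve c)
  periodic_curve : ∀ c, Function.Periodic (curve c) 1
  embedded : ∀ c d s t, curve c s = curve d t → c = d ∧ ∃ m : ℤ, s = t + m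

/-- An ambient isotopy of `ℝ³`: a continuous family of self-homeomorphisms starting at the
identity. -/
structure AmbientIsotopy where
  homeo : unitInterval → (Space ≃ₜ Space)
  continuous_homeo : Continuous fun x : unitInterval × Space => homeo x.1 x.2
  homeo_zero : homeo 0 = Homeomorph.refl Space

/-- Two oriented links are isotopic if the end of some ambient isotopy carries the components of
the first onto those of the second, preserving orientations. The order isomorphism `φ`,
which commutes with the translation by `1`, is the lift of an orientation-preserving
homeomorphism of `ℝ/ℤ`. -/
def Isotopic (L M : OrientedLink) : Prop :=
  ∃ (H : AmbientIsotopy) (e : L.ι ≃ M.ι), ∀ c : L.ι,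
    ∃ φ : ℝ ≃o ℝ, (∀ t, φ (t + 1) = φ t + 1) ∧
      ∀ t, H.homeo 1 (L.curve c t) = M.curve (e c) (φ t)

/-- The standard base points of a braid on `n` strings, on a line in the plane. -/
def basePoint {n : ℕ} (i : Fin n) : ℝ × ℝ := ((i : ℕ), 0)

/-- A geometric braid on `n` strings in `ℝ² × [0,1]`: the string that starts at the `i`-th base
point ends at the `perm i`-th one, and at each time the strings are at distinct points of `ℝ²`.
The strings are oriented by increasing time; only the times in `[0,1]` matter. -/
structure GeometricBraid (n : ℕ) where
  perm : Equiv.Perm (Fin n)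
  string : Fin n → ℝ → ℝ × ℝ
  continuousOn_string : ∀ i, ContinuousOn (string i) (Set.Icc 0 1)
  string_zero : ∀ i, string i 0 = basePoint i
  string_one : ∀ i, string i 1 = basePoint (perm i)
  disjoint : ∀ t ∈ Set.Icc (0 : ℝ) 1, ∀ i j, string i t = string j t → i = j

namespace GeometricBraid

variable {n : ℕ}

/-- The trivial braid. -/
instance : One (GeometricBraid n) where
  one :=
    { perm := 1
      string := fun i _ => basePoint i
      continuousOn_string := fun _ => continuousOn_const
      string_zero := fun _ => rfl
      string_one := fun _ => rfl
      disjoint := fun _ _ i j h => by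
        have h1 : ((i : ℕ) : ℝ) = (j : ℕ) := congrArg Prod.fst h
        exact Fin.ext (by exact_mod_cast h1) }

/-- The product of braids: `a * b` runs through `a` first and then through `b`. -/
noncomputable instance : Mul (GeometricBraid n) where
  mul a b :=
    { perm := b.perm * a.perm
      string := fun i t =>
        if t ≤ 1 / 2 then a.string i (2 * t) else b.string (a.perm i) (2 * t - 1)
      continuousOn_string := fun i => by
        refine ContinuousOn.if ?_ ?_ ?_
        · rintro t ⟨-, ht⟩
          have ht' : t = 1 / 2 := by
            have := frontier_le_subset_eq continuous_id continuous_const ht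
            simpa using this
          subst ht'
          norm_num [a.string_one, b.string_zero]
        · refine (a.continuousOn_string i).comp (by fun_prop) ?_
          rintro t ⟨⟨h0, -⟩, ht⟩
          have ht' : t ≤ 1 / 2 := by
            have : IsClosed {t : ℝ | t ≤ 1 / 2} := isClosed_le continuous_id continuous_const
            rwa [this.closure_eq] at ht
          exact ⟨by linarith, by linarith⟩
        · refine (b.continuousOn_string (a.perm i)).comp (by fun_prop) ?_
          rintro t ⟨⟨-, h1⟩, ht⟩
          have ht' : 1 / 2 ≤ t := by
            have hs : {t : ℝ | ¬ t ≤ 1 / 2} ⊆ {t : ℝ | 1 / 2 ≤ t} := fun t h => (not_le.1 h).le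
            exact closure_minimal hs (isClosed_le continuous_const continuous_id) ht
          exact ⟨by linarith, by linarith⟩
      string_zero := fun i => by simp [a.string_zero]
      string_one := fun i => by norm_num [b.string_one]
      disjoint := fun t ht i j h => by
        by_cases h2 : t ≤ 1 / 2
        · simp only [h2, if_true] at h
          exact a.disjoint _ ⟨by linarith [ht.1], by linarith⟩ i j h
        · simp only [h2, if_false] at h
          exact a.perm.injective
            (b.disjoint _ ⟨by linarith, by linarith [ht.2]⟩ _ _ h) }

/-- The (positive) permutation braid of `σ`: the string from place `i` to place `σ i` moves with
constant speed in the first coordinate, and in the second coordinate (the height over the plane of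
the diagram) its elevation is proportional to its displacement `σ i - i`. Hence two strings cross
at most once, and where they cross the one going to the right relative to the other lies over it,
so all crossings have the same sign. -/
noncomputable def ofPerm (σ : Equiv.Perm (Fin n)) : GeometricBraid n where
  perm := σ
  string := fun i t => ((i : ℕ) + t * (((σ i : ℕ) : ℝ) - (i : ℕ)),
    t * (1 - t) * (((σ i : ℕ) : ℝ) - (i : ℕ)))
  continuousOn_string := fun i => by fun_prop
  string_zero := fun i => by simp [basePoint]
  string_one := fun i => by simp [basePoint]
  disjoint := fun t _ i j h => by
    simp only [Prod.mk.injEq] at h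
    obtain ⟨h1, h2⟩ := h
    rcases eq_or_ne t 1 with ht | ht
    · rw [ht] at h1
      have h3 : ((σ i : ℕ) : ℝ) = (σ j : ℕ) := by linarith
      exact σ.injective (Fin.ext (by exact_mod_cast h3))
    · have ht' : (1 - t) ≠ 0 := sub_ne_zero.mpr (Ne.symm ht)
      have h4 : t * (((σ i : ℕ) : ℝ) - (i : ℕ)) = t * (((σ j : ℕ) : ℝ) - (j : ℕ)) := by
        apply mul_left_cancel₀ ht'
        linarith
      have h3 : ((i : ℕ) : ℝ) = (j : ℕ) := by linarith
      exact Fin.ext (by exact_mod_cast h3)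

/-- The Artin generator which crosses the strings at the places `j` and `j + 1` (counted from `0`),
the string going to the right passing over. It is only used for `j + 1 < n`. -/
noncomputable def gen (n j : ℕ) : GeometricBraid n :=
  if h : j + 1 < n then ofPerm (Equiv.swap ⟨j, by omega⟩ ⟨j + 1, h⟩) else 1

/-- The embedding of `ℝ² × (ℝ/ℤ)` in `ℝ³` onto the complement of the `z`-axis:
`(x, y, u)` goes to the point with cylindrical coordinates `(exp x, 2 π u, y)`. -/
noncomputable def wrap (v : ℝ × ℝ) (u : ℝ) : Space :=
  (Real.exp v.1 * Real.cos (2 * Real.pi * u), Real.exp v.1 * Real.sin (2 * Real.pi * u), v.2)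

theorem wrap_eq {v w : ℝ × ℝ} {s t : ℝ} (h : wrap v s = wrap w t) :
    v = w ∧ ∃ m : ℤ, s = t + m := by
  simp only [wrap, Prod.mk.injEq] at h
  obtain ⟨h1, h2, h3⟩ := h
  have hsq : Real.exp v.1 ^ 2 = Real.exp w.1 ^ 2 := by
    have e1 := Real.cos_sq_add_sin_sq (2 * Real.pi * s)
    have e2 := Real.cos_sq_add_sin_sq (2 * Real.pi * t)
    calc Real.exp v.1 ^ 2
        = (Real.exp v.1 * Real.cos (2 * Real.pi * s)) ^ 2
          + (Real.exp v.1 * Real.sin (2 * Real.pi * s)) ^ 2 := by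
          rw [mul_pow, mul_pow, ← mul_add, e1, mul_one]
      _ = Real.exp w.1 ^ 2 := by
          rw [h1, h2, mul_pow, mul_pow, ← mul_add, e2, mul_one]
  have hexp : Real.exp v.1 = Real.exp w.1 :=
    (pow_left_inj₀ (Real.exp_pos _).le (Real.exp_pos _).le two_ne_zero).1 hsq
  have hx : v.1 = w.1 := Real.exp_injective hexp
  refine ⟨Prod.ext hx h3, ?_⟩
  rw [hexp] at h1 h2
  have hc := mul_left_cancel₀ (Real.exp_pos w.1).ne' h1
  have hs := mul_left_cancel₀ (Real.exp_pos w.1).ne' h2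
  have ha : ((2 * Real.pi * s : ℝ) : Real.Angle) = ((2 * Real.pi * t : ℝ) : Real.Angle) :=
    Real.Angle.cos_sin_inj hc hs
  obtain ⟨m, hm⟩ := Real.Angle.angle_eq_iff_two_pi_dvd_sub.1 ha
  refine ⟨m, ?_⟩
  have : 2 * Real.pi * (s - (t + m)) = 0 := by linarith
  rcases mul_eq_zero.1 this with h | h
  · exact absurd h (by positivity)
  · linarith

theorem wrap_add_int (v : ℝ × ℝ) (u : ℝ) (m : ℤ) : wrap v (u + m) = wrap v u := by
  have : 2 * Real.pi * (u + m) = 2 * Real.pi * u + m * (2 * Real.pi) := by ring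
  simp only [wrap, this, Real.cos_add_int_mul_two_pi, Real.sin_add_int_mul_two_pi]

/-- The path around the axis that starts on the `i`-th string of the closed braid at time `0` and
follows the strings from then on, going through one string per unit of time. -/
noncomputable def run (b : GeometricBraid n) (i : Fin n) (u : ℝ) : Space :=
  wrap (b.string ((b.perm ^ ⌊u⌋) i) (Int.fract u)) u

theorem run_eq_of_mem (b : GeometricBraid n) (i : Fin n) (m : ℤ) {u : ℝ}
    (hu : u ∈ Set.Icc (m : ℝ) (m + 1)) :
    b.run i u = wrap (b.string ((b.perm ^ m) i) (u - m)) u := by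
  rcases hu.2.lt_or_eq with h | h
  · have hf : ⌊u⌋ = m := Int.floor_eq_iff.2 ⟨hu.1, h⟩
    rw [run, Int.fract, hf]
  · have hf : ⌊u⌋ = m + 1 := by
      rw [h]
      exact_mod_cast Int.floor_intCast (m + 1)
    have h0 : Int.fract u = 0 := by
      rw [Int.fract, hf, h]
      push_cast
      ring
    have h1 : u - m = 1 := by linarith
    have hp : (b.perm ^ (m + 1)) i = b.perm ((b.perm ^ m) i) := by
      rw [add_comm, zpow_add, zpow_one, Equiv.Perm.mul_apply]
    rw [run, hf, h0, h1, hp, string_zero, string_one]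

theorem continuous_run (b : GeometricBraid n) (i : Fin n) : Continuous (b.run i) := by
  have hlf : LocallyFinite fun m : ℤ => Set.Icc (m : ℝ) (m + 1) := by
    intro x
    refine ⟨Set.Ioo (x - 1) (x + 1), Ioo_mem_nhds (by linarith) (by linarith), ?_⟩
    refine (Set.finite_Icc (⌊x⌋ - 2) (⌊x⌋ + 2)).subset ?_
    rintro m ⟨y, hy1, hy2⟩
    have a1 := Int.floor_le x
    have a2 := Int.lt_floor_add_one x
    have b1 : (m : ℝ) < ((⌊x⌋ + 2 : ℤ) : ℝ) := by push_cast; linarith [hy1.1, hy2.2]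
    have b2 : ((⌊x⌋ - 2 - 1 : ℤ) : ℝ) < m := by push_cast; linarith [hy1.2, hy2.1]
    exact ⟨by have := Int.cast_lt.1 b2; omega, (Int.cast_lt.1 b1).le⟩
  refine hlf.continuous ?_ (fun _ => isClosed_Icc) fun m => ?_
  · ext x
    simp only [Set.mem_iUnion, Set.mem_univ, iff_true]
    exact ⟨⌊x⌋, Int.floor_le x, (Int.lt_floor_add_one x).le⟩
  · have hc : ContinuousOn (fun u : ℝ => b.string ((b.perm ^ m) i) (u - m))
        (Set.Icc (m : ℝ) (m + 1)) :=
      (b.continuousOn_string _).comp (by fun_prop)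
        fun u hu => ⟨by linarith [hu.1], by linarith [hu.2]⟩
    have hw : ContinuousOn (fun u : ℝ => wrap (b.string ((b.perm ^ m) i) (u - m)) u)
        (Set.Icc (m : ℝ) (m + 1)) := by
      unfold wrap
      fun_prop
    exact hw.congr fun u hu => b.run_eq_of_mem i m hu

theorem run_add_int (b : GeometricBraid n) (i : Fin n) (m : ℤ) (hm : (b.perm ^ m) i = i) (u : ℝ) :
    b.run i (u + m) = b.run i u := by
  rw [run, Int.floor_add_intCast, Int.fract_add_intCast, zpow_add, Equiv.Perm.mul_apply,
    hm, wrap_add_int, run]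

theorem run_eq (b : GeometricBraid n) {i j : Fin n} {s t : ℝ} (h : b.run i s = b.run j t) :
    (b.perm ^ ⌊s⌋) i = (b.perm ^ ⌊t⌋) j ∧ s - t = ((⌊s⌋ - ⌊t⌋ : ℤ) : ℝ) := by
  obtain ⟨hv, m, hm⟩ := wrap_eq h
  have hfr : Int.fract s = Int.fract t := by rw [hm, Int.fract_add_intCast]
  rw [hfr] at hv
  refine ⟨b.disjoint _ ⟨Int.fract_nonneg t, (Int.fract_lt_one t).le⟩ _ _ hv, ?_⟩
  have e1 := Int.floor_add_fract s
  have e2 := Int.floor_add_fract t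
  push_cast
  linarith

/-- The closure of a braid: the ends of the strings are joined around the `z`-axis. Its components
correspond to the cycles of the permutation of the braid. The component of a cycle of length `ℓ`
starts at a place `i` of the cycle and goes around the axis `ℓ` times. -/
noncomputable def closure (b : GeometricBraid n) : OrientedLink where
  ι := Quotient (Equiv.Perm.SameCycle.setoid b.perm)
  finite := inferInstance
  curve := fun c t => b.run c.out (Function.minimalPeriod b.perm c.out * t)
  continuous_curve := fun c => (b.continuous_run c.out).comp (continuous_const.mul continuous_id)
  periodic_curve := fun c t => by
    have hp : (b.perm ^ (Function.minimalPeriod b.perm c.out : ℤ)) c.out = c.out := by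
      rw [zpow_natCast, ← Equiv.Perm.iterate_eq_pow]
      exact Function.iterate_minimalPeriod
    have := b.run_add_int c.out _ hp (Function.minimalPeriod b.perm c.out * t)
    change b.run c.out (Function.minimalPeriod b.perm c.out * (t + 1)) = _
    rw [mul_add, mul_one]
    exact_mod_cast this
  embedded := fun c d s t h => by
    obtain ⟨hp, hst⟩ := b.run_eq h
    have hcd : c = d := by
      rw [← Quotient.out_eq c, ← Quotient.out_eq d]
      refine Quotient.sound ?_
      change b.perm.SameCycle c.out d.out
      rw [← Equiv.Perm.sameCycle_zpow_left (n := ⌊(Function.minimalPeriod b.perm c.out : ℝ) * s⌋), hp,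
        Equiv.Perm.sameCycle_zpow_left]
    subst hcd
    refine ⟨rfl, ?_⟩
    set ℓ := Function.minimalPeriod b.perm c.out with hℓ
    set k : ℤ := ⌊(ℓ : ℝ) * s⌋ - ⌊(ℓ : ℝ) * t⌋ with hk
    have hfix : (b.perm ^ k) c.out = c.out := by
      rw [hk, sub_eq_neg_add, zpow_add, Equiv.Perm.mul_apply, hp, ← Equiv.Perm.mul_apply,
        ← zpow_add]
      simp
    have hdvd : (ℓ : ℤ) ∣ k := (MulAction.zpow_smul_eq_iff_minimalPeriod_dvd (a := b.perm)).1 hfix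
    obtain ⟨m, hm⟩ := hdvd
    have hpos : 0 < ℓ :=
      Function.minimalPeriod_pos_of_mem_periodicPts
        (Function.Injective.mem_periodicPts b.perm.injective c.out)
    refine ⟨m, ?_⟩
    rw [hm] at hst
    push_cast at hst
    have hpos' : (0 : ℝ) < ℓ := by exact_mod_cast hpos
    have : (ℓ : ℝ) * (s - (t + m)) = 0 := by linarith
    rcases mul_eq_zero.1 this with h | h
    · exact absurd h hpos'.ne'
    · linarith

end GeometricBraid

/-- `σ` is a shuffle of the first `k` and the last `n - k` places. -/
def IsShuffle {n : ℕ} (σ : Equiv.Perm (Fin n)) (k : ℕ) : Prop :=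
  k ≤ n ∧ StrictMonoOn σ {i | (i : ℕ) < k} ∧ StrictMonoOn σ {i | k ≤ (i : ℕ)}

/-- `σ` is a shuffle without fixed points (on a nonempty set), so that the closure of its permutation
braid is a Lorenz link; `k` is then the number of the places `i` with `i < σ i`. -/
def IsLorenzPerm {n : ℕ} (σ : Equiv.Perm (Fin n)) (k : ℕ) : Prop :=
  0 < n ∧ IsShuffle σ k ∧ ∀ i, σ i ≠ i

/-- The Lorenz vector `⟨σ(1) - 1, …, σ(k) - k⟩`. -/
def lorenzVector {n : ℕ} (σ : Equiv.Perm (Fin n)) (k : ℕ) : List ℤ :=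
  ((List.finRange n).take k).map fun i => ((σ i : ℕ) : ℤ) - ((i : ℕ) : ℤ)

/-- The Lorenz link of `σ`. -/
noncomputable def lorenzLink {n : ℕ} (σ : Equiv.Perm (Fin n)) : OrientedLink :=
  (GeometricBraid.ofPerm σ).closure

/-- The vector `⟨p₀^{q₀}, …, p_s^{q_s}⟩`, in which each `pᵢ` is repeated `qᵢ` times. -/
def powerVector {s : ℕ} (p q : Fin (s + 1) → ℕ) : List ℤ :=
  (List.ofFn fun i => List.replicate (q i) (p i : ℤ)).flatten

/-- The indices of a T-link with `s + 1` pairs: `1 ≤ p₀ < p₁ < … < p_s` and `qᵢ ≥ 1`. -/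
def IsTData {s : ℕ} (p q : Fin (s + 1) → ℕ) : Prop :=
  0 < p 0 ∧ StrictMono p ∧ ∀ i, 0 < q i

/-- The braid `(σ₁ ⋯ σ_{p₀-1})^{q₀} ⋯ (σ₁ ⋯ σ_{p_s-1})^{q_s}` on `p_s` strings. -/
noncomputable def tBraid {s : ℕ} (p q : Fin (s + 1) → ℕ) : GeometricBraid (p (Fin.last s)) :=
  (List.ofFn fun i => (List.replicate (q i)
    ((List.range (p i - 1)).map (GeometricBraid.gen (p (Fin.last s)))).prod).prod).prod

/-- The T-link `T((p₀,q₀), …, (p_s,q_s))`. -/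
noncomputable def tLink {s : ℕ} (p q : Fin (s + 1) → ℕ) : OrientedLink :=
  (tBraid p q).closure

/-- `L` is a Lorenz link, up to isotopy. -/
def IsLorenzLink (L : OrientedLink) : Prop :=
  ∃ (n k : ℕ) (σ : Equiv.Perm (Fin n)), IsLorenzPerm σ k ∧ Isotopic (lorenzLink σ) L

/-- `L` is a twisted link, up to isotopy. -/
def IsTwistedLink (L : OrientedLink) : Prop :=
  ∃ (s : ℕ) (p q : Fin (s + 1) → ℕ), IsTData p q ∧ Isotopic (tLink p q) L

/-! A Lorenz braid loses its strings one at a time. Let d = σ(1) - 1 be the first entry of the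
vector. The first string runs over every string it meets, so the permutation braid of σ is that of
the shuffle τ left after deleting this string, placed on the strings 2, 3, …, followed by σ₁⋯σ_d.
Suppose that a product W of twists σ₁⋯σ_{a-1} with a ≤ d comes next. Since the moving string passes
over everything, W slides in front of σ₁⋯σ_d and becomes W on the strings 2, 3, …. Now σ₁ is the
only letter that touches the first place. Conjugation and destabilization remove it together with a
string; what is left of σ₁⋯σ_d is σ₂⋯σ_d, which on the remaining strings reads σ₁⋯σ_{d-1}, and a
last conjugation puts it behind W as one more twist, with number d. This is
`BraidMonoid.link_of_mul_twist`.

The entries of the vector are nondecreasing, so a ≤ d holds at every step. After k steps the shuffle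
is the identity on n - k strings and the twists of all entries stand in order
(`link_shuffle_mul_twist`). As σ has no fixed point, σ(k) = n, so n - k is the largest entry p_s,
and the closure is the T-link. Conversely, the vectors that occur are exactly the nonempty sorted
lists of positive integers (`exists_isLorenzPerm`, `IsLorenzPerm.exists_isTData`), so the two
classes of links agree.

The moves on braids have to be realized by ambient isotopies. Apart from rotations about the axis
and a scaling, these come from one principle (`AmbientIsotopy.exists_carries_of_linear`): a linear
homotopy of points in space extends to an ambient isotopy if at each stage the displacement is
Lipschitz in the position, because a short step is then the identity plus a contraction. For arcs
such a bound follows from embeddedness, compactness and a linear functional that increases along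
both arcs (`AmbientIsotopy.exists_carries_arcs`). It shows that permutation braids multiply as long
as no pair of strings crosses twice (`GeometricBraid.ofPerm_mul_ofPerm`). For destabilization
(`GeometricBraid.IsShift.isotopic_closure`) the superfluous turn around the axis is shaped into an
explicit loop along which x + z grows, so that it can be pulled tight by a linear homotopy. -/

open Set Filter Topology

/-! ### Isotopy is an equivalence relation -/

namespace AmbientIsotopy

/-- Running two ambient isotopies simultaneously. -/
def trans (H K : AmbientIsotopy) : AmbientIsotopy where
  homeo t := (H.homeo t).trans (K.homeo t)
  continuous_homeo :=
    K.continuous_homeo.comp (continuous_fst.prodMk H.continuous_homeo)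
  homeo_zero := by rw [H.homeo_zero, K.homeo_zero]; rfl

/-- The constant ambient isotopy. -/
def refl : AmbientIsotopy where
  homeo _ := Homeomorph.refl Space
  continuous_homeo := continuous_snd
  homeo_zero := rfl

/-- Joint continuity of the inverses is a compactness and connectedness argument. A small sphere
around the preimage y₀ has compact image avoiding x₀, and for nearby times the image still avoids a
fixed ball around x₀. That ball is connected and contains the image of y₀, so it lies in the image
of the closed ball bounded by the sphere. -/
theorem continuous_homeo_symm (H : AmbientIsotopy) :
    Continuous fun x : unitInterval × Space => (H.homeo x.1).symm x.2 := by
  rw [continuous_iff_continuousAt]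
  rintro ⟨t₀, x₀⟩
  set y₀ := (H.homeo t₀).symm x₀ with hy₀
  have hx₀ : H.homeo t₀ y₀ = x₀ := by simp [hy₀]
  rw [ContinuousAt, Metric.nhds_basis_closedBall.tendsto_right_iff]
  intro ε hε
  have hK : IsCompact (Metric.sphere y₀ ε) := isCompact_sphere y₀ ε
  have hx : x₀ ∉ H.homeo t₀ '' Metric.sphere y₀ ε := by
    rintro ⟨p, hp, hpx⟩
    have : p = y₀ := (H.homeo t₀).injective (hpx.trans hx₀.symm)
    rw [this, Metric.mem_sphere, dist_self] at hp
    exact hε.ne hp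
  obtain ⟨δ, hδ, hδs⟩ := Metric.isOpen_iff.1
    (hK.image (H.homeo t₀).continuous).isClosed.isOpen_compl x₀ hx
  have h1 : ∀ᶠ t in 𝓝 t₀, ∀ p ∈ Metric.sphere y₀ ε, H.homeo t p ∉ Metric.closedBall x₀ (δ / 2) := by
    refine hK.eventually_forall_of_forall_eventually fun p hp => ?_
    refine H.continuous_homeo.continuousAt.eventually
      (Metric.isClosed_closedBall.isOpen_compl.mem_nhds fun h => ?_)
    refine hδs (Metric.closedBall_subset_ball (by linarith) h) ⟨p, hp, rfl⟩
  have h2 : ∀ᶠ t in 𝓝 t₀, H.homeo t y₀ ∈ Metric.ball x₀ (δ / 2) := by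
    have hc : Continuous fun t => H.homeo t y₀ :=
      H.continuous_homeo.comp (continuous_id.prodMk continuous_const)
    refine hc.continuousAt.eventually (Metric.isOpen_ball.mem_nhds ?_)
    change H.homeo t₀ y₀ ∈ _
    rw [hx₀]
    exact Metric.mem_ball_self (by linarith)
  have h3 : ∀ᶠ z : unitInterval × Space in 𝓝 (t₀, x₀), z.2 ∈ Metric.ball x₀ (δ / 2) :=
    continuous_snd.continuousAt.eventually (Metric.ball_mem_nhds _ (by linarith))
  filter_upwards [continuous_fst.continuousAt.eventually h1,
    continuous_fst.continuousAt.eventually h2, h3] with z hz1 hz2 hz3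
  set S := H.homeo z.1 '' Metric.closedBall y₀ ε with hS
  have hSc : IsClosed S := (H.homeo z.1).isClosedMap _ Metric.isClosed_closedBall
  have hfr : ∀ x ∈ Metric.ball x₀ (δ / 2), x ∈ S → x ∈ interior S := by
    rintro x hx ⟨p, hp, rfl⟩
    rw [hS, ← (H.homeo z.1).image_interior]
    refine mem_image_of_mem _ (Metric.ball_subset_interior_closedBall ?_)
    refine lt_of_le_of_ne hp fun h => hz1 p h (Metric.ball_subset_closedBall hx)
  -- By `hfr` the ball meets `S` only in interior points, so it is covered by two disjoint open
  -- sets.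
  have hsub : Metric.ball x₀ (δ / 2) ⊆ interior S :=
    (convex_ball x₀ (δ / 2)).isPreconnected.subset_left_of_subset_union isOpen_interior
      hSc.isOpen_compl (disjoint_compl_right.mono_left interior_subset)
      (fun x hx => (em (x ∈ S)).imp (hfr x hx) id)
      ⟨_, hz2, hfr _ hz2 ⟨y₀, Metric.mem_closedBall_self hε.le, rfl⟩⟩
  obtain ⟨p, hp, hpz⟩ := interior_subset (hsub hz3)
  change (H.homeo z.1).symm z.2 ∈ _
  rw [← hpz, Homeomorph.symm_apply_apply]
  exact hp

/-- The ambient isotopy of the inverse homeomorphisms. -/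
def symm (H : AmbientIsotopy) : AmbientIsotopy where
  homeo t := (H.homeo t).symm
  continuous_homeo := H.continuous_homeo_symm
  homeo_zero := by rw [H.homeo_zero]; rfl

end AmbientIsotopy

namespace Isotopic

theorem refl (L : OrientedLink) : Isotopic L L :=
  ⟨AmbientIsotopy.refl, Equiv.refl _, fun _ => ⟨OrderIso.refl ℝ, fun _ => rfl, fun _ => rfl⟩⟩

theorem symm {L M : OrientedLink} : Isotopic L M → Isotopic M L := by
  rintro ⟨H, e, h⟩
  refine ⟨H.symm, e.symm, fun c => ?_⟩
  obtain ⟨φ, h1, h2⟩ := h (e.symm c)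
  refine ⟨φ.symm, fun t => ?_, fun t => ?_⟩
  · rw [OrderIso.symm_apply_eq, h1, OrderIso.apply_symm_apply]
  · have := h2 (φ.symm t)
    rw [Equiv.apply_symm_apply, OrderIso.apply_symm_apply] at this
    change (H.homeo 1).symm _ = _
    rw [← this, Homeomorph.symm_apply_apply]

theorem trans {L M N : OrientedLink} : Isotopic L M → Isotopic M N → Isotopic L N := by
  rintro ⟨H, e, h⟩ ⟨K, f, k⟩
  refine ⟨H.trans K, e.trans f, fun c => ?_⟩
  obtain ⟨φ, h1, h2⟩ := h c
  obtain ⟨ψ, k1, k2⟩ := k (e c)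
  refine ⟨φ.trans ψ, fun t => ?_, fun t => ?_⟩
  · simp [h1, k1]
  · change K.homeo 1 (H.homeo 1 _) = _
    rw [h2, k2]
    rfl

end Isotopic

/-! ### Ambient isotopies from Lipschitz displacements -/

/-- `H` carries the point `f x` to the point `g x`, for all `x`. -/
def AmbientIsotopy.Carries {X : Type*} (H : AmbientIsotopy) (f g : X → Space) : Prop :=
  ∀ x, H.homeo 1 (f x) = g x

/-- McShane's extension applied to each coordinate. `Space` carries the sup norm, so the constant is
not enlarged; this matters because it has to stay below 1. -/
theorem LipschitzOnWith.extend_space {g : Space → Space} {s : Set Space} {K : NNReal}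
    (hg : LipschitzOnWith K g s) : ∃ G : Space → Space, LipschitzWith K G ∧ EqOn g G s := by
  have p1 : LipschitzWith 1 fun p : Space => p.1 := LipschitzWith.prod_fst
  have p2 : LipschitzWith 1 fun p : Space => p.2.1 := by
    have := LipschitzWith.prod_fst.comp (LipschitzWith.prod_snd (α := ℝ) (β := ℝ × ℝ))
    rwa [one_mul] at this
  have p3 : LipschitzWith 1 fun p : Space => p.2.2 := by
    have := LipschitzWith.prod_snd.comp (LipschitzWith.prod_snd (α := ℝ) (β := ℝ × ℝ))
    rwa [one_mul] at this
  have h1 := (p1.comp_lipschitzOnWith hg).extend_real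
  have h2 := (p2.comp_lipschitzOnWith hg).extend_real
  have h3 := (p3.comp_lipschitzOnWith hg).extend_real
  rw [one_mul] at h1 h2 h3
  obtain ⟨G1, k1, e1⟩ := h1
  obtain ⟨G2, k2, e2⟩ := h2
  obtain ⟨G3, k3, e3⟩ := h3
  refine ⟨fun p => (G1 p, G2 p, G3 p), ?_, fun p hp => ?_⟩
  · simpa using k1.prodMk (k2.prodMk k3)
  · exact Prod.ext (e1 hp) (Prod.ext (e2 hp) (e3 hp))

/-- The identity plus a map with small Lipschitz constant is a homeomorphism. -/
theorem LipschitzWith.exists_homeomorph_add {G : Space → Space} {K : NNReal} (hK : K < 1)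
    (hG : LipschitzWith K G) : ∃ h : Space ≃ₜ Space, ∀ p, h p = p + G p := by
  have ha : ApproximatesLinearOn (fun p => p + G p)
      ((ContinuousLinearEquiv.refl ℝ Space : Space ≃L[ℝ] Space) : Space →L[ℝ] Space) univ K := by
    intro x _ y _
    have := hG.norm_sub_le x y
    have e : x + G x - (y + G y) - (x - y) = G x - G y := by abel
    simpa [e] using this
  refine ⟨ha.toHomeomorph _ (Or.inr ?_), fun p => rfl⟩
  have : ‖(((ContinuousLinearEquiv.refl ℝ Space).symm : Space ≃L[ℝ] Space) : Space →L[ℝ] Space)‖₊ = 1 := by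
    rw [ContinuousLinearEquiv.refl_symm, ContinuousLinearEquiv.coe_refl]
    exact nnnorm_one
  rw [this, inv_one]
  exact hK

/-- Moving points by a displacement which is a contraction of their position. -/
theorem AmbientIsotopy.exists_carries_add {X : Type*} (f D : X → Space) {C : ℝ} (hC : C < 1)
    (h : ∀ x y, ‖D x - D y‖ ≤ C * ‖f x - f y‖) :
    ∃ H : AmbientIsotopy, H.Carries f fun x => f x + D x := by
  set K : NNReal := C.toNNReal
  have hK : K < 1 := by simpa [K] using hC
  have hf : ∀ x y, f x = f y → D x = D y := fun x y e => by
    have := h x y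
    rw [e, sub_self, norm_zero, mul_zero] at this
    exact sub_eq_zero.1 (norm_le_zero_iff.1 this)
  classical
  -- Points at the same position have the same displacement, so the displacement is a function of
  -- the position.
  have hg : ∃ g : Space → Space, ∀ x, g (f x) = D x := by
    refine ⟨fun p => if hp : ∃ x, f x = p then D hp.choose else 0, fun x => ?_⟩
    have hp : ∃ x', f x' = f x := ⟨x, rfl⟩
    simp only [hp, dif_pos]
    exact hf _ _ hp.choose_spec
  obtain ⟨g, hg⟩ := hg
  have hgL : LipschitzOnWith K g (range f) := by
    refine LipschitzOnWith.of_dist_le_mul ?_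
    rintro _ ⟨x, rfl⟩ _ ⟨y, rfl⟩
    rw [hg, hg, dist_eq_norm, dist_eq_norm]
    exact (h x y).trans (mul_le_mul_of_nonneg_right (Real.le_coe_toNNReal C) (norm_nonneg _))
  obtain ⟨G, hG, hgG⟩ := hgL.extend_space
  have key : ∀ t : unitInterval, ∃ h : Space ≃ₜ Space, ∀ p, h p = p + (t : ℝ) • G p := by
    intro t
    refine LipschitzWith.exists_homeomorph_add hK (G := fun p => (t : ℝ) • G p) ?_
    refine LipschitzWith.of_dist_le_mul fun p q => ?_
    rw [dist_smul₀, Real.norm_eq_abs, abs_of_nonneg t.2.1]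
    calc (t : ℝ) * dist (G p) (G q) ≤ 1 * dist (G p) (G q) :=
          mul_le_mul_of_nonneg_right t.2.2 dist_nonneg
      _ ≤ K * dist p q := by rw [one_mul]; exact hG.dist_le_mul p q
  choose hh hhs using key
  refine ⟨⟨hh, ?_, ?_⟩, fun x => ?_⟩
  · simp only [hhs]
    have := hG.continuous
    fun_prop
  · ext1 p
    simp [hhs]
  · change hh 1 (f x) = _
    rw [hhs, ← hgG ⟨x, rfl⟩, hg]
    simp

/-- A linear homotopy whose displacement is at each time Lipschitz in the position is the
restriction of an ambient isotopy. -/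
theorem AmbientIsotopy.exists_carries_of_linear {X : Type*} (f D : X → Space)
    (h : ∀ s ∈ Icc (0 : ℝ) 1, ∃ C : ℝ, ∀ x y,
      ‖D x - D y‖ ≤ C * ‖(f x + s • D x) - (f y + s • D y)‖) :
    ∃ H : AmbientIsotopy, H.Carries f fun x => f x + D x := by
  -- The relation between stages s and s' of being joined by an ambient isotopy is transitive and
  -- holds in both directions between neighbouring stages; connectedness of [0,1] then joins 0 to 1.
  have key := isPreconnected_Icc.induction₂' (s := Icc (0 : ℝ) 1)
    (fun s s' => ∃ H : AmbientIsotopy, H.Carries (fun x => f x + s • D x) fun x => f x + s' • D x)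
    ?_ ?_ (x := 0) (y := 1) (by simp) (by simp)
  · obtain ⟨H, hH⟩ := key
    exact ⟨H, fun x => by simpa using hH x⟩
  · intro s hs
    obtain ⟨C', hC'⟩ := h s hs
    obtain ⟨C, hC0, hC⟩ : ∃ C : ℝ, 0 < C ∧ ∀ x y,
        ‖D x - D y‖ ≤ C * ‖(f x + s • D x) - (f y + s • D y)‖ :=
      ⟨max C' 1, by positivity, fun x y => (hC' x y).trans
        (mul_le_mul_of_nonneg_right (le_max_left _ _) (norm_nonneg _))⟩
    -- The factor 4 leaves room for the way back from s' to s: there the bound is needed in terms of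
    -- the positions at stage s', which costs a factor 2.
    have hev : ∀ᶠ s' in 𝓝[Icc (0 : ℝ) 1] s, |s' - s| * (4 * C) < 1 := by
      refine Filter.Eventually.filter_mono nhdsWithin_le_nhds ?_
      have hc : Continuous fun s' : ℝ => |s' - s| * (4 * C) := by fun_prop
      refine hc.continuousAt.eventually (Iio_mem_nhds ?_)
      simp
    filter_upwards [hev] with s' hs'
    have hsm : |s' - s| * C < 1 / 4 := by linarith
    have e : ∀ x, f x + s' • D x = (f x + s • D x) + (s' - s) • D x := fun x => by
      rw [sub_smul]; abel
    constructor
    · obtain ⟨H, hH⟩ := AmbientIsotopy.exists_carries_add (fun x => f x + s • D x)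
        (fun x => (s' - s) • D x) (C := |s' - s| * C) (by linarith) fun x y => by
          rw [← smul_sub, norm_smul, Real.norm_eq_abs, mul_assoc]
          exact mul_le_mul_of_nonneg_left (hC x y) (abs_nonneg _)
      exact ⟨H, fun x => (hH x).trans (e x).symm⟩
    · obtain ⟨H, hH⟩ := AmbientIsotopy.exists_carries_add (fun x => f x + s' • D x)
        (fun x => (s - s') • D x) (C := |s' - s| * (2 * C)) (by linarith) fun x y => by
          rw [← smul_sub, norm_smul, Real.norm_eq_abs, mul_assoc, abs_sub_comm]
          refine mul_le_mul_of_nonneg_left ?_ (abs_nonneg _)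
          set A := (f x + s • D x) - (f y + s • D y) with hA
          have e1 : (f x + s' • D x) - (f y + s' • D y) = A + (s' - s) • (D x - D y) := by
            rw [e, e, hA, smul_sub]; abel
          rw [e1]
          have h1 : ‖(s' - s) • (D x - D y)‖ ≤ 1 / 4 * ‖A‖ := by
            rw [norm_smul, Real.norm_eq_abs]
            calc |s' - s| * ‖D x - D y‖ ≤ |s' - s| * (C * ‖A‖) :=
                  mul_le_mul_of_nonneg_left (hC x y) (abs_nonneg _)
              _ = |s' - s| * C * ‖A‖ := by ring
              _ ≤ _ := mul_le_mul_of_nonneg_right hsm.le (norm_nonneg _)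
          have h2 : ‖A‖ - ‖(s' - s) • (D x - D y)‖ ≤ ‖A + (s' - s) • (D x - D y)‖ := by
            have := norm_sub_norm_le A (-((s' - s) • (D x - D y)))
            rwa [norm_neg, sub_neg_eq_add] at this
          have h3 : ‖A‖ / 2 ≤ ‖A + (s' - s) • (D x - D y)‖ := by
            have := norm_nonneg A
            linarith
          calc ‖D x - D y‖ ≤ C * ‖A‖ := hC x y
            _ = 2 * C * (‖A‖ / 2) := by ring
            _ ≤ _ := mul_le_mul_of_nonneg_left h3 (by positivity)
      refine ⟨H, fun x => (hH x).trans ?_⟩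
      simp only [e]
      rw [add_assoc, ← add_smul]
      simp
  · rintro a b c - - - ⟨H, hH⟩ ⟨K, hK⟩
    exact ⟨H.trans K, fun x => by
      change K.homeo 1 (H.homeo 1 _) = _
      rw [hH x, hK x]⟩

/-! ### Linear functionals that increase along arcs -/

/-- The standard inner product of `ℝ³`. -/
def dot (w p : Space) : ℝ := w.1 * p.1 + w.2.1 * p.2.1 + w.2.2 * p.2.2

theorem dot_add (w p q : Space) : dot w (p + q) = dot w p + dot w q := by
  simp only [dot, Prod.fst_add, Prod.snd_add]; ring

theorem dot_sub (w p q : Space) : dot w (p - q) = dot w p - dot w q := by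
  simp only [dot, Prod.fst_sub, Prod.snd_sub]; ring

theorem dot_smul (w : Space) (c : ℝ) (p : Space) : dot w (c • p) = c * dot w p := by
  simp only [dot, Prod.smul_fst, Prod.smul_snd, smul_eq_mul]; ring

theorem dot_le (w p : Space) : dot w p ≤ (|w.1| + |w.2.1| + |w.2.2|) * ‖p‖ := by
  have h1 : |p.1| ≤ ‖p‖ := norm_fst_le p
  have h2 : |p.2.1| ≤ ‖p‖ := (norm_fst_le p.2).trans (norm_snd_le p)
  have h3 : |p.2.2| ≤ ‖p‖ := (norm_snd_le p.2).trans (norm_snd_le p)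
  have e : ∀ a b : ℝ, |b| ≤ ‖p‖ → a * b ≤ |a| * ‖p‖ := fun a b h =>
    (le_abs_self _).trans (by rw [abs_mul]; exact mul_le_mul_of_nonneg_left h (abs_nonneg _))
  have := e w.1 _ h1
  have := e w.2.1 _ h2
  have := e w.2.2 _ h3
  rw [dot]
  linarith

/-- In a neighbourhood of `u` in `[0,1]`, the function `f` increases with at least some positive
rate. -/
def IncreasingAt (f : ℝ → ℝ) (u : ℝ) : Prop :=
  ∃ m > 0, ∃ t ∈ 𝓝[Icc 0 1] u, ∀ a ∈ t ∩ Icc 0 1, ∀ b ∈ t ∩ Icc 0 1, a ≤ b →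
    m * (b - a) ≤ f b - f a

/-- The reason for asking for a linear functional: if it increases along both ends of a linear
homotopy, it increases along every intermediate stage. -/
theorem IncreasingAt.convex {f g : ℝ → ℝ} {u s : ℝ} (hf : IncreasingAt f u)
    (hg : IncreasingAt g u) (hs : s ∈ Icc (0 : ℝ) 1) :
    IncreasingAt (fun x => (1 - s) * f x + s * g x) u := by
  obtain ⟨m, hm, t, ht, h⟩ := hf
  obtain ⟨m', hm', t', ht', h'⟩ := hg
  refine ⟨min m m', lt_min hm hm', t ∩ t', inter_mem ht ht', fun a ha b hb hab => ?_⟩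
  have h1 := h a ⟨ha.1.1, ha.2⟩ b ⟨hb.1.1, hb.2⟩ hab
  have h2 := h' a ⟨ha.1.2, ha.2⟩ b ⟨hb.1.2, hb.2⟩ hab
  have hd : 0 ≤ b - a := sub_nonneg.2 hab
  have h3 := (mul_le_mul_of_nonneg_right (min_le_left m m') hd).trans h1
  have h4 := (mul_le_mul_of_nonneg_right (min_le_right m m') hd).trans h2
  have h5 := mul_le_mul_of_nonneg_left h3 (sub_nonneg.2 hs.2)
  have h6 := mul_le_mul_of_nonneg_left h4 hs.1
  nlinarith

/-- Two displaced arcs whose positions are locally separated by a linear functional, in the order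
of the parameter. -/
theorem displacement_bound_of_increasing {F₁ F₂ D₁ D₂ : ℝ → Space} {K : NNReal} {w : Space}
    {p q : ℝ} (hp : p ∈ Icc (0 : ℝ) 1) (hq : q ∈ Icc (0 : ℝ) 1) (hF : F₁ p = F₂ q) (hD : D₁ p = D₂ q)
    (hD₁ : LipschitzOnWith K D₁ (Icc 0 1)) (hD₂ : LipschitzOnWith K D₂ (Icc 0 1))
    {m : ℝ} (hm : 0 < m) {a b : ℝ} (ha : a ∈ Icc (0 : ℝ) 1) (hb : b ∈ Icc (0 : ℝ) 1)
    (hap : a ≤ p) (hqb : q ≤ b)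
    (h₁ : m * (p - a) ≤ dot w (F₁ p) - dot w (F₁ a))
    (h₂ : m * (b - q) ≤ dot w (F₂ b) - dot w (F₂ q)) :
    ‖D₁ a - D₂ b‖ ≤ K * (|w.1| + |w.2.1| + |w.2.2|) / m * ‖F₁ a - F₂ b‖ := by
  set W := |w.1| + |w.2.1| + |w.2.2|
  have e1 : ‖D₁ a - D₁ p‖ ≤ K * (p - a) := by
    have := hD₁.norm_sub_le ha hp
    rwa [Real.norm_eq_abs, abs_sub_comm, abs_of_nonneg (sub_nonneg.2 hap)] at this
  have e2 : ‖D₂ q - D₂ b‖ ≤ K * (b - q) := by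
    have := hD₂.norm_sub_le hq hb
    rwa [Real.norm_eq_abs, abs_sub_comm, abs_of_nonneg (sub_nonneg.2 hqb)] at this
  have e3 : ‖D₁ a - D₂ b‖ ≤ K * ((p - a) + (b - q)) := by
    have : D₁ a - D₂ b = (D₁ a - D₁ p) + (D₂ q - D₂ b) := by rw [hD]; abel
    rw [this]
    refine (norm_add_le _ _).trans ?_
    linarith
  -- The arcs run from `F₁ a` up to the common point and from there up to `F₂ b`; both parts raise
  -- the functional, so the gains add up and nothing cancels.
  have e4 : m * ((p - a) + (b - q)) ≤ W * ‖F₁ a - F₂ b‖ := by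
    have h := dot_le w (F₂ b - F₁ a)
    rw [dot_sub, norm_sub_rev] at h
    rw [hF] at h₁
    linarith
  calc ‖D₁ a - D₂ b‖ ≤ K * ((p - a) + (b - q)) := e3
    _ = K / m * (m * ((p - a) + (b - q))) := by field_simp
    _ ≤ K / m * (W * ‖F₁ a - F₂ b‖) := mul_le_mul_of_nonneg_left e4 (by positivity)
    _ = _ := by ring

section Arcs

variable {n : ℕ}

/-- Compactness of X × X: finitely many local constants are replaced by their maximum. -/
theorem exists_forall_le_of_local {X : Type*} [TopologicalSpace X] [CompactSpace X]
    (F D : X → Space)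
    (h : ∀ x y : X, ∃ C : ℝ, ∀ᶠ z in 𝓝 (x, y), ‖D z.1 - D z.2‖ ≤ C * ‖F z.1 - F z.2‖) :
    ∃ C : ℝ, ∀ x y, ‖D x - D y‖ ≤ C * ‖F x - F y‖ := by
  have key : ∃ C : ℝ, ∀ z ∈ (univ : Set (X × X)), ‖D z.1 - D z.2‖ ≤ C * ‖F z.1 - F z.2‖ := by
    refine isCompact_univ.induction_on
      (p := fun N : Set (X × X) => ∃ C : ℝ, ∀ z ∈ N, ‖D z.1 - D z.2‖ ≤ C * ‖F z.1 - F z.2‖)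
      ⟨0, by simp⟩ (fun s t hst ⟨C, hC⟩ => ⟨C, fun z hz => hC z (hst hz)⟩) ?_ ?_
    · rintro s t ⟨C, hC⟩ ⟨C', hC'⟩
      refine ⟨max C C', fun z hz => ?_⟩
      rcases hz with hz | hz
      · exact (hC z hz).trans (mul_le_mul_of_nonneg_right (le_max_left _ _) (norm_nonneg _))
      · exact (hC' z hz).trans (mul_le_mul_of_nonneg_right (le_max_right _ _) (norm_nonneg _))
    · rintro ⟨x, y⟩ -
      obtain ⟨C, hC⟩ := h x y
      exact ⟨_, by rw [nhdsWithin_univ]; exact hC, C, fun z hz => hz⟩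
  obtain ⟨C, hC⟩ := key
  exact ⟨C, fun x y => hC (x, y) (mem_univ _)⟩

theorem eventually_nhds_arcs {i j : Fin n} {u v : unitInterval} {t₁ t₂ : Set ℝ}
    (h₁ : t₁ ∈ 𝓝[Icc 0 1] (u : ℝ)) (h₂ : t₂ ∈ 𝓝[Icc 0 1] (v : ℝ))
    {P : (Fin n × unitInterval) × (Fin n × unitInterval) → Prop}
    (h : ∀ a b : unitInterval, (a : ℝ) ∈ t₁ → (b : ℝ) ∈ t₂ → P ((i, a), (j, b))) :
    ∀ᶠ z in 𝓝 ((i, u), (j, v)), P z := by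
  have k₁ : ∀ᶠ a : unitInterval in 𝓝 u, (a : ℝ) ∈ t₁ :=
    preimage_coe_mem_nhds_subtype.2 h₁
  have k₂ : ∀ᶠ a : unitInterval in 𝓝 v, (a : ℝ) ∈ t₂ :=
    preimage_coe_mem_nhds_subtype.2 h₂
  have d : ∀ k : Fin n, ∀ᶠ a in 𝓝 k, a = k := fun k => by
    rw [nhds_discrete]; exact Filter.eventually_pure.2 rfl
  rw [nhds_prod_eq, nhds_prod_eq, nhds_prod_eq]
  filter_upwards [((d i).prod_mk k₁).prod_mk ((d j).prod_mk k₂)]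
  rintro ⟨⟨i', a⟩, ⟨j', b⟩⟩ ⟨⟨h1, h2⟩, ⟨h3, h4⟩⟩
  simp only at h1 h2 h3 h4
  subst h1 h3
  exact h a b h2 h4

/-- Two systems of arcs in `ℝ³`, joined end to end in the same way to closed curves, are carried to
each other by an ambient isotopy if the linear homotopy between them stays embedded and if locally
some linear functional increases along both. -/
theorem AmbientIsotopy.exists_carries_arcs (π : Equiv.Perm (Fin n)) (α β : Fin n → ℝ → Space)
    {K : NNReal} (hα : ∀ i, LipschitzOnWith K (α i) (Icc 0 1))
    (hβ : ∀ i, LipschitzOnWith K (β i) (Icc 0 1))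
    (hα1 : ∀ i, α i 1 = α (π i) 0) (hβ1 : ∀ i, β i 1 = β (π i) 0)
    (hinj : ∀ s ∈ Icc (0 : ℝ) 1, ∀ i j, ∀ u ∈ Ico (0 : ℝ) 1, ∀ v ∈ Ico (0 : ℝ) 1,
      (1 - s) • α i u + s • β i u = (1 - s) • α j v + s • β j v → i = j ∧ u = v)
    (w : Fin n → ℝ → Space) (hw : ∀ i, w i 1 = w (π i) 0)
    (hincα : ∀ i, ∀ u ∈ Icc (0 : ℝ) 1, IncreasingAt (fun x => dot (w i u) (α i x)) u)
    (hincβ : ∀ i, ∀ u ∈ Icc (0 : ℝ) 1, IncreasingAt (fun x => dot (w i u) (β i x)) u) :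
    ∃ H : AmbientIsotopy, ∀ i, ∀ u ∈ Icc (0 : ℝ) 1, H.homeo 1 (α i u) = β i u := by
  set D : Fin n → ℝ → Space := fun i u => β i u - α i u with hDdef
  have hD : ∀ i, LipschitzOnWith (K + K) (D i) (Icc 0 1) := fun i => (hβ i).sub (hα i)
  have hD1 : ∀ i, D i 1 = D (π i) 0 := fun i => by simp only [hDdef, hα1, hβ1]
  have main : ∃ H : AmbientIsotopy, H.Carries
      (fun x : Fin n × unitInterval => α x.1 x.2) fun x => α x.1 x.2 + D x.1 x.2 := by
    refine AmbientIsotopy.exists_carries_of_linear _ _ fun s hs => ?_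
    set F : Fin n → ℝ → Space := fun i u => α i u + s • D i u with hFdef
    have hFs : ∀ i u, F i u = (1 - s) • α i u + s • β i u := fun i u => by
      simp only [hFdef, hDdef]; module
    have hF1 : ∀ i, F i 1 = F (π i) 0 := fun i => by simp only [hFdef, hα1, hD1]
    have hFinj : ∀ i j, ∀ u ∈ Ico (0 : ℝ) 1, ∀ v ∈ Ico (0 : ℝ) 1, F i u = F j v → i = j ∧ u = v :=
      fun i j u hu v hv h => hinj s hs i j u hu v hv (by rwa [hFs, hFs] at h)
    have hFinc : ∀ i, ∀ u ∈ Icc (0 : ℝ) 1, IncreasingAt (fun x => dot (w i u) (F i x)) u := by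
      intro i u hu
      have := (hincα i u hu).convex (hincβ i u hu) hs
      simpa only [hFs, dot_add, dot_smul] using this
    have hcF : Continuous fun x : Fin n × unitInterval => F x.1 x.2 := by
      refine continuous_prod_of_discrete_left.2 fun i => ?_
      have h1 : ContinuousOn (F i) (Icc 0 1) :=
        (hα i).continuousOn.add ((hD i).continuousOn.const_smul s)
      exact h1.domRestrict
    have hcD : Continuous fun x : Fin n × unitInterval => D x.1 x.2 := by
      refine continuous_prod_of_discrete_left.2 fun i => ?_
      exact (hD i).continuousOn.domRestrict
    refine exists_forall_le_of_local (fun x : Fin n × unitInterval => F x.1 x.2)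
      (fun x => D x.1 x.2) ?_
    -- Near the diagonal, the increasing functional compares distance in space with distance in the
    -- parameter.
    have hsame : ∀ i, ∀ u : unitInterval, ∃ C : ℝ, ∀ᶠ z in 𝓝 (((i, u) : Fin n × unitInterval),
        ((i, u) : Fin n × unitInterval)),
        ‖D z.1.1 z.1.2 - D z.2.1 z.2.2‖ ≤ C * ‖F z.1.1 z.1.2 - F z.2.1 z.2.2‖ := by
      intro i u
      obtain ⟨m, hm, t, ht, h⟩ := hFinc i u u.2
      refine ⟨((K + K : NNReal) : ℝ) * (|(w i u).1| + |(w i u).2.1| + |(w i u).2.2|) / m,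
        eventually_nhds_arcs ht ht fun a b ha hb => ?_⟩
      rcases le_total a b with hab | hab
      · exact displacement_bound_of_increasing (w := w i u) a.2 a.2 rfl rfl (hD i) (hD i) hm a.2 b.2 le_rfl hab
          (by simp) (h a ⟨ha, a.2⟩ b ⟨hb, b.2⟩ hab)
      · rw [norm_sub_rev, norm_sub_rev (F i a)]
        exact displacement_bound_of_increasing (w := w i u) b.2 b.2 rfl rfl (hD i) (hD i) hm b.2 a.2 le_rfl hab
          (by simp) (h b ⟨hb, b.2⟩ a ⟨ha, a.2⟩ hab)
    -- Near a junction of two arcs the same functional increases on both sides, by the compatibility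
    -- `hw`.
    have hjunc : ∀ i, ∃ C : ℝ, ∀ᶠ z in 𝓝 (((i, 1) : Fin n × unitInterval),
        ((π i, 0) : Fin n × unitInterval)),
        ‖D z.1.1 z.1.2 - D z.2.1 z.2.2‖ ≤ C * ‖F z.1.1 z.1.2 - F z.2.1 z.2.2‖ := by
      intro i
      obtain ⟨m, hm, t, ht, h⟩ := hFinc i 1 (by simp)
      obtain ⟨m', hm', t', ht', h'⟩ := hFinc (π i) 0 (by simp)
      refine ⟨((K + K : NNReal) : ℝ) * (|(w i 1).1| + |(w i 1).2.1| + |(w i 1).2.2|) / min m m',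
        eventually_nhds_arcs ht ht' fun a b ha hb => ?_⟩
      have h1 := h a ⟨ha, a.2⟩ 1 ⟨mem_of_mem_nhdsWithin (by simp) ht, by simp⟩ a.2.2
      have h2 := h' 0 ⟨mem_of_mem_nhdsWithin (by simp) ht', by simp⟩ b ⟨hb, b.2⟩ b.2.1
      rw [← hw] at h2
      refine displacement_bound_of_increasing (w := w i 1) (p := 1) (q := 0) (m := min m m') (by simp) (by simp) (hF1 i) (hD1 i)
        (hD i) (hD (π i)) (lt_min hm hm') a.2 b.2 a.2.2 b.2.1 ?_ ?_
      · exact (mul_le_mul_of_nonneg_right (min_le_left m m') (sub_nonneg.2 a.2.2)).trans h1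
      · exact (mul_le_mul_of_nonneg_right (min_le_right m m') (sub_nonneg.2 b.2.1)).trans h2
    -- Away from coincidences the distance of the positions is bounded below and the displacements
    -- are bounded.
    have hne : ∀ x y : Fin n × unitInterval, F x.1 x.2 ≠ F y.1 y.2 → ∃ C : ℝ, ∀ᶠ z in 𝓝 (x, y),
        ‖D z.1.1 z.1.2 - D z.2.1 z.2.2‖ ≤ C * ‖F z.1.1 z.1.2 - F z.2.1 z.2.2‖ := by
      intro x y hxy
      have c1 : Continuous fun z : (Fin n × unitInterval) × (Fin n × unitInterval) =>
          ‖D z.1.1 z.1.2 - D z.2.1 z.2.2‖ :=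
        ((hcD.comp continuous_fst).sub (hcD.comp continuous_snd)).norm
      have c2 : Continuous fun z : (Fin n × unitInterval) × (Fin n × unitInterval) =>
          ‖F z.1.1 z.1.2 - F z.2.1 z.2.2‖ :=
        ((hcF.comp continuous_fst).sub (hcF.comp continuous_snd)).norm
      set d := ‖F x.1 x.2 - F y.1 y.2‖ with hd
      have hd0 : 0 < d := norm_pos_iff.2 (sub_ne_zero.2 hxy)
      set B := ‖D x.1 x.2 - D y.1 y.2‖ with hB
      have hB0 : 0 ≤ B := norm_nonneg _
      refine ⟨(B + 1) / (d / 2), ?_⟩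
      filter_upwards [c1.continuousAt.eventually (Iio_mem_nhds (show _ < B + 1 by simp [hB])),
        c2.continuousAt.eventually (Ioi_mem_nhds (show d / 2 < _ by simp only [← hd]; linarith))] with z h1 h2
      calc _ ≤ B + 1 := h1.le
        _ = (B + 1) / (d / 2) * (d / 2) := by field_simp
        _ ≤ _ := mul_le_mul_of_nonneg_left h2.le (by positivity)
    rintro ⟨i, u⟩ ⟨j, v⟩
    by_cases hxy : F i u = F j v
    · rcases u.2.2.lt_or_eq with hu | hu <;> rcases v.2.2.lt_or_eq with hv | hv
      · obtain ⟨rfl, h⟩ := hFinj i j u ⟨u.2.1, hu⟩ v ⟨v.2.1, hv⟩ hxy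
        obtain rfl := Subtype.ext h
        exact hsame i u
      · obtain rfl : v = 1 := Subtype.ext hv
        rw [show ((1 : unitInterval) : ℝ) = 1 from rfl, hF1] at hxy
        obtain ⟨rfl, h⟩ := hFinj _ _ u ⟨u.2.1, hu⟩ 0 (by simp) hxy
        obtain rfl : u = 0 := Subtype.ext h
        obtain ⟨C, hC⟩ := hjunc j
        refine ⟨C, ?_⟩
        have := (continuous_swap.tendsto (((π j, 0) : Fin n × unitInterval), ((j, 1) : Fin n × unitInterval))).eventually hC
        filter_upwards [this] with z hz
        rw [norm_sub_rev, norm_sub_rev (F _ _)]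
        exact hz
      · obtain rfl : u = 1 := Subtype.ext hu
        rw [show ((1 : unitInterval) : ℝ) = 1 from rfl, hF1] at hxy
        obtain ⟨rfl, h⟩ := hFinj _ _ 0 (by simp) v ⟨v.2.1, hv⟩ hxy
        obtain rfl : v = 0 := Subtype.ext h.symm
        exact hjunc i
      · obtain rfl : u = 1 := Subtype.ext hu
        obtain rfl : v = 1 := Subtype.ext hv
        rw [show ((1 : unitInterval) : ℝ) = 1 from rfl, hF1, hF1] at hxy
        obtain ⟨h, -⟩ := hFinj _ _ 0 (by simp) 0 (by simp) hxy
        obtain rfl := π.injective h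
        exact hsame i 1
    · exact hne _ _ hxy
  obtain ⟨H, hH⟩ := main
  refine ⟨H, fun i u hu => ?_⟩
  have := hH (i, ⟨u, hu⟩)
  simpa [hDdef] using this

end Arcs

/-! ### From carried curves and strings to isotopic links -/

/-- Two links are isotopic if an ambient isotopy carries each component of the first into a component
of the second by an increasing reparametrization, and if each component of the second is met. -/
theorem Isotopic.of_carries {L M : OrientedLink} (H : AmbientIsotopy)
    (h : ∀ c, ∃ d, ∃ φ : ℝ → ℝ, Continuous φ ∧ StrictMono φ ∧
      ∀ t, H.homeo 1 (L.curve c t) = M.curve d (φ t))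
    (hs : ∀ d, ∃ c s t, H.homeo 1 (L.curve c s) = M.curve d t) : Isotopic L M := by
  choose e φ hφc hφm hφ using h
  have inj : ∀ {c c' t t'}, M.curve (e c) (φ c t) = M.curve (e c') (φ c' t') →
      c = c' ∧ ∃ m : ℤ, t = t' + m := fun {c c' t t'} hh => by
    rw [← hφ, ← hφ] at hh
    exact L.embedded _ _ _ _ ((H.homeo 1).injective hh)
  have hφ1 : ∀ c t, φ c (t + 1) = φ c t + 1 := by
    intro c t
    have h1 : M.curve (e c) (φ c (t + 1)) = M.curve (e c) (φ c t) := by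
      rw [← hφ, ← hφ, L.periodic_curve c t]
    obtain ⟨-, m, hm⟩ := M.embedded _ _ _ _ h1
    have hlt : φ c t < φ c (t + 1) := hφm c (by linarith)
    have hm0 : (0 : ℝ) < m := by linarith
    have hm1 : 0 < m := by exact_mod_cast hm0
    rcases eq_or_ne m 1 with rfl | hne
    · simpa using hm
    · have h2 : 2 ≤ m := by omega
      have h2' : (2 : ℝ) ≤ m := by exact_mod_cast h2
      -- If one period of the first curve covered the second at least twice, some point would
      -- already be reached again strictly inside the period, against the embeddedness of the first
      -- link.
      obtain ⟨t', ht', he⟩ := intermediate_value_Ioo (by linarith : t ≤ t + 1)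
        (hφc c).continuousOn (show φ c t + 1 ∈ Ioo (φ c t) (φ c (t + 1)) from
          ⟨by linarith, by linarith⟩)
      have h3 : M.curve (e c) (φ c t') = M.curve (e c) (φ c t) := by
        rw [he, M.periodic_curve]
      obtain ⟨-, k, hk⟩ := inj h3
      have k0 : (0 : ℝ) < k := by linarith [ht'.1]
      have k1 : (k : ℝ) < 1 := by linarith [ht'.2]
      have : 0 < k := by exact_mod_cast k0
      have : k < 1 := by exact_mod_cast k1
      omega
  have hsurj : ∀ c, Function.Surjective (φ c) := fun c => by
    -- Maps of degree one are unbounded in both directions.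
    let f : CircleDeg1Lift := ⟨⟨φ c, (hφm c).monotone⟩, hφ1 c⟩
    exact (hφc c).surjective f.tendsto_atTop f.tendsto_atBot
  have he : Function.Bijective e := by
    refine ⟨fun c c' hcc => ?_, fun d => ?_⟩
    · obtain ⟨t', ht'⟩ := hsurj c' (φ c 0)
      exact (inj (t := 0) (t' := t') (by rw [hcc, ht'])).1
    · obtain ⟨c, s, t, hcs⟩ := hs d
      rw [hφ] at hcs
      exact ⟨c, (M.embedded _ _ _ _ hcs).1⟩
  exact ⟨H, Equiv.ofBijective e he, fun c =>
    ⟨(hφm c).orderIsoOfSurjective _ (hsurj c), hφ1 c, fun t => hφ c t⟩⟩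

/-- Increasing functions on `[0,1]` which fit together at the ends are glued to an increasing
function on the line. -/
theorem continuous_strictMono_glue (θ : ℤ → ℝ → ℝ) (hc : ∀ z, ContinuousOn (θ z) (Icc 0 1))
    (hm : ∀ z, StrictMonoOn (θ z) (Icc 0 1)) (h1 : ∀ z, θ z 1 = θ (z + 1) 0) :
    Continuous (fun u => θ ⌊u⌋ (Int.fract u)) ∧ StrictMono fun u => θ ⌊u⌋ (Int.fract u) := by
  have heq : ∀ (z : ℤ) (u : ℝ), u ∈ Icc (z : ℝ) (z + 1) →
      θ ⌊u⌋ (Int.fract u) = θ z (u - z) := by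
    intro z u hu
    rcases hu.2.lt_or_eq with h | h
    · have hf : ⌊u⌋ = z := Int.floor_eq_iff.2 ⟨hu.1, h⟩
      rw [Int.fract, hf]
    · have hf : ⌊u⌋ = z + 1 := by
        rw [h]
        exact_mod_cast Int.floor_intCast (z + 1)
      have h0 : Int.fract u = 0 := by
        rw [Int.fract, hf, h]; push_cast; ring
      have h2 : u - z = 1 := by linarith
      rw [hf, h0, h2, h1]
  constructor
  · have hlf : LocallyFinite fun z : ℤ => Icc (z : ℝ) (z + 1) := by
      intro x
      refine ⟨Ioo (x - 1) (x + 1), Ioo_mem_nhds (by linarith) (by linarith), ?_⟩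
      refine (finite_Icc (⌊x⌋ - 2) (⌊x⌋ + 2)).subset ?_
      rintro m ⟨y, hy1, hy2⟩
      have a1 := Int.floor_le x
      have a2 := Int.lt_floor_add_one x
      have b1 : (m : ℝ) < ((⌊x⌋ + 2 : ℤ) : ℝ) := by push_cast; linarith [hy1.1, hy2.2]
      have b2 : ((⌊x⌋ - 2 - 1 : ℤ) : ℝ) < m := by push_cast; linarith [hy1.2, hy2.1]
      exact ⟨by have := Int.cast_lt.1 b2; omega, (Int.cast_lt.1 b1).le⟩
    refine hlf.continuous ?_ (fun _ => isClosed_Icc) fun z => ?_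
    · ext x
      simp only [mem_iUnion, mem_univ, iff_true]
      exact ⟨⌊x⌋, Int.floor_le x, (Int.lt_floor_add_one x).le⟩
    · refine ContinuousOn.congr (f := fun u => θ z (u - z)) ?_ fun u hu => heq z u hu
      exact (hc z).comp (by fun_prop) fun u hu => ⟨by linarith [hu.1], by linarith [hu.2]⟩
  · have hint : StrictMono fun z : ℤ => θ z 0 := strictMono_int_of_lt_succ fun z => by
      have := hm z (by simp : (0 : ℝ) ∈ Icc (0 : ℝ) 1) (by simp : (1 : ℝ) ∈ Icc (0 : ℝ) 1) one_pos
      rwa [h1] at this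
    intro u v huv
    have fu : Int.fract u ∈ Icc (0 : ℝ) 1 := ⟨Int.fract_nonneg u, (Int.fract_lt_one u).le⟩
    have fv : Int.fract v ∈ Icc (0 : ℝ) 1 := ⟨Int.fract_nonneg v, (Int.fract_lt_one v).le⟩
    rcases (Int.floor_le_floor huv.le).eq_or_lt with h | h
    · change θ ⌊u⌋ (Int.fract u) < θ ⌊v⌋ (Int.fract v)
      rw [← h]
      refine hm _ fu fv ?_
      rw [Int.fract, Int.fract, h]
      linarith
    · calc θ ⌊u⌋ (Int.fract u) < θ ⌊u⌋ 1 := hm _ fu (by simp) (Int.fract_lt_one u)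
        _ = θ (⌊u⌋ + 1) 0 := h1 _
        _ ≤ θ ⌊v⌋ 0 := hint.monotone (by omega)
        _ ≤ θ ⌊v⌋ (Int.fract v) := (hm _).monotoneOn (by simp) fv (Int.fract_nonneg v)

/-- Every sequence of integers indexed by `ℤ` is the sequence of differences of another. -/
theorem exists_int_sum (f : ℤ → ℤ) : ∃ C : ℤ → ℤ, C 0 = 0 ∧ ∀ z, C (z + 1) = C z + f z := by
  refine ⟨fun z => ∑ i ∈ Finset.range z.toNat, f i - ∑ i ∈ Finset.range (-z).toNat, f (-i - 1),
    by simp, fun z => ?_⟩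
  rcases lt_or_ge z 0 with h | h
  · have e1 : z.toNat = 0 := by omega
    have e2 : (z + 1).toNat = 0 := by omega
    obtain ⟨k, hk⟩ : ∃ k : ℕ, (-z).toNat = k + 1 := ⟨(-z).toNat - 1, by omega⟩
    have e3 : (-(z + 1)).toNat = k := by omega
    have e4 : -(k : ℤ) - 1 = z := by omega
    simp only [e1, e2, e3, hk, Finset.sum_range_succ, Finset.range_zero, Finset.sum_empty, e4]
    ring
  · have e1 : (-z).toNat = 0 := by omega
    have e2 : (-(z + 1)).toNat = 0 := by omega
    have e3 : (z + 1).toNat = z.toNat + 1 := by omega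
    have e4 : (z.toNat : ℤ) = z := by omega
    simp only [e1, e2, e3, Finset.sum_range_succ, Finset.range_zero, Finset.sum_empty, e4]
    ring

namespace GeometricBraid

variable {n n' : ℕ}

theorem run_add_intCast (b : GeometricBraid n) (i : Fin n) (u : ℝ) (m : ℤ) :
    b.run i (u + m) = b.run ((b.perm ^ m) i) u := by
  rw [run, Int.floor_add_intCast, Int.fract_add_intCast, zpow_add, Equiv.Perm.mul_apply,
    wrap_add_int, run]

theorem run_one (b : GeometricBraid n) (i : Fin n) : b.run i 1 = b.run (b.perm i) 0 := by
  have := b.run_add_intCast i 0 1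
  simpa using this

theorem run_of_mem_Icc (b : GeometricBraid n) (i : Fin n) {u : ℝ} (hu : u ∈ Icc (0 : ℝ) 1) :
    b.run i u = wrap (b.string i u) u := by
  have := b.run_eq_of_mem i 0 (u := u) (by simpa using hu)
  simpa using this

theorem exists_of_run_eq (b : GeometricBraid n) {i j : Fin n} {s t : ℝ}
    (h : b.run i s = b.run j t) : ∃ m : ℤ, s = t + m ∧ j = (b.perm ^ m) i := by
  obtain ⟨h1, h2⟩ := b.run_eq h
  refine ⟨⌊s⌋ - ⌊t⌋, by linarith, ?_⟩
  rw [sub_eq_neg_add, zpow_add, Equiv.Perm.mul_apply, h1, ← Equiv.Perm.mul_apply, ← zpow_add]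
  simp

theorem exists_run_eq_curve (b : GeometricBraid n) (j : Fin n) :
    ∃ d : b.closure.ι, ∃ ℓ : ℝ, 0 < ℓ ∧ ∃ m : ℤ, ∀ u, b.run j u = b.closure.curve d ((u + m) / ℓ) := by
  let d : b.closure.ι := Quotient.mk (Equiv.Perm.SameCycle.setoid b.perm) j
  have hd : b.perm.SameCycle d.out j := Quotient.exact (Quotient.out_eq d)
  obtain ⟨m, hm⟩ := hd
  have hpos : 0 < Function.minimalPeriod b.perm d.out :=
    Function.minimalPeriod_pos_of_mem_periodicPts
      (Function.Injective.mem_periodicPts b.perm.injective d.out)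
  have hpos' : (0 : ℝ) < Function.minimalPeriod b.perm d.out := by exact_mod_cast hpos
  refine ⟨d, _, hpos', m, fun u => ?_⟩
  change _ = b.run d.out (_ * (_ / _))
  rw [mul_div_cancel₀ _ hpos'.ne', run_add_intCast, hm]

/-- The closures of two braids are isotopic if an ambient isotopy carries each string of the first,
wrapped around the axis, into the path of a string of the second by an increasing
reparametrization, and if each string of the second is met. -/
theorem isotopic_closure_of_carries {a : GeometricBraid n} {b : GeometricBraid n'}
    (H : AmbientIsotopy)
    (h : ∀ i, ∃ j, ∃ ψ : ℝ → ℝ, ContinuousOn ψ (Icc 0 1) ∧ StrictMonoOn ψ (Icc 0 1) ∧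
      ∀ u ∈ Icc (0 : ℝ) 1, H.homeo 1 (wrap (a.string i u) u) = b.run j (ψ u))
    (hs : ∀ j, ∃ i, ∃ u ∈ Icc (0 : ℝ) 1, ∃ v, H.homeo 1 (wrap (a.string i u) u) = b.run j v) :
    Isotopic a.closure b.closure := by
  choose τ ψ hψc hψm hψ using h
  -- The string i ends where the next one starts, so their images agree there; in the second closed
  -- braid this fixes the paths and times up to a whole number of turns.
  have hcompat : ∀ i, ∃ m : ℤ, ψ i 1 = ψ (a.perm i) 0 + m ∧ τ (a.perm i) = (b.perm ^ m) (τ i) := by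
    intro i
    refine b.exists_of_run_eq ?_
    rw [← hψ i 1 (by simp), ← hψ _ 0 (by simp), ← run_of_mem_Icc _ _ (by simp),
      ← run_of_mem_Icc _ _ (by simp), run_one]
  choose N hN1 hN2 using hcompat
  have hglob : ∀ i, ∃ φ : ℝ → ℝ, Continuous φ ∧ StrictMono φ ∧
      ∀ u, H.homeo 1 (a.run i u) = b.run (τ i) (φ u) := by
    intro i
    -- The turns are summed along the orbit of i, so that the reparametrizations of the single
    -- strings fit together to one on the line.
    obtain ⟨C, hC0, hC⟩ := exists_int_sum fun z => N ((a.perm ^ z) i)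
    have hz : ∀ z : ℤ, (a.perm ^ (z + 1)) i = a.perm ((a.perm ^ z) i) := fun z => by
      rw [add_comm, zpow_add, zpow_one, Equiv.Perm.mul_apply]
    have hτ : ∀ z : ℤ, τ ((a.perm ^ z) i) = (b.perm ^ C z) (τ i) := by
      intro z
      induction z using Int.induction_on with
      | zero => simp [hC0]
      | succ k ih =>
        rw [hz, hN2, ih, hC, ← Equiv.Perm.mul_apply, ← zpow_add, add_comm]
      | pred k ih =>
        have e1 := hz (-k - 1)
        have e2 := hC (-k - 1)
        rw [sub_add_cancel] at e1 e2
        rw [e1, hN2, e2, add_comm, zpow_add, Equiv.Perm.mul_apply] at ih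
        exact (b.perm ^ _).injective ih
    let θ : ℤ → ℝ → ℝ := fun z u => ψ ((a.perm ^ z) i) u + C z
    obtain ⟨g1, g2⟩ := continuous_strictMono_glue θ
      (fun z => (hψc _).add continuousOn_const) (fun z => (hψm _).add_const _) (fun z => by
        simp only [θ]
        rw [hN1, hz, hC]
        push_cast
        ring)
    refine ⟨_, g1, g2, fun u => ?_⟩
    have hf : Int.fract u ∈ Icc (0 : ℝ) 1 := ⟨Int.fract_nonneg u, (Int.fract_lt_one u).le⟩
    have e : a.run i u = wrap (a.string ((a.perm ^ ⌊u⌋) i) (Int.fract u)) (Int.fract u) := by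
      conv_lhs => rw [← Int.fract_add_floor u]
      rw [run_add_intCast, run_of_mem_Icc _ _ hf]
    rw [e, hψ _ _ hf, hτ, ← run_add_intCast]
  refine Isotopic.of_carries H (fun c => ?_) fun d => ?_
  · obtain ⟨φ, h1, h2, h3⟩ := hglob c.out
    obtain ⟨d, ℓ, hℓ, m, hd⟩ := b.exists_run_eq_curve (τ c.out)
    have hpos : 0 < Function.minimalPeriod a.perm c.out :=
      Function.minimalPeriod_pos_of_mem_periodicPts
        (Function.Injective.mem_periodicPts a.perm.injective c.out)
    have hpos' : (0 : ℝ) < Function.minimalPeriod a.perm c.out := by exact_mod_cast hpos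
    refine ⟨d, fun t => (φ (Function.minimalPeriod a.perm c.out * t) + m) / ℓ, by fun_prop,
      fun s t hst => ?_, fun t => ?_⟩
    · have := h2 (mul_lt_mul_of_pos_left hst hpos')
      exact div_lt_div_of_pos_right (by linarith) hℓ
    · rw [← hd, ← h3]
      rfl
  · obtain ⟨i, u, hu, v, hv⟩ := hs d.out
    obtain ⟨c, ℓ, hℓ, m, hc⟩ := a.exists_run_eq_curve i
    have hpos : 0 < Function.minimalPeriod b.perm d.out :=
      Function.minimalPeriod_pos_of_mem_periodicPts
        (Function.Injective.mem_periodicPts b.perm.injective d.out)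
    have hpos' : (0 : ℝ) < Function.minimalPeriod b.perm d.out := by exact_mod_cast hpos
    refine ⟨c, (u + m) / ℓ, v / Function.minimalPeriod b.perm d.out, ?_⟩
    rw [← hc, run_of_mem_Icc _ _ hu, hv]
    change _ = b.run d.out (_ * (_ / _))
    rw [mul_div_cancel₀ _ hpos'.ne']

end GeometricBraid

/-! ### Rotations about the axis and scaling -/

namespace GeometricBraid

theorem exists_eq_wrap (p : Space) : (p.1 = 0 ∧ p.2.1 = 0) ∨ ∃ v u, p = wrap v u := by
  set z : ℂ := ⟨p.1, p.2.1⟩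
  by_cases h : z = 0
  · left
    exact ⟨congrArg Complex.re h, congrArg Complex.im h⟩
  · right
    refine ⟨(Real.log ‖z‖, p.2.2), z.arg / (2 * Real.pi), ?_⟩
    have hn : 0 < ‖z‖ := norm_pos_iff.2 h
    have e : 2 * Real.pi * (z.arg / (2 * Real.pi)) = z.arg := by
      have := Real.pi_pos
      field_simp
    simp only [wrap, e, Real.exp_log hn, Complex.norm_mul_cos_arg, Complex.norm_mul_sin_arg]
    rfl

end GeometricBraid

open GeometricBraid

/-- The angle around the axis, divided by `2 π`. -/
noncomputable def turn (p : Space) : ℝ := Complex.arg ⟨p.1, p.2.1⟩ / (2 * Real.pi)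

/-- The principal argument recovers the angle only up to whole turns, which a periodic function does
not see. -/
theorem turn_wrap {η : ℝ → ℝ} (hη : Function.Periodic η 1) (v : ℝ × ℝ) (u : ℝ) :
    η (turn (wrap v u)) = η u := by
  have h : wrap v u = wrap v (turn (wrap v u)) := by
    rcases exists_eq_wrap (wrap v u) with ⟨h1, h2⟩ | ⟨v', u', h⟩
    · exfalso
      have he := (Real.exp_pos v.1).ne'
      have e := Real.cos_sq_add_sin_sq (2 * Real.pi * u)
      simp only [wrap, mul_eq_zero, he, false_or] at h1 h2
      rw [h1, h2] at e
      norm_num at e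
    · set z : ℂ := ⟨(wrap v u).1, (wrap v u).2.1⟩ with hz
      have hn : ‖z‖ = Real.exp v.1 := by
        have e := Real.cos_sq_add_sin_sq (2 * Real.pi * u)
        have hsq : ‖z‖ ^ 2 = Real.exp v.1 ^ 2 := by
          rw [← Complex.normSq_eq_norm_sq, Complex.normSq_apply, hz]
          simp only [wrap]
          linear_combination Real.exp v.1 ^ 2 * e
        exact (pow_left_inj₀ (norm_nonneg _) (Real.exp_pos _).le two_ne_zero).1 hsq
      have e : 2 * Real.pi * turn (wrap v u) = z.arg := by
        have := Real.pi_pos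
        simp only [turn, ← hz]
        field_simp
      have h1 := Complex.norm_mul_cos_arg z
      have h2 := Complex.norm_mul_sin_arg z
      rw [hn] at h1 h2
      refine Eq.trans ?_ (by rw [wrap, e, h1, h2] : _ = wrap v (turn (wrap v u)))
      rfl
  obtain ⟨-, m, hm⟩ := wrap_eq h
  conv_rhs => rw [hm]
  have := hη.int_mul m (turn (wrap v u))
  rw [mul_one] at this
  exact this.symm

/-- The rotation of each point around the axis by `2 π η`, where `η` depends on its angle. -/
noncomputable def twist (η : ℝ → ℝ) (p : Space) : Space :=
  (p.1 * Real.cos (2 * Real.pi * η (turn p)) - p.2.1 * Real.sin (2 * Real.pi * η (turn p)),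
    p.1 * Real.sin (2 * Real.pi * η (turn p)) + p.2.1 * Real.cos (2 * Real.pi * η (turn p)), p.2.2)

theorem twist_wrap {η : ℝ → ℝ} (hη : Function.Periodic η 1) (v : ℝ × ℝ) (u : ℝ) :
    twist η (wrap v u) = wrap v (u + η u) := by
  simp only [twist, turn_wrap hη]
  simp only [wrap, mul_add, Real.cos_add, Real.sin_add]
  refine Prod.ext ?_ (Prod.ext ?_ rfl) <;> simp only <;> ring

theorem twist_axis {η : ℝ → ℝ} {p : Space} (h : p.1 = 0 ∧ p.2.1 = 0) : twist η p = p := by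
  refine Prod.ext ?_ (Prod.ext ?_ rfl) <;> simp [twist, h.1, h.2]

/-- The argument jumps along a half-plane, but is continuous off the axis as a map to `Real.Angle`,
and the periodic function factors through that quotient. -/
theorem continuousAt_comp_turn {η : ℝ → ℝ} (hη : Function.Periodic η 1) (hc : Continuous η)
    {p : Space} (hp : ¬ (p.1 = 0 ∧ p.2.1 = 0)) : ContinuousAt (fun q => η (turn q)) p := by
  have hper : Function.Periodic (fun x => η (x / (2 * Real.pi))) (2 * Real.pi) := fun x => by
    have := Real.pi_pos
    change η _ = η _
    rw [add_div, div_self (by positivity), hη]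
  let g : Real.Angle → ℝ := hper.lift
  have hg : Continuous g := by
    refine continuous_quot_lift _ ?_
    fun_prop
  have hz : (⟨p.1, p.2.1⟩ : ℂ) ≠ 0 := fun h => hp ⟨congrArg Complex.re h, congrArg Complex.im h⟩
  have hcz : Continuous fun q : Space => (⟨q.1, q.2.1⟩ : ℂ) := by
    have : (fun q : Space => (⟨q.1, q.2.1⟩ : ℂ)) = fun q => (q.1 : ℂ) + q.2.1 * Complex.I := by
      funext q
      exact Complex.ext (by simp) (by simp)
    rw [this]
    fun_prop
  have := ContinuousAt.comp (f := fun q : Space => (⟨q.1, q.2.1⟩ : ℂ)) (x := p)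
    (Complex.continuousAt_arg_coe_angle hz) hcz.continuousAt
  exact hg.continuousAt.comp this

theorem continuous_twist {η : ℝ → ℝ} (hη : Function.Periodic η 1) (hc : Continuous η) :
    Continuous fun x : ℝ × Space => twist (fun u => x.1 * η u) x.2 := by
  rw [continuous_iff_continuousAt]
  rintro ⟨t, p⟩
  by_cases hp : p.1 = 0 ∧ p.2.1 = 0
  · have hb : ∀ a b c : ℝ, |c| ≤ 1 → |a * c| ≤ |a| := fun a b c h => by
      rw [abs_mul]; exact mul_le_of_le_one_right (abs_nonneg _) h
    have key : Continuous fun x : ℝ × Space => |x.2.1| + |x.2.2.1| := by fun_prop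
    have key0 := key.tendsto (t, p)
    simp only [hp.1, hp.2, abs_zero, add_zero] at key0
    have h1 : Tendsto (fun x : ℝ × Space => (twist (fun u => x.1 * η u) x.2).1) (𝓝 (t, p)) (𝓝 0) := by
      refine squeeze_zero_norm (fun x => ?_) key0
      rw [Real.norm_eq_abs]
      refine (abs_sub _ _).trans (add_le_add ?_ ?_)
      · exact hb _ 0 _ (Real.abs_cos_le_one _)
      · exact hb _ 0 _ (Real.abs_sin_le_one _)
    have h2 : Tendsto (fun x : ℝ × Space => (twist (fun u => x.1 * η u) x.2).2.1) (𝓝 (t, p)) (𝓝 0) := by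
      refine squeeze_zero_norm (fun x => ?_) key0
      rw [Real.norm_eq_abs]
      refine (abs_add_le _ _).trans (add_le_add ?_ ?_)
      · exact hb _ 0 _ (Real.abs_sin_le_one _)
      · exact hb _ 0 _ (Real.abs_cos_le_one _)
    have h3 : Tendsto (fun x : ℝ × Space => (twist (fun u => x.1 * η u) x.2).2.2) (𝓝 (t, p))
        (𝓝 p.2.2) := by
      have : Continuous fun x : ℝ × Space => x.2.2.2 := by fun_prop
      exact this.tendsto (t, p)
    have h4 := h1.prodMk_nhds (h2.prodMk_nhds h3)
    rw [ContinuousAt]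
    have e : twist (fun u => t * η u) p = ((0 : ℝ), (0 : ℝ), p.2.2) := by
      rw [twist_axis hp]
      exact Prod.ext hp.1 (Prod.ext hp.2 rfl)
    simp only [e]
    exact h4
  · have h1 : ContinuousAt (fun x : ℝ × Space => η (turn x.2)) (t, p) :=
      ContinuousAt.comp (f := fun x : ℝ × Space => x.2) (x := (t, p))
        (continuousAt_comp_turn hη hc hp) continuous_snd.continuousAt
    have h2 : ContinuousAt (fun x : ℝ × Space => 2 * Real.pi * (x.1 * η (turn x.2))) (t, p) :=
      continuousAt_const.mul (continuous_fst.continuousAt.mul h1)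
    have hcos := Real.continuous_cos.continuousAt.comp h2
    have hsin := Real.continuous_sin.continuousAt.comp h2
    have hx : ContinuousAt (fun x : ℝ × Space => x.2.1) (t, p) := by fun_prop
    have hy : ContinuousAt (fun x : ℝ × Space => x.2.2.1) (t, p) := by fun_prop
    have hz : ContinuousAt (fun x : ℝ × Space => x.2.2.2) (t, p) := by fun_prop
    exact ((hx.mul hcos).sub (hy.mul hsin)).prodMk (((hx.mul hsin).add (hy.mul hcos)).prodMk hz)

theorem twist_twist {η ζ : ℝ → ℝ} (hη : Function.Periodic η 1) (hζ : Function.Periodic ζ 1)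
    (h : ∀ u, u + η u + ζ (u + η u) = u) (p : Space) : twist ζ (twist η p) = p := by
  rcases exists_eq_wrap p with hp | ⟨v, u, rfl⟩
  · rw [twist_axis hp, twist_axis hp]
  · rw [twist_wrap hη, twist_wrap hζ, h]

/-- Reparametrizing the angle around the axis. -/
theorem AmbientIsotopy.exists_angle {η : ℝ → ℝ} (hη : Function.Periodic η 1) (hc : Continuous η)
    (hm : StrictMono fun u => u + η u) :
    ∃ H : AmbientIsotopy, ∀ v u, H.homeo 1 (wrap v u) = wrap v (u + η u) := by
  have key : ∀ t : unitInterval, ∃ h : Space ≃ₜ Space, ∀ p, h p = twist (fun u => t * η u) p := by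
    intro t
    have hpt : Function.Periodic (fun u => (t : ℝ) * η u) 1 := fun u => by
      change (t : ℝ) * η (u + 1) = t * η u
      rw [hη]
    -- Each intermediate angle map is a convex combination of the identity and the final one, hence
    -- an increasing bijection whose inverse is again of this type.
    have hmt : StrictMono fun u => u + t * η u := by
      intro u v huv
      have h1 : u + η u < v + η v := hm huv
      rcases t.2.1.eq_or_lt with h0 | h0
      · simp [← h0, huv]
      · have h2 := mul_lt_mul_of_pos_left h1 h0
        have h3 := mul_le_mul_of_nonneg_left huv.le (sub_nonneg.2 t.2.2)
        change u + t * η u < v + t * η v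
        linarith
    have h1 : ∀ u, (u + 1) + t * η (u + 1) = u + t * η u + 1 := fun u => by rw [hη]; ring
    let f : CircleDeg1Lift := ⟨⟨_, hmt.monotone⟩, h1⟩
    have hsurj : Function.Surjective fun u => u + t * η u :=
      (by fun_prop : Continuous fun u => u + t * η u).surjective f.tendsto_atTop f.tendsto_atBot
    let e : ℝ ≃o ℝ := hmt.orderIsoOfSurjective _ hsurj
    have he : ∀ u, e u = u + t * η u := fun u => rfl
    have hpe : Function.Periodic (fun u => e.symm u - u) 1 := fun u => by
      have : e.symm (u + 1) = e.symm u + 1 := by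
        rw [OrderIso.symm_apply_eq, he, h1, ← he, OrderIso.apply_symm_apply]
      change e.symm (u + 1) - (u + 1) = e.symm u - u
      rw [this]
      ring
    have c1 := continuous_twist hpt (by fun_prop)
    have c2 := continuous_twist hpe (by have := e.symm.continuous; fun_prop)
    refine ⟨⟨⟨twist fun u => t * η u, twist fun u => e.symm u - u, ?_, ?_⟩, ?_, ?_⟩, fun p => rfl⟩
    · refine fun p => twist_twist hpt hpe (fun u => ?_) p
      rw [← he, OrderIso.symm_apply_apply]
      ring
    · refine fun p => twist_twist hpe hpt (fun u => ?_) p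
      have := he (e.symm u)
      rw [OrderIso.apply_symm_apply] at this
      rw [add_sub_cancel]
      exact this.symm
    · have := c1.comp (continuous_const.prodMk continuous_id : Continuous fun p : Space => ((1 : ℝ), p))
      simpa only [Function.comp_def, one_mul] using this
    · have := c2.comp (continuous_const.prodMk continuous_id : Continuous fun p : Space => ((1 : ℝ), p))
      simpa only [Function.comp_def, one_mul] using this
  choose h hh using key
  refine ⟨⟨h, ?_, ?_⟩, fun v u => ?_⟩
  · simp only [hh]
    exact (continuous_twist hη hc).comp
      ((continuous_subtype_val.comp continuous_fst).prodMk continuous_snd)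
  · ext1 p
    rw [hh]
    simp [twist]
  · change h 1 _ = _
    rw [hh]
    simpa using twist_wrap hη v u

/-- Scaling the distance from the axis. -/
theorem AmbientIsotopy.exists_scale (c : ℝ) :
    ∃ H : AmbientIsotopy, ∀ v u, H.homeo 1 (wrap v u) = wrap (v.1 + c, v.2) u := by
  have hexp : ∀ x : ℝ, Real.exp x * Real.exp (-x) = 1 := fun x => by
    rw [← Real.exp_add, add_neg_cancel, Real.exp_zero]
  refine ⟨⟨fun t => ⟨⟨fun p => (Real.exp (t * c) * p.1, Real.exp (t * c) * p.2.1, p.2.2),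
    fun p => (Real.exp (-(t * c)) * p.1, Real.exp (-(t * c)) * p.2.1, p.2.2), fun p => ?_,
    fun p => ?_⟩, by fun_prop, by fun_prop⟩, ?_, ?_⟩, fun v u => ?_⟩
  · have := hexp (t * c)
    refine Prod.ext ?_ (Prod.ext ?_ rfl)
    · change Real.exp (-(t * c)) * (Real.exp (t * c) * p.1) = p.1
      linear_combination p.1 * this
    · change Real.exp (-(t * c)) * (Real.exp (t * c) * p.2.1) = p.2.1
      linear_combination p.2.1 * this
  · have := hexp (t * c)
    refine Prod.ext ?_ (Prod.ext ?_ rfl)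
    · change Real.exp (t * c) * (Real.exp (-(t * c)) * p.1) = p.1
      linear_combination p.1 * this
    · change Real.exp (t * c) * (Real.exp (-(t * c)) * p.2.1) = p.2.1
      linear_combination p.2.1 * this
  · change Continuous fun x : unitInterval × Space =>
      (Real.exp (x.1 * c) * x.2.1, Real.exp (x.1 * c) * x.2.2.1, x.2.2.2)
    fun_prop
  · ext1 p
    refine Prod.ext ?_ (Prod.ext ?_ rfl) <;> simp
  · change (Real.exp (((1 : unitInterval) : ℝ) * c) * _, Real.exp (((1 : unitInterval) : ℝ) * c) * _, _) = _
    simp only [wrap, Real.exp_add, Icc.coe_one, one_mul]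
    refine Prod.ext ?_ (Prod.ext ?_ rfl) <;> simp only <;> ring

/-! ### Lipschitz arcs in cylindrical coordinates -/

/-- `f` is Lipschitz on `s`, for some constant. -/
def LipOn {E : Type*} [PseudoEMetricSpace E] (s : Set ℝ) (f : ℝ → E) : Prop :=
  ∃ K, LipschitzOnWith K f s

namespace LipOn

variable {E F : Type*}

theorem continuousOn [PseudoEMetricSpace E] {s : Set ℝ} {f : ℝ → E} (hf : LipOn s f) :
    ContinuousOn f s :=
  hf.choose_spec.continuousOn

theorem mono [PseudoEMetricSpace E] {s t : Set ℝ} {f : ℝ → E} (hf : LipOn t f) (h : s ⊆ t) :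
    LipOn s f :=
  hf.imp fun _ hK => hK.mono h

theorem congr [PseudoEMetricSpace E] {s : Set ℝ} {f g : ℝ → E} (hf : LipOn s f) (h : EqOn g f s) :
    LipOn s g :=
  hf.imp fun K hK x hx y hy => by rw [h hx, h hy]; exact hK hx hy

theorem prodMk [PseudoEMetricSpace E] [PseudoEMetricSpace F] {s : Set ℝ} {f : ℝ → E} {g : ℝ → F}
    (hf : LipOn s f) (hg : LipOn s g) : LipOn s fun x => (f x, g x) := by
  obtain ⟨K, hK⟩ := hf
  obtain ⟨K', hK'⟩ := hg
  exact ⟨_, hK.prodMk hK'⟩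

theorem comp [PseudoEMetricSpace E] {s t : Set ℝ} {f : ℝ → E} {g : ℝ → ℝ} (hf : LipOn t f)
    (hg : LipOn s g) (h : MapsTo g s t) : LipOn s fun x => f (g x) := by
  obtain ⟨K, hK⟩ := hf
  obtain ⟨K', hK'⟩ := hg
  exact ⟨_, hK.comp hK' h⟩

theorem glue [PseudoMetricSpace E] {a b c : ℝ} {f : ℝ → E} (h₁ : LipOn (Icc a b) f) (h₂ : LipOn (Icc b c) f) :
    LipOn (Icc a c) f := by
  obtain ⟨K, hK⟩ := h₁
  obtain ⟨K', hK'⟩ := h₂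
  have key : ∀ x ∈ Icc a c, ∀ y ∈ Icc a c, x ≤ y →
      dist (f x) (f y) ≤ (max K K' : NNReal) * dist x y := by
    intro x hx y hy hxy
    have m1 : (K : ℝ) ≤ (max K K' : NNReal) := by exact_mod_cast le_max_left K K'
    have m2 : (K' : ℝ) ≤ (max K K' : NNReal) := by exact_mod_cast le_max_right K K'
    rcases le_total y b with hyb | hyb
    · exact (hK.dist_le_mul x ⟨hx.1, hxy.trans hyb⟩ y ⟨hy.1, hyb⟩).trans
        (mul_le_mul_of_nonneg_right m1 dist_nonneg)
    rcases le_total b x with hxb | hxb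
    · exact (hK'.dist_le_mul x ⟨hxb, hx.2⟩ y ⟨hxb.trans hxy, hy.2⟩).trans
        (mul_le_mul_of_nonneg_right m2 dist_nonneg)
    have h1 := (hK.dist_le_mul x ⟨hx.1, hxb⟩ b ⟨hx.1.trans hxb, le_rfl⟩).trans
      (mul_le_mul_of_nonneg_right m1 dist_nonneg)
    have h2 := (hK'.dist_le_mul b ⟨le_rfl, hyb.trans hy.2⟩ y ⟨hyb, hy.2⟩).trans
      (mul_le_mul_of_nonneg_right m2 dist_nonneg)
    have e : dist x y = dist x b + dist b y := by
      rw [Real.dist_eq, Real.dist_eq, Real.dist_eq, abs_of_nonpos (sub_nonpos.2 hxy),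
        abs_of_nonpos (sub_nonpos.2 hxb), abs_of_nonpos (sub_nonpos.2 hyb)]
      ring
    rw [e, mul_add]
    exact (dist_triangle _ (f b) _).trans (add_le_add h1 h2)
  refine ⟨max K K', LipschitzOnWith.of_dist_le_mul fun x hx y hy => ?_⟩
  rcases le_total x y with h | h
  · exact key x hx y hy h
  · rw [dist_comm, dist_comm x]
    exact key y hy x hx h

variable [NormedAddCommGroup E] [NormedSpace ℝ E] [NormedAddCommGroup F] [NormedSpace ℝ F]

theorem contDiff_comp {s : Set ℝ} (hs : IsCompact s) {f : ℝ → E} {g : E → F}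
    (hf : LipOn s f) (hg : ContDiff ℝ 1 g) : LipOn s fun x => g (f x) := by
  obtain ⟨K', hK'⟩ := (hg.locallyLipschitz.locallyLipschitzOn).exists_lipschitzOnWith_of_compact
    (hs.image_of_continuousOn hf.continuousOn)
  obtain ⟨K, hK⟩ := hf
  exact ⟨_, hK'.comp hK (mapsTo_image f s)⟩

theorem of_contDiff {s : Set ℝ} (hs : IsCompact s) {f : ℝ → E} (hf : ContDiff ℝ 1 f) :
    LipOn s f :=
  (show LipOn s id from ⟨1, LipschitzWith.id.lipschitzOnWith⟩).contDiff_comp hs hf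

end LipOn

/-- Strict differentiability is what is needed here: both end points of the interval vary. -/
theorem IncreasingAt.of_hasStrictDerivAt {f : ℝ → ℝ} {f' u : ℝ} (h : HasStrictDerivAt f f' u)
    (hf' : 0 < f') : ∃ t ∈ 𝓝 u, ∀ a ∈ t, ∀ b ∈ t, a ≤ b → f' / 2 * (b - a) ≤ f b - f a := by
  have h1 := h.hasStrictFDerivAt.isLittleO.def (half_pos hf')
  rw [nhds_prod_eq] at h1
  obtain ⟨t, ht, h1⟩ := mem_prod_same_iff.1 h1
  refine ⟨t, ht, fun a ha b hb hab => ?_⟩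
  have := h1 (mk_mem_prod hb ha)
  simp only [mem_ofPred_eq, ContinuousLinearMap.toSpanSingleton_apply, smul_eq_mul, Real.norm_eq_abs] at this
  rw [abs_of_nonneg (sub_nonneg.2 hab)] at this
  have := (abs_le.1 this).1
  linarith

theorem increasingAt_of_hasStrictDerivAt {f : ℝ → ℝ} {f' u : ℝ} (h : HasStrictDerivAt f f' u)
    (hf' : 0 < f') : IncreasingAt f u := by
  obtain ⟨t, ht, h⟩ := IncreasingAt.of_hasStrictDerivAt h hf'
  exact ⟨_, half_pos hf', t, mem_nhdsWithin_of_mem_nhds ht, fun a ha b hb => h a ha.1 b hb.1⟩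

theorem IncreasingAt.congr {f g : ℝ → ℝ} {u : ℝ} {t : Set ℝ} (hf : IncreasingAt f u)
    (ht : t ∈ 𝓝[Icc 0 1] u) (h : EqOn g f t) : IncreasingAt g u := by
  obtain ⟨m, hm, t', ht', h'⟩ := hf
  refine ⟨m, hm, t' ∩ t, inter_mem ht' ht, fun a ha b hb hab => ?_⟩
  rw [h ha.1.2, h hb.1.2]
  exact h' a ⟨ha.1.1, ha.2⟩ b ⟨hb.1.1, hb.2⟩ hab

/-- The point with cylindrical coordinates `(ρ, 2 π θ, y)`. -/
noncomputable def cyl (ρ θ y : ℝ) : Space :=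
  (ρ * Real.cos (2 * Real.pi * θ), ρ * Real.sin (2 * Real.pi * θ), y)

theorem wrap_eq_cyl (v : ℝ × ℝ) (u : ℝ) : GeometricBraid.wrap v u = cyl (Real.exp v.1) u v.2 := rfl

theorem cyl_injective {ρ ρ' θ θ' y y' : ℝ} (hρ : 0 < ρ) (hρ' : 0 < ρ')
    (h : cyl ρ θ y = cyl ρ' θ' y') : ρ = ρ' ∧ y = y' ∧ ∃ m : ℤ, θ = θ' + m := by
  have h' : GeometricBraid.wrap (Real.log ρ, y) θ = GeometricBraid.wrap (Real.log ρ', y') θ' := by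
    simpa only [wrap_eq_cyl, Real.exp_log hρ, Real.exp_log hρ'] using h
  obtain ⟨h1, h2⟩ := GeometricBraid.wrap_eq h'
  simp only [Prod.mk.injEq] at h1
  exact ⟨Real.log_injOn_pos hρ hρ' h1.1, h1.2, h2⟩

theorem cyl_add_int (ρ θ y : ℝ) (m : ℤ) : cyl ρ (θ + m) y = cyl ρ θ y := by
  have : 2 * Real.pi * (θ + m) = 2 * Real.pi * θ + m * (2 * Real.pi) := by ring
  simp only [cyl, this, Real.cos_add_int_mul_two_pi, Real.sin_add_int_mul_two_pi]

theorem cyl_one (ρ y : ℝ) : cyl ρ 1 y = cyl ρ 0 y := by simpa using cyl_add_int ρ 0 y 1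

theorem LipOn.cyl {s : Set ℝ} (hs : IsCompact s) {ρ θ y : ℝ → ℝ} (hρ : LipOn s ρ) (hθ : LipOn s θ)
    (hy : LipOn s y) : LipOn s fun x => cyl (ρ x) (θ x) (y x) := by
  have h : ContDiff ℝ 1 fun p : ℝ × ℝ × ℝ => _root_.cyl p.1 p.2.1 p.2.2 := by
    unfold _root_.cyl; fun_prop
  exact (hρ.prodMk (hθ.prodMk hy)).contDiff_comp hs h

/-- The unit vector of increasing angle at the angle `2 π u`. -/
noncomputable def angleDir (u : ℝ) : Space :=
  (-Real.sin (2 * Real.pi * u), Real.cos (2 * Real.pi * u), 0)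

theorem angleDir_one : angleDir 1 = angleDir 0 := by simp [angleDir]

theorem dot_angleDir (u ρ θ y : ℝ) :
    dot (angleDir u) (cyl ρ θ y) = ρ * Real.sin (2 * Real.pi * (θ - u)) := by
  simp only [dot, angleDir, cyl, mul_sub, Real.sin_sub]
  ring

/-- The functional takes the value ρ sin(2π(θ - θ₀)). Near the point the sine grows at a positive
rate, while a change of ρ is multiplied by a sine that is almost 0. So it suffices that ρ is
Lipschitz. -/
theorem increasingAt_angleDir {ρ θ y : ℝ → ℝ} {u θ₀ c : ℝ} (hu : u ∈ Icc (0 : ℝ) 1)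
    (hρ : LipOn (Icc 0 1) ρ) (hρ0 : 0 < ρ u) (hθ : LipOn (Icc 0 1) θ) (hc : 0 < c)
    (hθc : ∀ a ∈ Icc (0 : ℝ) 1, ∀ b ∈ Icc (0 : ℝ) 1, a ≤ b → c * (b - a) ≤ θ b - θ a)
    (hθ₀ : ∃ m : ℤ, θ u = θ₀ + m) :
    IncreasingAt (fun x => dot (angleDir θ₀) (cyl (ρ x) (θ x) (y x))) u := by
  obtain ⟨m, hm⟩ := hθ₀
  obtain ⟨K, hK⟩ := hρ
  have hsin : ∀ x, Real.sin (2 * Real.pi * (θ x - θ₀)) = Real.sin (2 * Real.pi * (θ x - θ u)) := by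
    intro x
    have : 2 * Real.pi * (θ x - θ₀) = 2 * Real.pi * (θ x - θ u) + m * (2 * Real.pi) := by
      rw [hm]; ring
    rw [this, Real.sin_add_int_mul_two_pi]
  obtain ⟨t, ht, hst⟩ := IncreasingAt.of_hasStrictDerivAt (u := 0)
    ((Real.hasStrictDerivAt_sin 0).comp_of_eq 0 ((hasStrictDerivAt_id (0 : ℝ)).const_mul (2 * Real.pi))
      (by simp)) (by simp [Real.pi_pos])
  have hst' : ∀ a ∈ t, ∀ b ∈ t, a ≤ b →
      b - a ≤ Real.sin (2 * Real.pi * b) - Real.sin (2 * Real.pi * a) := fun a ha b hb hab => by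
    have h := hst a ha b hb hab
    simp only [id, Real.cos_zero, one_mul, mul_one, Function.comp_apply] at h
    have := Real.pi_gt_three
    nlinarith
  have hθu : ContinuousWithinAt θ (Icc 0 1) u := hθ.continuousOn u hu
  have hcs : ContinuousWithinAt (fun x => θ x - θ u) (Icc 0 1) u := hθu.sub continuousWithinAt_const
  have hcsin : ContinuousWithinAt (fun x => |Real.sin (2 * Real.pi * (θ x - θ u))|) (Icc 0 1) u :=
    (Real.continuous_sin.continuousAt.comp_continuousWithinAt (continuousWithinAt_const.mul hcs)).abs
  set r := ρ u / 2 with hr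
  have hr0 : 0 < r := half_pos hρ0
  -- Chosen so that K δ ≤ r c / 2: the variation of ρ eats at most half of the growth r c coming
  -- from the sine.
  set δ := r * c / (2 * (K + 1)) with hδ
  have hK0 : (0 : ℝ) ≤ K := K.2
  have hδ0 : 0 < δ := by positivity
  have e1 : ∀ᶠ x in 𝓝[Icc 0 1] u, θ x - θ u ∈ t :=
    hcs (by simpa using ht)
  have e2 : ∀ᶠ x in 𝓝[Icc 0 1] u, r < ρ x :=
    (hK.continuousOn u hu) (Ioi_mem_nhds (by simp only [hr]; linarith))
  have e3 : ∀ᶠ x in 𝓝[Icc 0 1] u, |Real.sin (2 * Real.pi * (θ x - θ u))| < δ :=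
    hcsin (Iio_mem_nhds (by simpa using hδ0))
  refine ⟨r * c / 2, by positivity, _, e1.and (e2.and e3), ?_⟩
  rintro a ⟨⟨ha1, ha2, ha3⟩, ha⟩ b ⟨⟨hb1, hb2, hb3⟩, hb⟩ hab
  simp only [dot_angleDir, hsin]
  have hd : 0 ≤ b - a := sub_nonneg.2 hab
  have h1 : c * (b - a) ≤ Real.sin (2 * Real.pi * (θ b - θ u)) - Real.sin (2 * Real.pi * (θ a - θ u)) := by
    have h2 := hθc a ha b hb hab
    have h3 := hst' _ ha1 _ hb1 (by nlinarith)
    linarith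
  have h4 : |ρ b - ρ a| ≤ K * (b - a) := by
    have := hK.norm_sub_le hb ha
    rwa [Real.norm_eq_abs, Real.norm_eq_abs, abs_of_nonneg hd] at this
  set sa := Real.sin (2 * Real.pi * (θ a - θ u))
  set sb := Real.sin (2 * Real.pi * (θ b - θ u))
  have h5 : |(ρ b - ρ a) * sa| ≤ K * (b - a) * δ := by
    rw [abs_mul]
    exact mul_le_mul h4 ha3.le (abs_nonneg _) (by positivity)
  have h6 : K * (b - a) * δ ≤ r * c / 2 * (b - a) := by
    have : K * δ ≤ r * c / 2 := by
      rw [hδ]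
      have : (K : ℝ) * (r * c / (2 * (K + 1))) = r * c / 2 * (K / (K + 1)) := by field_simp
      rw [this]
      refine mul_le_of_le_one_right (by positivity) ?_
      rw [div_le_one (by positivity)]
      linarith
    nlinarith
  have h7 : r * (c * (b - a)) ≤ ρ b * (sb - sa) :=
    mul_le_mul hb2.le h1 (by positivity) (hr0.le.trans hb2.le)
  have h8 := (abs_le.1 h5).1
  nlinarith

/-- Version of `AmbientIsotopy.exists_carries_arcs` for arcs with any Lipschitz constants. -/
theorem AmbientIsotopy.exists_carries_lipArcs {n : ℕ} (π : Equiv.Perm (Fin n))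
    (α β : Fin n → ℝ → Space)
    (hα : ∀ i, LipOn (Icc 0 1) (α i)) (hβ : ∀ i, LipOn (Icc 0 1) (β i))
    (hα1 : ∀ i, α i 1 = α (π i) 0) (hβ1 : ∀ i, β i 1 = β (π i) 0)
    (hinj : ∀ s ∈ Icc (0 : ℝ) 1, ∀ i j, ∀ u ∈ Ico (0 : ℝ) 1, ∀ v ∈ Ico (0 : ℝ) 1,
      (1 - s) • α i u + s • β i u = (1 - s) • α j v + s • β j v → i = j ∧ u = v)
    (w : Fin n → ℝ → Space) (hw : ∀ i, w i 1 = w (π i) 0)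
    (hincα : ∀ i, ∀ u ∈ Icc (0 : ℝ) 1, IncreasingAt (fun x => dot (w i u) (α i x)) u)
    (hincβ : ∀ i, ∀ u ∈ Icc (0 : ℝ) 1, IncreasingAt (fun x => dot (w i u) (β i x)) u) :
    ∃ H : AmbientIsotopy, ∀ i, ∀ u ∈ Icc (0 : ℝ) 1, H.homeo 1 (α i u) = β i u := by
  choose K hK using hα
  choose K' hK' using hβ
  refine AmbientIsotopy.exists_carries_arcs π α β (K := Finset.univ.sup fun i => max (K i) (K' i))
    (fun i => (hK i).weaken ?_) (fun i => (hK' i).weaken ?_) hα1 hβ1 hinj w hw hincα hincβ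
  · exact (le_max_left _ (K' i)).trans (Finset.le_sup (f := fun i => max (K i) (K' i)) (Finset.mem_univ i))
  · exact (le_max_right (K i) _).trans (Finset.le_sup (f := fun i => max (K i) (K' i)) (Finset.mem_univ i))

/-- Strings wrapped around the axis may be moved linearly in their distance from the axis and in
their height, as long as they stay disjoint at each angle. -/
theorem AmbientIsotopy.exists_carries_cyl {n : ℕ} (π : Equiv.Perm (Fin n))
    (ρ y ρ' y' : Fin n → ℝ → ℝ)
    (hρ : ∀ i, LipOn (Icc 0 1) (ρ i)) (hy : ∀ i, LipOn (Icc 0 1) (y i))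
    (hρ' : ∀ i, LipOn (Icc 0 1) (ρ' i)) (hy' : ∀ i, LipOn (Icc 0 1) (y' i))
    (hpos : ∀ i, ∀ u ∈ Icc (0 : ℝ) 1, 0 < ρ i u) (hpos' : ∀ i, ∀ u ∈ Icc (0 : ℝ) 1, 0 < ρ' i u)
    (hρ1 : ∀ i, ρ i 1 = ρ (π i) 0) (hy1 : ∀ i, y i 1 = y (π i) 0)
    (hρ1' : ∀ i, ρ' i 1 = ρ' (π i) 0) (hy1' : ∀ i, y' i 1 = y' (π i) 0)
    (hdisj : ∀ s ∈ Icc (0 : ℝ) 1, ∀ u ∈ Ico (0 : ℝ) 1, ∀ i j,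
      (1 - s) * ρ i u + s * ρ' i u = (1 - s) * ρ j u + s * ρ' j u →
      (1 - s) * y i u + s * y' i u = (1 - s) * y j u + s * y' j u → i = j) :
    ∃ H : AmbientIsotopy, ∀ i, ∀ u ∈ Icc (0 : ℝ) 1,
      H.homeo 1 (cyl (ρ i u) u (y i u)) = cyl (ρ' i u) u (y' i u) := by
  have hid : LipOn (Icc (0 : ℝ) 1) fun u => u := LipOn.of_contDiff isCompact_Icc contDiff_id
  refine AmbientIsotopy.exists_carries_lipArcs π (fun i u => cyl (ρ i u) u (y i u))
    (fun i u => cyl (ρ' i u) u (y' i u)) (fun i => (hρ i).cyl isCompact_Icc hid (hy i))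
    (fun i => (hρ' i).cyl isCompact_Icc hid (hy' i)) (fun i => ?_) (fun i => ?_) ?_
    (fun _ u => angleDir u) (fun _ => angleDir_one) ?_ ?_
  · simp only [cyl_one, hρ1, hy1]
  · simp only [cyl_one, hρ1', hy1']
  · intro s hs i j u hu v hv h
    -- Points at the same angle are combined within their half-plane, so embeddedness of the
    -- homotopy reduces to disjointness of the strings at each angle.
    have hcomb : ∀ i u, (1 - s) • cyl (ρ i u) u (y i u) + s • cyl (ρ' i u) u (y' i u) =
        cyl ((1 - s) * ρ i u + s * ρ' i u) u ((1 - s) * y i u + s * y' i u) := fun i u => by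
      simp only [cyl]
      refine Prod.ext ?_ (Prod.ext ?_ ?_) <;>
        simp only [Prod.fst_add, Prod.snd_add, Prod.smul_fst, Prod.smul_snd, smul_eq_mul] <;> ring
    have hp : ∀ i, ∀ u ∈ Ico (0 : ℝ) 1, 0 < (1 - s) * ρ i u + s * ρ' i u := fun i u hu => by
      have h1 := hpos i u ⟨hu.1, hu.2.le⟩
      have h2 := hpos' i u ⟨hu.1, hu.2.le⟩
      rcases hs.1.eq_or_lt with h0 | h0
      · simpa [← h0] using h1
      · have := mul_nonneg (sub_nonneg.2 hs.2) h1.le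
        have := mul_pos h0 h2
        linarith
    simp only [hcomb] at h
    obtain ⟨h1, h2, m, hm⟩ := cyl_injective (hp i u hu) (hp j v hv) h
    have huv : u = v := by
      have a1 : (m : ℝ) < 1 := by linarith [hu.2, hv.1]
      have a2 : (-1 : ℝ) < m := by linarith [hu.1, hv.2]
      have a3 : m < 1 := by exact_mod_cast a1
      have a4 : -1 < m := by exact_mod_cast a2
      obtain rfl : m = 0 := by omega
      simpa using hm
    subst huv
    exact ⟨hdisj s hs u hu i j h1 h2, rfl⟩
  · exact fun i u hu => increasingAt_angleDir hu (hρ i) (hpos i u hu) hid one_pos (fun a _ b _ _ => by simp)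
      ⟨0, by simp⟩
  · exact fun i u hu => increasingAt_angleDir hu (hρ' i) (hpos' i u hu) hid one_pos (fun a _ b _ _ => by simp)
      ⟨0, by simp⟩

/-! ### Reparametrizations, deformations and conjugation of braids -/

namespace GeometricBraid

variable {n : ℕ}

theorem mul_string_left (a b : GeometricBraid n) (i : Fin n) {t : ℝ} (ht : t ≤ 1 / 2) :
    (a * b).string i t = a.string i (2 * t) := if_pos ht

theorem mul_string_right (a b : GeometricBraid n) (i : Fin n) {t : ℝ} (ht : 1 / 2 ≤ t) :
    (a * b).string i t = b.string (a.perm i) (2 * t - 1) := by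
  rcases ht.eq_or_lt with rfl | h
  · rw [mul_string_left _ _ _ le_rfl]
    norm_num [a.string_one, b.string_zero]
  · exact if_neg (not_le.2 h)

theorem mul_perm_apply (a b : GeometricBraid n) (i : Fin n) :
    (a * b).perm i = b.perm (a.perm i) := rfl

theorem mul_perm (a b : GeometricBraid n) : (a * b).perm = b.perm * a.perm := rfl

/-- All strings are Lipschitz. -/
def IsLip (b : GeometricBraid n) : Prop := ∀ i, LipOn (Icc 0 1) (b.string i)

theorem IsLip.mul {a b : GeometricBraid n} (ha : a.IsLip) (hb : b.IsLip) : (a * b).IsLip := by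
  intro i
  refine LipOn.glue (b := 1 / 2) ?_ ?_
  · refine LipOn.congr (f := fun t => a.string i (2 * t)) ?_
      fun t ht => mul_string_left a b i ht.2
    exact (ha i).comp (LipOn.of_contDiff isCompact_Icc (by fun_prop))
      fun t ht => ⟨by linarith [ht.1], by linarith [ht.2]⟩
  · refine LipOn.congr (f := fun t => b.string (a.perm i) (2 * t - 1)) ?_
      fun t ht => mul_string_right a b i ht.1
    exact (hb _).comp (LipOn.of_contDiff isCompact_Icc (by fun_prop))
      fun t ht => ⟨by linarith [ht.1], by linarith [ht.2]⟩

theorem isLip_one : (1 : GeometricBraid n).IsLip := fun _ =>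
  ⟨0, (LipschitzWith.const _).lipschitzOnWith⟩

theorem isLip_ofPerm (σ : Equiv.Perm (Fin n)) : (ofPerm σ).IsLip := fun i => by
  refine LipOn.of_contDiff isCompact_Icc ?_
  change ContDiff ℝ 1 fun t : ℝ => ((i : ℕ) + t * (((σ i : ℕ) : ℝ) - (i : ℕ)),
    t * (1 - t) * (((σ i : ℕ) : ℝ) - (i : ℕ)))
  fun_prop

/-- `b` is `a`, run through at another speed. -/
def Reparam (a b : GeometricBraid n) : Prop :=
  a.perm = b.perm ∧ ∃ φ : ℝ → ℝ, ContinuousOn φ (Icc 0 1) ∧ StrictMonoOn φ (Icc 0 1) ∧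
    φ 0 = 0 ∧ φ 1 = 1 ∧ ∀ i, ∀ t ∈ Icc (0 : ℝ) 1, a.string i t = b.string i (φ t)

/-- Time along the strings is the angle in the closure, so a change of speed is a rotation by an
amount depending on the angle. -/
theorem Reparam.isotopic {a b : GeometricBraid n} (h : Reparam a b) :
    Isotopic a.closure b.closure := by
  obtain ⟨hp, φ, hc, hm, h0, h1, hs⟩ := h
  obtain ⟨g1, g2⟩ := continuous_strictMono_glue (fun z u => z + φ u)
    (fun z => continuousOn_const.add hc) (fun z => hm.const_add _)
    (fun z => by push_cast; rw [h0, h1]; ring)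
  set g : ℝ → ℝ := fun u => (⌊u⌋ : ℝ) + φ (Int.fract u) with hg
  have hg1 : ∀ u ∈ Icc (0 : ℝ) 1, g u = φ u := by
    intro u hu
    rcases hu.2.lt_or_eq with h | rfl
    · have hf : ⌊u⌋ = 0 := Int.floor_eq_iff.2 ⟨by simpa using hu.1, by simpa using h⟩
      simp [hg, hf, Int.fract_eq_self.2 ⟨hu.1, h⟩]
    · simp [hg, h0, h1]
  obtain ⟨H, hH⟩ := AmbientIsotopy.exists_angle (η := fun u => g u - u) (fun u => by
    simp only [hg, Int.floor_add_one, Int.fract_add_one]; push_cast; ring) (g1.sub continuous_id)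
    (by simpa only [add_sub_cancel] using g2)
  simp only [add_sub_cancel] at hH
  have key : ∀ i, ∀ u ∈ Icc (0 : ℝ) 1, H.homeo 1 (wrap (a.string i u) u) = b.run i (φ u) := by
    intro i u hu
    have hφ : φ u ∈ Icc (0 : ℝ) 1 := by
      rw [← h0, ← h1]
      exact ⟨hm.monotoneOn (by simp) hu hu.1, hm.monotoneOn hu (by simp) hu.2⟩
    rw [hH, hg1 u hu, hs i u hu, run_of_mem_Icc _ _ hφ]
  exact isotopic_closure_of_carries H (fun i => ⟨i, φ, hc, hm, key i⟩)
    fun j => ⟨j, 0, by simp, _, key j 0 (by simp)⟩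

theorem Reparam.mul_right {a b : GeometricBraid n} (h : Reparam a b) (c : GeometricBraid n) :
    Reparam (a * c) (b * c) := by
  obtain ⟨hp, φ, hc, hm, h0, h1, hs⟩ := h
  have hφ : ∀ u ∈ Icc (0 : ℝ) 1, φ u ∈ Icc (0 : ℝ) 1 := fun u hu => by
    rw [← h0, ← h1]
    exact ⟨hm.monotoneOn (by simp) hu hu.1, hm.monotoneOn hu (by simp) hu.2⟩
  refine ⟨by rw [mul_perm, mul_perm, hp], fun t => if t ≤ 1 / 2 then φ (2 * t) / 2 else t, ?_, ?_,
    by simp [h0], by norm_num, ?_⟩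
  · refine ContinuousOn.if ?_ ?_ ?_
    · rintro t ⟨-, ht⟩
      have ht' : t = 1 / 2 := by
        have := frontier_le_subset_eq continuous_id continuous_const ht
        simpa using this
      subst ht'
      norm_num [h1]
    · refine (hc.comp (by fun_prop) ?_).div_const 2
      rintro t ⟨⟨h0, -⟩, ht⟩
      have ht' : t ≤ 1 / 2 := by
        have : IsClosed {t : ℝ | t ≤ 1 / 2} := isClosed_le continuous_id continuous_const
        rwa [this.closure_eq] at ht
      exact ⟨by linarith, by linarith⟩
    · exact continuousOn_id
  · intro s hs t ht hst
    by_cases h1' : s ≤ 1 / 2 <;> by_cases h2 : t ≤ 1 / 2 <;> simp only [h1', h2, if_true, if_false]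
    · have := hm (a := 2 * s) (b := 2 * t) ⟨by linarith [hs.1], by linarith⟩
        ⟨by linarith [ht.1], by linarith⟩ (by linarith)
      linarith
    · have := (hφ (2 * s) ⟨by linarith [hs.1], by linarith⟩).2
      linarith
    · linarith
    · exact hst
  · intro i t ht
    by_cases h2 : t ≤ 1 / 2
    · simp only [h2, if_true]
      have ht2 : 2 * t ∈ Icc (0 : ℝ) 1 := ⟨by linarith [ht.1], by linarith⟩
      have := (hφ _ ht2).2
      rw [mul_string_left _ _ _ h2, mul_string_left _ _ _ (by linarith), hs i _ ht2]
      congr 1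
      ring
    · simp only [h2, if_false]
      have := (not_le.1 h2).le
      rw [mul_string_right _ _ _ this, mul_string_right _ _ _ this, hp]

theorem Reparam.mul_left {a b : GeometricBraid n} (h : Reparam a b) (c : GeometricBraid n) :
    Reparam (c * a) (c * b) := by
  obtain ⟨hp, φ, hc, hm, h0, h1, hs⟩ := h
  have hφ : ∀ u ∈ Icc (0 : ℝ) 1, φ u ∈ Icc (0 : ℝ) 1 := fun u hu => by
    rw [← h0, ← h1]
    exact ⟨hm.monotoneOn (by simp) hu hu.1, hm.monotoneOn hu (by simp) hu.2⟩
  refine ⟨by rw [mul_perm, mul_perm, hp],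
    fun t => if t ≤ 1 / 2 then t else (φ (2 * t - 1) + 1) / 2, ?_, ?_,
    by simp, by norm_num [h1], ?_⟩
  · refine ContinuousOn.if ?_ continuousOn_id ?_
    · rintro t ⟨-, ht⟩
      have ht' : t = 1 / 2 := by
        have := frontier_le_subset_eq continuous_id continuous_const ht
        simpa using this
      subst ht'
      norm_num [h0]
    · refine ((hc.comp (by fun_prop) ?_).add continuousOn_const).div_const 2
      rintro t ⟨⟨-, h1⟩, ht⟩
      have ht' : 1 / 2 ≤ t := by
        have hs : {t : ℝ | ¬ t ≤ 1 / 2} ⊆ {t : ℝ | 1 / 2 ≤ t} := fun t h => (not_le.1 h).le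
        exact closure_minimal hs (isClosed_le continuous_const continuous_id) ht
      exact ⟨by linarith, by linarith⟩
  · intro s hs t ht hst
    by_cases h1' : s ≤ 1 / 2 <;> by_cases h2 : t ≤ 1 / 2 <;> simp only [h1', h2, if_true, if_false]
    · exact hst
    · have h3 := hm (a := 0) (b := 2 * t - 1) (by simp) ⟨by linarith, by linarith [ht.2]⟩ (by linarith)
      rw [h0] at h3
      linarith
    · linarith
    · have := hm (a := 2 * s - 1) (b := 2 * t - 1) ⟨by linarith, by linarith [hs.2]⟩
        ⟨by linarith, by linarith [ht.2]⟩ (by linarith)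
      linarith
  · intro i t ht
    by_cases h2 : t ≤ 1 / 2
    · simp only [h2, if_true]
      rw [mul_string_left _ _ _ h2, mul_string_left _ _ _ h2]
    · simp only [h2, if_false]
      have ht1 := (not_le.1 h2).le
      have ht2 : 2 * t - 1 ∈ Icc (0 : ℝ) 1 := ⟨by linarith, by linarith [ht.2]⟩
      have := (hφ _ ht2).1
      rw [mul_string_right _ _ _ ht1, mul_string_right _ _ _ (by linarith), hs _ _ ht2]
      congr 1
      ring

theorem reparam_assoc (a b c : GeometricBraid n) : Reparam (a * (b * c)) (a * b * c) := by
  -- In a(bc) the factors occupy the times up to 1/2, 3/4 and 1, in (ab)c up to 1/4, 1/2 and 1. The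
  -- piecewise linear map between them has slopes 1/2, 1, 2, so it is convex and the maximum of its
  -- three pieces.
  refine ⟨by simp only [mul_perm, mul_assoc], fun t => max (t / 2) (max (t - 1 / 4) (2 * t - 1)),
    by fun_prop, ?_, by norm_num, by norm_num, fun i t ht => ?_⟩
  · intro s _ t _ hst
    exact max_lt_max (by linarith) (max_lt_max (by linarith) (by linarith))
  · rcases le_total t (1 / 2) with h1 | h1
    · have e : max (t / 2) (max (t - 1 / 4) (2 * t - 1)) = t / 2 :=
        max_eq_left (max_le (by linarith) (by linarith))
      simp only [e]
      rw [mul_string_left _ _ _ h1, mul_string_left _ _ _ (by linarith),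
        mul_string_left _ _ _ (by linarith)]
      congr 1
      ring
    rcases le_total t (3 / 4) with h2 | h2
    · have e : max (t / 2) (max (t - 1 / 4) (2 * t - 1)) = t - 1 / 4 := by
        rw [max_eq_left (by linarith : 2 * t - 1 ≤ t - 1 / 4), max_eq_right (by linarith)]
      simp only [e]
      rw [mul_string_right _ _ _ h1, mul_string_left _ _ _ (by linarith),
        mul_string_left _ _ _ (by linarith), mul_string_right _ _ _ (by linarith)]
      congr 1
      ring
    · have e : max (t / 2) (max (t - 1 / 4) (2 * t - 1)) = 2 * t - 1 := by
        rw [max_eq_right (by linarith : t - 1 / 4 ≤ 2 * t - 1), max_eq_right (by linarith)]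
      simp only [e]
      rw [mul_string_right _ _ _ h1, mul_string_right _ _ _ (by linarith),
        mul_string_right _ _ _ (by linarith), mul_perm_apply]

/-- `p` is to the left of `q` and `p'` to the left of `q'`, or `p` is below `q` and `p'` below `q'`
(not necessarily strictly in both cases). -/
def Separated (p q p' q' : ℝ × ℝ) : Prop :=
  (p.1 < q.1 ∧ p'.1 < q'.1) ∨ (p.2 ≤ q.2 ∧ p'.2 ≤ q'.2 ∧ (p.2 < q.2 ∨ p'.2 < q'.2))

/-- At all times, any two strings of `a` lie in the same order as those of `b`, with respect to
one of the two coordinates. -/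
def Deformation (a b : GeometricBraid n) : Prop :=
  a.perm = b.perm ∧ a.IsLip ∧ b.IsLip ∧ ∀ t ∈ Icc (0 : ℝ) 1, ∀ i j, i ≠ j →
    Separated (a.string i t) (a.string j t) (b.string i t) (b.string j t) ∨
    Separated (a.string j t) (a.string i t) (b.string j t) (b.string i t)

/-- The homotopy is linear in the distance exp x from the axis, not in x; since exp is increasing,
the order of the first coordinates is preserved all the same. For the heights one strict inequality
is enough because the stage is neither the first nor the last. -/
theorem Separated.ne {p q p' q' : ℝ × ℝ} (h : Separated p q p' q') {s : ℝ} (hs0 : 0 < s)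
    (hs1 : s < 1)
    (h1 : (1 - s) * Real.exp p.1 + s * Real.exp p'.1 = (1 - s) * Real.exp q.1 + s * Real.exp q'.1)
    (h2 : (1 - s) * p.2 + s * p'.2 = (1 - s) * q.2 + s * q'.2) : False := by
  have hs : 0 < 1 - s := sub_pos.2 hs1
  rcases h with ⟨a1, a2⟩ | ⟨a1, a2, a3⟩
  · have e1 := mul_lt_mul_of_pos_left (Real.exp_lt_exp.2 a1) hs
    have e2 := mul_lt_mul_of_pos_left (Real.exp_lt_exp.2 a2) hs0
    linarith
  · have e1 := mul_le_mul_of_nonneg_left a1 hs.le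
    have e2 := mul_le_mul_of_nonneg_left a2 hs0.le
    rcases a3 with a3 | a3
    · have e3 := mul_lt_mul_of_pos_left a3 hs
      linarith
    · have e3 := mul_lt_mul_of_pos_left a3 hs0
      linarith

theorem Deformation.isotopic {a b : GeometricBraid n} (h : Deformation a b) :
    Isotopic a.closure b.closure := by
  obtain ⟨hp, ha, hb, hsep⟩ := h
  have hexp : ∀ {c : GeometricBraid n}, c.IsLip → ∀ i,
      LipOn (Icc 0 1) fun t => Real.exp (c.string i t).1 := fun hc i =>
    (hc i).contDiff_comp isCompact_Icc (g := fun p : ℝ × ℝ => Real.exp p.1) (by fun_prop)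
  have hsnd : ∀ {c : GeometricBraid n}, c.IsLip → ∀ i,
      LipOn (Icc 0 1) fun t => (c.string i t).2 := fun hc i =>
    (hc i).contDiff_comp isCompact_Icc (g := fun p : ℝ × ℝ => p.2) (by fun_prop)
  have hdisj : ∀ s ∈ Icc (0 : ℝ) 1, ∀ u ∈ Ico (0 : ℝ) 1, ∀ i j,
      (1 - s) * Real.exp (a.string i u).1 + s * Real.exp (b.string i u).1 =
        (1 - s) * Real.exp (a.string j u).1 + s * Real.exp (b.string j u).1 →
      (1 - s) * (a.string i u).2 + s * (b.string i u).2 =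
        (1 - s) * (a.string j u).2 + s * (b.string j u).2 → i = j := by
    intro s hs u hu i j h1 h2
    have hu' : u ∈ Icc (0 : ℝ) 1 := ⟨hu.1, hu.2.le⟩
    rcases hs.1.eq_or_lt with rfl | hs0
    · simp only [sub_zero, one_mul, zero_mul, add_zero] at h1 h2
      exact a.disjoint u hu' i j (Prod.ext (Real.exp_injective h1) h2)
    rcases hs.2.eq_or_lt with rfl | hs1
    · simp only [sub_self, one_mul, zero_mul, zero_add] at h1 h2
      exact b.disjoint u hu' i j (Prod.ext (Real.exp_injective h1) h2)
    by_contra hij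
    rcases hsep u hu' i j hij with h | h
    · exact h.ne hs0 hs1 h1 h2
    · exact h.ne hs0 hs1 h1.symm h2.symm
  obtain ⟨H, hH⟩ := AmbientIsotopy.exists_carries_cyl a.perm
    (fun i t => Real.exp (a.string i t).1) (fun i t => (a.string i t).2)
    (fun i t => Real.exp (b.string i t).1) (fun i t => (b.string i t).2)
    (hexp ha) (hsnd ha) (hexp hb) (hsnd hb) (fun _ _ _ => Real.exp_pos _)
    (fun _ _ _ => Real.exp_pos _) (fun i => by rw [string_one, string_zero])
    (fun i => by rw [string_one, string_zero]) (fun i => by rw [string_one, string_zero, hp])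
    (fun i => by rw [string_one, string_zero, hp]) hdisj
  have key : ∀ i, ∀ u ∈ Icc (0 : ℝ) 1, H.homeo 1 (wrap (a.string i u) u) = b.run i u :=
    fun i u hu => by rw [run_of_mem_Icc _ _ hu, wrap_eq_cyl, hH i u hu, wrap_eq_cyl]
  exact isotopic_closure_of_carries H
    (fun i => ⟨i, id, continuousOn_id, strictMono_id.strictMonoOn _, key i⟩)
    fun j => ⟨j, 0, by simp, _, key j 0 (by simp)⟩

theorem Deformation.mul_right {a b c : GeometricBraid n} (h : Deformation a b) (hc : c.IsLip) :
    Deformation (a * c) (b * c) := by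
  obtain ⟨hp, ha, hb, hsep⟩ := h
  refine ⟨by rw [mul_perm, mul_perm, hp], ha.mul hc, hb.mul hc, fun t ht i j hij => ?_⟩
  rcases le_total t (1 / 2) with h | h
  · simp only [mul_string_left _ _ _ h]
    exact hsep _ ⟨by linarith [ht.1], by linarith⟩ i j hij
  · simp only [mul_string_right _ _ _ h, hp]
    have hne := c.disjoint (2 * t - 1) ⟨by linarith, by linarith [ht.2]⟩ (b.perm i) (b.perm j)
    have hne' : c.string (b.perm i) (2 * t - 1) ≠ c.string (b.perm j) (2 * t - 1) :=
      fun he => hij (b.perm.injective (hne he))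
    -- Nothing moves in this half, and distinct points of the plane differ in one of the
    -- coordinates.
    rcases lt_trichotomy (c.string (b.perm i) (2 * t - 1)).1 (c.string (b.perm j) (2 * t - 1)).1
      with h1 | h1 | h1
    · exact Or.inl (Or.inl ⟨h1, h1⟩)
    · rcases lt_trichotomy (c.string (b.perm i) (2 * t - 1)).2 (c.string (b.perm j) (2 * t - 1)).2
        with h2 | h2 | h2
      · exact Or.inl (Or.inr ⟨h2.le, h2.le, Or.inl h2⟩)
      · exact absurd (Prod.ext h1 h2) hne'
      · exact Or.inr (Or.inr ⟨h2.le, h2.le, Or.inl h2⟩)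
    · exact Or.inr (Or.inl ⟨h1, h1⟩)

theorem Deformation.mul_left {a b c : GeometricBraid n} (h : Deformation a b) (hc : c.IsLip) :
    Deformation (c * a) (c * b) := by
  obtain ⟨hp, ha, hb, hsep⟩ := h
  refine ⟨by rw [mul_perm, mul_perm, hp], hc.mul ha, hc.mul hb, fun t ht i j hij => ?_⟩
  rcases le_total t (1 / 2) with h | h
  · simp only [mul_string_left _ _ _ h]
    have hne := c.disjoint (2 * t) ⟨by linarith [ht.1], by linarith⟩ i j
    have hne' : c.string i (2 * t) ≠ c.string j (2 * t) := fun he => hij (hne he)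
    rcases lt_trichotomy (c.string i (2 * t)).1 (c.string j (2 * t)).1 with h1 | h1 | h1
    · exact Or.inl (Or.inl ⟨h1, h1⟩)
    · rcases lt_trichotomy (c.string i (2 * t)).2 (c.string j (2 * t)).2 with h2 | h2 | h2
      · exact Or.inl (Or.inr ⟨h2.le, h2.le, Or.inl h2⟩)
      · exact absurd (Prod.ext h1 h2) hne'
      · exact Or.inr (Or.inr ⟨h2.le, h2.le, Or.inl h2⟩)
    · exact Or.inr (Or.inl ⟨h1, h1⟩)
  · simp only [mul_string_right _ _ _ h]
    exact hsep _ ⟨by linarith, by linarith [ht.2]⟩ _ _ fun he => hij (c.perm.injective he)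

/-- Equivalence of braids, generated by deformations and reparametrizations. -/
inductive Equiv : GeometricBraid n → GeometricBraid n → Prop
  | refl (a) : Equiv a a
  | symm {a b} : Equiv a b → Equiv b a
  | trans {a b c} : Equiv a b → Equiv b c → Equiv a c
  | deformation {a b} : Deformation a b → Equiv a b
  | reparam {a b} : Reparam a b → Equiv a b

theorem Equiv.isotopic {a b : GeometricBraid n} (h : Equiv a b) :
    Isotopic a.closure b.closure := by
  induction h with
  | refl a => exact Isotopic.refl _
  | symm _ ih => exact ih.symm
  | trans _ _ ih ih' => exact ih.trans ih'
  | deformation h => exact h.isotopic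
  | reparam h => exact h.isotopic

theorem Equiv.mul_right {a b c : GeometricBraid n} (h : Equiv a b) (hc : c.IsLip) :
    Equiv (a * c) (b * c) := by
  induction h with
  | refl a => exact .refl _
  | symm _ ih => exact ih.symm
  | trans _ _ ih ih' => exact ih.trans ih'
  | deformation h => exact .deformation (h.mul_right hc)
  | reparam h => exact .reparam (h.mul_right c)

theorem Equiv.mul_left {a b c : GeometricBraid n} (h : Equiv a b) (hc : c.IsLip) :
    Equiv (c * a) (c * b) := by
  induction h with
  | refl a => exact .refl _
  | symm _ ih => exact ih.symm
  | trans _ _ ih ih' => exact ih.trans ih'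
  | deformation h => exact .deformation (h.mul_left hc)
  | reparam h => exact .reparam (h.mul_left c)

/-- Conjugate braids have isotopic closures. -/
theorem isotopic_closure_mul_comm (a b : GeometricBraid n) :
    Isotopic (a * b).closure (b * a).closure := by
  -- Half a turn around the axis exchanges the two factors.
  obtain ⟨H, hH⟩ := AmbientIsotopy.exists_angle (η := fun _ => 1 / 2) (fun _ => rfl)
    continuous_const (fun _ _ h => by simpa using h)
  have key : ∀ i, ∀ u ∈ Icc (0 : ℝ) 1, H.homeo 1 (wrap ((a * b).string (b.perm i) u) u) =
      (b * a).run i (u + 1 / 2) := by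
    intro i u hu
    rw [hH]
    rcases le_total u (1 / 2) with h | h
    · rw [run_of_mem_Icc _ _ ⟨by linarith [hu.1], by linarith⟩, mul_string_left _ _ _ h,
        mul_string_right _ _ _ (by linarith [hu.1])]
      congr 2
      ring
    · rw [run_eq_of_mem _ _ 1 ⟨by push_cast; linarith, by push_cast; linarith [hu.2]⟩,
        mul_string_right _ _ _ h, mul_string_left _ _ _ (by push_cast; linarith [hu.2]), zpow_one,
        mul_perm_apply]
      congr 2
      push_cast
      ring
  have hmono : StrictMonoOn (fun u : ℝ => u + 1 / 2) (Icc 0 1) := fun _ _ _ _ h => by simpa using h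
  refine isotopic_closure_of_carries H (fun i => ⟨b.perm.symm i, fun u => u + 1 / 2,
    by fun_prop, hmono, fun u hu => ?_⟩) fun j => ⟨b.perm j, 0, by simp, _, key j 0 (by simp)⟩
  rw [← key _ u hu, _root_.Equiv.apply_symm_apply]

end GeometricBraid

/-! ### Permutation braids and their products -/

namespace GeometricBraid

variable {n : ℕ}

theorem ofPerm_string (σ : Equiv.Perm (Fin n)) (i : Fin n) (t : ℝ) :
    (ofPerm σ).string i t = ((i : ℕ) + t * (((σ i : ℕ) : ℝ) - (i : ℕ)),
      t * (1 - t) * (((σ i : ℕ) : ℝ) - (i : ℕ))) := rfl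

theorem lerp_lt {p q P Q t : ℝ} (hpq : p < q) (hPQ : P < Q) (ht : t ∈ Icc (0 : ℝ) 1) :
    p + t * (P - p) < q + t * (Q - q) := by
  rcases ht.1.eq_or_lt with rfl | h0
  · simpa using hpq
  · have h1 := mul_lt_mul_of_pos_left hPQ h0
    have h2 := mul_le_mul_of_nonneg_left hpq.le (sub_nonneg.2 ht.2)
    linarith

theorem cast_fin_lt {i j : Fin n} (h : i < j) : ((i : ℕ) : ℝ) < ((j : ℕ) : ℝ) := by
  exact_mod_cast h

theorem ofPerm_left {σ : Equiv.Perm (Fin n)} {i j : Fin n} (hij : i < j) (h : σ i < σ j) {t : ℝ}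
    (ht : t ∈ Icc (0 : ℝ) 1) : ((ofPerm σ).string i t).1 < ((ofPerm σ).string j t).1 :=
  lerp_lt (cast_fin_lt hij) (cast_fin_lt h) ht

theorem ofPerm_over {σ : Equiv.Perm (Fin n)} {i j : Fin n} (hij : i < j) (h : σ j < σ i) {t : ℝ}
    (ht : t ∈ Ioo (0 : ℝ) 1) : ((ofPerm σ).string j t).2 < ((ofPerm σ).string i t).2 := by
  rw [ofPerm_string, ofPerm_string]
  refine mul_lt_mul_of_pos_left ?_ (mul_pos ht.1 (sub_pos.2 ht.2))
  have := cast_fin_lt hij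
  have := cast_fin_lt h
  linarith

/-- A braid in which two strings cross only if this is required by the permutation, and then the
string going to the right passes over, is equivalent to the permutation braid. -/
theorem equiv_ofPerm {b : GeometricBraid n} (hb : b.IsLip)
    (hx : ∀ i j, i < j → b.perm i < b.perm j → ∀ t ∈ Icc (0 : ℝ) 1,
      (b.string i t).1 < (b.string j t).1)
    (hy : ∀ i j, i < j → b.perm j < b.perm i → ∀ t ∈ Icc (0 : ℝ) 1,
      (b.string i t).1 = (b.string j t).1 → (b.string j t).2 < (b.string i t).2) :
    Equiv b (ofPerm b.perm) := by
  set σ := b.perm with hσ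
  have hov : ∀ i j, i < j → σ j < σ i → ∀ t ∈ Icc (0 : ℝ) 1,
      (b.string i t).1 = (b.string j t).1 → ((ofPerm σ).string j t).2 < ((ofPerm σ).string i t).2 := by
    intro i j hij h t ht hxt
    refine ofPerm_over hij h ⟨lt_of_le_of_ne ht.1 ?_, lt_of_le_of_ne ht.2 ?_⟩
    · rintro rfl
      rw [string_zero, string_zero] at hxt
      exact (cast_fin_lt hij).ne hxt
    · rintro rfl
      rw [string_one, string_one] at hxt
      exact (cast_fin_lt h).ne' hxt
  -- The deformation goes through the braid with the plane diagram of `b` and the heights of the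
  -- permutation braid: first only heights change, then only the diagram.
  let c : GeometricBraid n :=
    { perm := σ
      string := fun i t => ((b.string i t).1, ((ofPerm σ).string i t).2)
      continuousOn_string := fun i =>
        (continuous_fst.comp_continuousOn (b.continuousOn_string i)).prodMk
          (continuous_snd.comp_continuousOn ((ofPerm σ).continuousOn_string i))
      string_zero := fun i => by rw [string_zero, string_zero]
      string_one := fun i => by rw [string_one, string_one]; rfl
      disjoint := fun t ht i j h => by
        simp only [Prod.mk.injEq] at h
        by_contra hne
        wlog hij : i < j generalizing i j
        · exact this j i ⟨h.1.symm, h.2.symm⟩ (Ne.symm hne) (lt_of_le_of_ne (not_lt.1 hij) (Ne.symm hne))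
        rcases lt_or_gt_of_ne (σ.injective.ne hne) with h1 | h1
        · exact (hx i j hij h1 t ht).ne h.1
        · exact (hov i j hij h1 t ht h.1).ne' h.2 }
  have hc : c.IsLip := fun i => LipOn.prodMk
    ((hb i).contDiff_comp isCompact_Icc (g := Prod.fst) contDiff_fst)
    ((isLip_ofPerm σ i).contDiff_comp isCompact_Icc (g := Prod.snd) contDiff_snd)
  have h₁ : Deformation b c := by
    refine ⟨rfl, hb, hc, fun t ht i j hne => ?_⟩
    wlog hij : i < j generalizing i j
    · exact (this j i hne.symm (lt_of_le_of_ne (not_lt.1 hij) hne.symm)).symm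
    rcases lt_trichotomy (b.string i t).1 (b.string j t).1 with h | h | h
    · exact Or.inl (Or.inl ⟨h, h⟩)
    · rcases lt_or_gt_of_ne (σ.injective.ne hne) with h1 | h1
      · exact absurd h (hx i j hij h1 t ht).ne
      · have h2 := hy i j hij h1 t ht h
        have h3 := hov i j hij h1 t ht h
        exact Or.inr (Or.inr ⟨h2.le, h3.le, Or.inl h2⟩)
    · exact Or.inr (Or.inl ⟨h, h⟩)
  have h₂ : Deformation c (ofPerm σ) := by
    refine ⟨rfl, hc, isLip_ofPerm σ, fun t ht i j hne => ?_⟩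
    wlog hij : i < j generalizing i j
    · exact (this j i hne.symm (lt_of_le_of_ne (not_lt.1 hij) hne.symm)).symm
    rcases lt_or_gt_of_ne (σ.injective.ne hne) with h1 | h1
    · exact Or.inl (Or.inl ⟨hx i j hij h1 t ht, ofPerm_left hij h1 ht⟩)
    -- At the ends all heights of the permutation braid vanish, so there the strings are separated
    -- by their places.
    · rcases ht.1.eq_or_lt with rfl | h0
      · refine Or.inl (Or.inl ⟨?_, ?_⟩)
        · change (b.string i 0).1 < (b.string j 0).1
          rw [string_zero, string_zero]
          exact cast_fin_lt hij
        · rw [string_zero, string_zero]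
          exact cast_fin_lt hij
      rcases ht.2.eq_or_lt with rfl | h2
      · refine Or.inr (Or.inl ⟨?_, ?_⟩)
        · change (b.string j 1).1 < (b.string i 1).1
          rw [string_one, string_one]
          exact cast_fin_lt h1
        · rw [string_one, string_one]
          exact cast_fin_lt h1
      · have h3 := ofPerm_over hij h1 ⟨h0, h2⟩
        exact Or.inr (Or.inr ⟨h3.le, h3.le, Or.inl h3⟩)
  exact (Equiv.deformation h₁).trans (.deformation h₂)

/-- By hypothesis a pair crossed by σ is not crossed back by τ. So in the product two strings cross
only if the permutation demands it, and only once, in one of the two halves. -/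
theorem ofPerm_mul_ofPerm {σ τ : Equiv.Perm (Fin n)}
    (h : ∀ i j, i < j → σ j < σ i → τ (σ j) < τ (σ i)) :
    Equiv (ofPerm σ * ofPerm τ) (ofPerm (τ * σ)) := by
  have hp : ∀ i, (ofPerm σ).perm i = σ i := fun _ => rfl
  refine equiv_ofPerm (b := ofPerm σ * ofPerm τ) ((isLip_ofPerm σ).mul (isLip_ofPerm τ))
    (fun i j hij h1 t ht => ?_) fun i j hij h1 t ht => ?_
  · change τ (σ i) < τ (σ j) at h1
    have h2 : σ i < σ j := by
      rcases lt_trichotomy (σ i) (σ j) with h2 | h2 | h2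
      · exact h2
      · exact absurd (σ.injective h2) hij.ne
      · exact absurd h1 (h i j hij h2).asymm
    rcases le_total t (1 / 2) with h3 | h3
    · rw [mul_string_left _ _ _ h3, mul_string_left _ _ _ h3]
      exact ofPerm_left hij h2 ⟨by linarith [ht.1], by linarith⟩
    · rw [mul_string_right _ _ _ h3, mul_string_right _ _ _ h3]
      exact ofPerm_left h2 h1 ⟨by linarith, by linarith [ht.2]⟩
  · change τ (σ j) < τ (σ i) at h1
    rcases lt_or_gt_of_ne (σ.injective.ne hij.ne) with h2 | h2
    · rcases le_total t (1 / 2) with h3 | h3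
      · rw [mul_string_left _ _ _ h3, mul_string_left _ _ _ h3]
        exact fun he => absurd he (ofPerm_left hij h2 ⟨by linarith [ht.1], by linarith⟩).ne
      · rw [mul_string_right _ _ _ h3, mul_string_right _ _ _ h3]
        intro he
        refine ofPerm_over h2 h1 ⟨lt_of_le_of_ne (by linarith) ?_, lt_of_le_of_ne (by linarith [ht.2]) ?_⟩
        · intro h0
          rw [← h0, string_zero, string_zero] at he
          exact (cast_fin_lt h2).ne he
        · intro h0
          rw [h0, string_one, string_one] at he
          exact (cast_fin_lt h1).ne' he
    · rcases le_total t (1 / 2) with h3 | h3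
      · rw [mul_string_left _ _ _ h3, mul_string_left _ _ _ h3]
        intro he
        refine ofPerm_over hij h2 ⟨lt_of_le_of_ne (by linarith [ht.1]) ?_, lt_of_le_of_ne (by linarith) ?_⟩
        · intro h0
          rw [← h0, string_zero, string_zero] at he
          exact (cast_fin_lt hij).ne he
        · intro h0
          rw [h0, string_one, string_one] at he
          exact (cast_fin_lt h2).ne' he
      · rw [mul_string_right _ _ _ h3, mul_string_right _ _ _ h3]
        exact fun he => absurd he
          (ofPerm_left (σ := τ) h2 h1 ⟨by linarith, by linarith [ht.2]⟩).ne'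

theorem ofPerm_one : Equiv (ofPerm (1 : Equiv.Perm (Fin n))) 1 := by
  refine .deformation ⟨rfl, isLip_ofPerm 1, isLip_one, fun t ht i j hne => ?_⟩
  wlog hij : i < j generalizing i j
  · exact (this j i hne.symm (lt_of_le_of_ne (not_lt.1 hij) hne.symm)).symm
  exact Or.inl (Or.inl ⟨ofPerm_left hij hij ht, cast_fin_lt hij⟩)

/-- A product of permutation braids. -/
inductive IsWord : GeometricBraid n → Prop
  | one : IsWord 1
  | ofPerm (σ) : IsWord (ofPerm σ)
  | mul {a b} : IsWord a → IsWord b → IsWord (a * b)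

theorem IsWord.isLip {b : GeometricBraid n} (h : IsWord b) : b.IsLip := by
  induction h with
  | one => exact isLip_one
  | ofPerm σ => exact isLip_ofPerm σ
  | mul _ _ ih ih' => exact ih.mul ih'

theorem one_mul_one : Equiv (1 * 1 : GeometricBraid n) 1 := by
  refine .deformation ⟨rfl, isLip_one.mul isLip_one, isLip_one, fun t ht i j hne => ?_⟩
  have e : ∀ i, (1 * 1 : GeometricBraid n).string i t = basePoint i := fun i => by
    rcases le_total t (1 / 2) with h | h
    · rw [mul_string_left _ _ _ h]; rfl
    · rw [mul_string_right _ _ _ h]; rfl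
  rw [e, e]
  rcases lt_or_gt_of_ne hne with h | h
  · exact Or.inl (Or.inl ⟨cast_fin_lt h, cast_fin_lt h⟩)
  · exact Or.inr (Or.inl ⟨cast_fin_lt h, cast_fin_lt h⟩)

/-- Not a change of speed, since the strings rest during the first half. For a single permutation
braid the rest is absorbed as the permutation braid of the identity, and associativity passes this
on to products. -/
theorem IsWord.one_mul {b : GeometricBraid n} (h : IsWord b) : Equiv (1 * b) b := by
  induction h with
  | one => exact one_mul_one
  | ofPerm σ =>
    refine (ofPerm_one.symm.mul_right (isLip_ofPerm σ)).trans ?_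
    simpa using ofPerm_mul_ofPerm (σ := 1) (τ := σ) fun i j hij h => absurd h hij.asymm
  | mul ha hb ih ih' => exact (Equiv.reparam (reparam_assoc _ _ _)).trans (ih.mul_right hb.isLip)

theorem IsWord.mul_one {b : GeometricBraid n} (h : IsWord b) : Equiv (b * 1) b := by
  induction h with
  | one => exact one_mul_one
  | ofPerm σ =>
    refine (ofPerm_one.symm.mul_left (isLip_ofPerm σ)).trans ?_
    simpa using ofPerm_mul_ofPerm (σ := σ) (τ := 1) fun i j hij h => h
  | mul ha hb ih ih' =>
    exact (Equiv.reparam (reparam_assoc _ _ _)).symm.trans (ih'.mul_left ha.isLip)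

/-- Equivalence of products of permutation braids. -/
instance wordSetoid (n : ℕ) : Setoid {b : GeometricBraid n // IsWord b} where
  r a b := Equiv a.1 b.1
  iseqv := ⟨fun _ => .refl _, fun h => h.symm, fun h h' => h.trans h'⟩

end GeometricBraid

/-! ### The monoid of positive words and the link of a class -/

/-- The monoid of equivalence classes of products of permutation braids. -/
def BraidMonoid (n : ℕ) : Type := Quotient (wordSetoid n)

/-- Isotopy of oriented links. -/
instance linkSetoid : Setoid OrientedLink where
  r := Isotopic
  iseqv := ⟨Isotopic.refl, Isotopic.symm, Isotopic.trans⟩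

namespace BraidMonoid

variable {n : ℕ}

/-- The class of a product of permutation braids. -/
def mk (b : GeometricBraid n) (h : IsWord b) : BraidMonoid n := Quotient.mk _ ⟨b, h⟩

theorem mk_eq {a b : GeometricBraid n} {ha : IsWord a} {hb : IsWord b}
    (h : GeometricBraid.Equiv a b) : mk a ha = mk b hb := Quotient.sound h

noncomputable instance : Monoid (BraidMonoid n) where
  mul := Quotient.map₂ (fun a b => ⟨a.1 * b.1, a.2.mul b.2⟩) fun a a' h b b' h' =>
    (h.mul_right b.2.isLip).trans (h'.mul_left a'.2.isLip)
  one := mk 1 .one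
  mul_assoc a b c := by
    induction a, b, c using Quotient.inductionOn₃
    exact Quotient.sound (GeometricBraid.Equiv.reparam (reparam_assoc _ _ _)).symm
  one_mul a := by
    induction a using Quotient.inductionOn with | _ a => exact Quotient.sound a.2.one_mul
  mul_one a := by
    induction a using Quotient.inductionOn with | _ a => exact Quotient.sound a.2.mul_one

/-- The class of a permutation braid. -/
noncomputable def of (σ : Equiv.Perm (Fin n)) : BraidMonoid n := mk (ofPerm σ) (.ofPerm σ)

theorem of_one : of (1 : Equiv.Perm (Fin n)) = 1 := mk_eq ofPerm_one

theorem of_mul_of {σ τ : Equiv.Perm (Fin n)}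
    (h : ∀ i j, i < j → σ j < σ i → τ (σ j) < τ (σ i)) : of σ * of τ = of (τ * σ) :=
  mk_eq (ha := .mul (.ofPerm σ) (.ofPerm τ)) (hb := .ofPerm _) (ofPerm_mul_ofPerm h)

/-- The isotopy class of the closure. -/
noncomputable def link (x : BraidMonoid n) : Quotient linkSetoid :=
  Quotient.lift (fun b : {b : GeometricBraid n // IsWord b} => Quotient.mk linkSetoid b.1.closure)
    (fun _ _ h => Quotient.sound (GeometricBraid.Equiv.isotopic h)) x

theorem link_mul_comm (x y : BraidMonoid n) : (x * y).link = (y * x).link := by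
  induction x, y using Quotient.inductionOn₂
  exact Quotient.sound (isotopic_closure_mul_comm _ _)

end BraidMonoid

/-! ### Destabilization: shaping the loop -/

namespace GeometricBraid

/-- The distance from the axis along the loop that is removed in a destabilization. -/
noncomputable def loopRadius (v : ℝ) : ℝ := 4 * Real.exp 1 / 3 * max (1 / 4) |v|

/-- The height along the loop that is removed in a destabilization. -/
noncomputable def loopHeight (v : ℝ) : ℝ :=
  4 * Real.exp 1 / 3 * (max (1 / 4) |v| * Real.sin (2 * Real.pi * v) + v)

theorem loopRadius_pos (v : ℝ) : 0 < loopRadius v := by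
  have : 0 < max (1 / 4) |v| := lt_max_of_lt_left (by norm_num)
  have := Real.exp_pos 1
  unfold loopRadius
  positivity

theorem loopRadius_le {v : ℝ} (hv : |v| ≤ 3 / 4) : loopRadius v ≤ Real.exp 1 := by
  have : max (1 / 4) |v| ≤ 3 / 4 := max_le (by norm_num) hv
  have := Real.exp_pos 1
  unfold loopRadius
  nlinarith

theorem loopRadius_lt {v : ℝ} (hv : |v| < 3 / 4) : loopRadius v < Real.exp 1 := by
  have : max (1 / 4) |v| < 3 / 4 := max_lt (by norm_num) hv
  have := Real.exp_pos 1
  unfold loopRadius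
  nlinarith

theorem loopRadius_neg (v : ℝ) : loopRadius (-v) = loopRadius v := by simp [loopRadius]

theorem loopHeight_neg (v : ℝ) : loopHeight (-v) = -loopHeight v := by
  simp only [loopHeight, abs_neg, mul_neg, Real.sin_neg]
  ring

theorem loopRadius_end : loopRadius (3 / 4) = Real.exp 1 := by
  have : max (1 / 4 : ℝ) |3 / 4| = 3 / 4 := by norm_num [abs_of_pos]
  rw [loopRadius, this]
  ring

theorem loopHeight_end : loopHeight (3 / 4) = 0 := by
  have h1 : max (1 / 4 : ℝ) |3 / 4| = 3 / 4 := by norm_num [abs_of_pos]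
  have h2 : 2 * Real.pi * (3 / 4) = Real.pi / 2 + Real.pi := by ring
  rw [loopHeight, h1, h2, Real.sin_add_pi, Real.sin_pi_div_two]
  ring

/-- Here the height is a multiple of v (1 + sin 2πv), and the sine exceeds -1 before v = 3/4. So the
last stretch of the loop runs above the plane of the diagram and, by symmetry, the first stretch
below it, which is the crossing of the removed generator. -/
theorem loopHeight_pos {v : ℝ} (h1 : 1 / 4 < v) (h2 : v < 3 / 4) : 0 < loopHeight v := by
  have hm : max (1 / 4) |v| = v := by rw [abs_of_pos (by linarith), max_eq_right h1.le]
  have hpi := Real.pi_pos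
  have hs : Real.sin (2 * Real.pi * v - Real.pi) < 1 := by
    rw [← Real.sin_pi_div_two]
    exact Real.sin_lt_sin_of_lt_of_le_pi_div_two (by nlinarith) le_rfl (by nlinarith)
  rw [Real.sin_sub_pi] at hs
  have := Real.exp_pos 1
  rw [loopHeight, hm]
  have : 0 < v * Real.sin (2 * Real.pi * v) + v := by nlinarith
  positivity

theorem lipOn_loop {s : Set ℝ} (hs : IsCompact s) (a c : ℝ) :
    LipOn s (fun u => loopRadius (a * u + c)) ∧ LipOn s fun u => loopHeight (a * u + c) := by
  have h1 : LipOn s fun u => a * u + c := LipOn.of_contDiff hs (by fun_prop)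
  have h2 : LipOn s fun u => max (1 / 4) |a * u + c| := by
    obtain ⟨K, hK⟩ := h1
    refine ⟨1 * (1 * K), ?_⟩
    have habs : LipschitzWith 1 fun x : ℝ => |x| := lipschitzWith_one_norm
    have hmax : LipschitzWith 1 fun x : ℝ => max (1 / 4) x := LipschitzWith.id.const_max _
    exact hmax.comp_lipschitzOnWith (habs.comp_lipschitzOnWith hK)
  have h3 := h2.prodMk h1
  constructor
  · exact h3.contDiff_comp hs (g := fun p : ℝ × ℝ => 4 * Real.exp 1 / 3 * p.1) (by fun_prop)
  · exact h3.contDiff_comp hs (g := fun p : ℝ × ℝ =>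
      4 * Real.exp 1 / 3 * (p.1 * Real.sin (2 * Real.pi * p.2) + p.2)) (by fun_prop)

/-- Along the loop, the sum of the first and the last coordinate grows linearly. -/
theorem dot_loop (v : ℝ) : dot (1, 0, 1) (cyl (loopRadius v) (v + 5 / 4) (loopHeight v)) =
    4 * Real.exp 1 / 3 * v := by
  -- The shift 5/4 turns the cosine into -sin 2πv, which cancels the sine term of the height. It
  -- also makes the loop, for v from -3/4 to 3/4, run from the angle 1/2 to the angle 2.
  have h : 2 * Real.pi * (v + 5 / 4) = 2 * Real.pi * v + Real.pi / 2 + 2 * Real.pi := by ring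
  simp only [dot, cyl, loopRadius, loopHeight, h, Real.cos_add_two_pi, Real.cos_add_pi_div_two]
  ring

/-- `b` is the braid `a` on the places `1, 2, …`, with one more string resting at the place `0`. -/
structure IsShift {n : ℕ} (a : GeometricBraid n) (b : GeometricBraid (n + 1)) : Prop where
  perm_zero : b.perm 0 = 0
  perm_succ : ∀ i : Fin n, b.perm i.succ = (a.perm i).succ
  string_zero' : ∀ t ∈ Icc (0 : ℝ) 1, b.string 0 t = (0, 0)
  string_succ : ∀ (i : Fin n), ∀ t ∈ Icc (0 : ℝ) 1,
    b.string i.succ t = ((a.string i t).1 + 1, (a.string i t).2)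

section Destabilization

variable {m : ℕ} {X : GeometricBraid (m + 1)} {X' : GeometricBraid (m + 2)}

/-- Only the string at the place 0 and the one crossing it take part in the extra generator; all
others follow `X`, one place further out. The comparison is with `X * 1`, which runs through `X` at
the same speed and then waits. -/
theorem IsShift.stabilization_string_succ (h : IsShift X X') {i : Fin (m + 1)} {u : ℝ}
    (hu : u ∈ Icc (0 : ℝ) 1) (hi : ¬(i = X.perm.symm 0 ∧ 1 / 2 < u)) :
    (X' * ofPerm (Equiv.swap 0 1)).string i.succ u =
      (((X * 1).string i u).1 + 1, ((X * 1).string i u).2) := by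
  rcases le_or_gt u (1 / 2) with h1 | h1
  · rw [mul_string_left _ _ _ h1, mul_string_left _ _ _ h1,
      h.string_succ _ _ ⟨by linarith [hu.1], by linarith⟩]
  · have hi0 : X.perm i ≠ 0 := fun e => hi ⟨by rw [← e, Equiv.symm_apply_apply], h1⟩
    have hs : Equiv.swap (0 : Fin (m + 2)) 1 (X.perm i).succ = (X.perm i).succ :=
      Equiv.swap_apply_of_ne_of_ne (Fin.succ_ne_zero _) fun e => hi0 (Fin.succ_injective _ e)
    rw [mul_string_right _ _ _ h1.le, mul_string_right _ _ _ h1.le, h.perm_succ, ofPerm_string, hs]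
    change _ = (((X.perm i : ℕ) : ℝ) + 1, (0 : ℝ))
    simp

theorem IsShift.stabilization_string_zero (h : IsShift X X') {u : ℝ}
    (hu : u ∈ Icc (0 : ℝ) 1) (hu2 : u ≤ 1 / 2) :
    (X' * ofPerm (Equiv.swap 0 1)).string 0 u = (0, 0) := by
  rw [mul_string_left _ _ _ hu2, h.string_zero' _ ⟨by linarith [hu.1], by linarith⟩]

theorem IsShift.stabilization_string_zero' (h : IsShift X X') {u : ℝ} (hu2 : 1 / 2 ≤ u) :
    (X' * ofPerm (Equiv.swap 0 1)).string 0 u = (2 * u - 1, (2 * u - 1) * (1 - (2 * u - 1))) := by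
  rw [mul_string_right _ _ _ hu2, h.perm_zero, ofPerm_string, Equiv.swap_apply_left]
  simp

theorem IsShift.stabilization_string_succ' (h : IsShift X X') {u : ℝ} (hu2 : 1 / 2 ≤ u) :
    (X' * ofPerm (Equiv.swap 0 1)).string (X.perm.symm 0).succ u =
      (1 - (2 * u - 1), -((2 * u - 1) * (1 - (2 * u - 1)))) := by
  rw [mul_string_right _ _ _ hu2, h.perm_succ, Equiv.apply_symm_apply, ofPerm_string]
  rw [show (Fin.succ 0 : Fin (m + 2)) = 1 from rfl, Equiv.swap_apply_right]
  refine Prod.ext ?_ ?_ <;> simp <;> ring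

theorem mul_one_string_of_le (X : GeometricBraid (m + 1)) (i : Fin (m + 1)) {u : ℝ}
    (hu : 1 / 2 ≤ u) : (X * 1).string i u = basePoint (X.perm i) := by
  rw [mul_string_right _ _ _ hu]; rfl

theorem mul_one_nonneg (hX0 : ∀ i, ∀ t ∈ Icc (0 : ℝ) 1, 0 ≤ (X.string i t).1) (i : Fin (m + 1))
    {u : ℝ} (hu : u ∈ Icc (0 : ℝ) 1) : 0 ≤ ((X * 1).string i u).1 := by
  rcases le_total u (1 / 2) with h1 | h1
  · rw [mul_string_left _ _ _ h1]
    exact hX0 i _ ⟨by linarith [hu.1], by linarith⟩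
  · rw [mul_one_string_of_le X i h1]
    exact Nat.cast_nonneg _

variable (X) in
/-- The distance from the axis of the strings of the destabilized braid, with loop. -/
noncomputable def loopedRadius : Fin (m + 2) → ℝ → ℝ :=
  Fin.cases (fun u => loopRadius (u - 1 / 4)) fun i u =>
    if i = X.perm.symm 0 ∧ 1 / 2 < u then loopRadius (u - 5 / 4)
    else Real.exp (((X * 1).string i u).1 + 1)

variable (X) in
/-- The height of the strings of the destabilized braid, with loop. -/
noncomputable def loopedHeight : Fin (m + 2) → ℝ → ℝ :=
  Fin.cases (fun u => loopHeight (u - 1 / 4)) fun i u =>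
    if i = X.perm.symm 0 ∧ 1 / 2 < u then loopHeight (u - 5 / 4) else ((X * 1).string i u).2

variable (X) in
theorem loopedRadius_zero (u : ℝ) : loopedRadius X 0 u = loopRadius (u - 1 / 4) := rfl
variable (X) in
theorem loopedHeight_zero (u : ℝ) : loopedHeight X 0 u = loopHeight (u - 1 / 4) := rfl
variable (X) in
theorem loopedRadius_succ (i : Fin (m + 1)) (u : ℝ) : loopedRadius X i.succ u =
    if i = X.perm.symm 0 ∧ 1 / 2 < u then loopRadius (u - 5 / 4)
    else Real.exp (((X * 1).string i u).1 + 1) := rfl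
variable (X) in
theorem loopedHeight_succ (i : Fin (m + 1)) (u : ℝ) : loopedHeight X i.succ u =
    if i = X.perm.symm 0 ∧ 1 / 2 < u then loopHeight (u - 5 / 4) else ((X * 1).string i u).2 := rfl

theorem lipOn_ite_half {f g : ℝ → ℝ} {P : Prop} [Decidable P] (hf : LipOn (Icc 0 1) f)
    (hg : LipOn (Icc 0 1) g) (h : P → f (1 / 2) = g (1 / 2)) :
    LipOn (Icc 0 1) fun u => if P ∧ 1 / 2 < u then f u else g u := by
  by_cases hP : P
  · refine LipOn.glue (b := 1 / 2) ((hg.mono (Icc_subset_Icc_right (by norm_num))).congr fun u hu => ?_)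
      ((hf.mono (Icc_subset_Icc_left (by norm_num))).congr fun u hu => ?_)
    · exact if_neg fun hh => absurd hh.2 (not_lt.2 hu.2)
    · rcases hu.1.eq_or_lt with rfl | h1
      · exact (if_neg fun hh => absurd hh.2 (lt_irrefl _)).trans (h hP).symm
      · exact if_pos ⟨hP, h1⟩
  · simpa [hP] using hg

variable (X) in
theorem lipOn_mul_one_exp (hX : X.IsLip) (i : Fin (m + 1)) :
    LipOn (Icc 0 1) fun u => Real.exp (((X * 1).string i u).1 + 1) :=
  ((hX.mul isLip_one) i).contDiff_comp isCompact_Icc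
    (g := fun p : ℝ × ℝ => Real.exp (p.1 + 1)) (by fun_prop)

variable (X) in
theorem lipOn_mul_one_snd (hX : X.IsLip) (i : Fin (m + 1)) :
    LipOn (Icc 0 1) fun u => ((X * 1).string i u).2 :=
  ((hX.mul isLip_one) i).contDiff_comp isCompact_Icc (g := fun p : ℝ × ℝ => p.2) (by fun_prop)

theorem loopRadius_half : loopRadius (1 / 2 - 5 / 4) = Real.exp 1 := by
  rw [show (1 / 2 - 5 / 4 : ℝ) = -(3 / 4) by norm_num, loopRadius_neg, loopRadius_end]

theorem loopHeight_half : loopHeight (1 / 2 - 5 / 4) = 0 := by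
  rw [show (1 / 2 - 5 / 4 : ℝ) = -(3 / 4) by norm_num, loopHeight_neg, loopHeight_end, neg_zero]

variable (X) in
theorem mul_one_string_half : (X * 1).string (X.perm.symm 0) (1 / 2) = (0, 0) := by
  rw [mul_one_string_of_le X _ le_rfl, Equiv.apply_symm_apply]
  simp [basePoint]

theorem string_zero_zero (a : GeometricBraid (m + 1)) : a.string 0 0 = (0, 0) := by
  rw [string_zero]
  simp [basePoint]

/-- The first part of a destabilization: the string at the place `0` is turned into a rising loop. -/
theorem IsShift.exists_carries_looped (h : IsShift X X') (hX : X.IsLip) (hX' : X'.IsLip)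
    (hX0 : ∀ i, ∀ t ∈ Icc (0 : ℝ) 1, 0 ≤ (X.string i t).1) :
    ∃ H : AmbientIsotopy, ∀ i, ∀ u ∈ Icc (0 : ℝ) 1,
      H.homeo 1 (wrap ((X' * ofPerm (Equiv.swap 0 1)).string i u) u) =
        cyl (loopedRadius X i u) u (loopedHeight X i u) := by
  set b := X' * ofPerm (Equiv.swap 0 1) with hb
  have hbl : b.IsLip := hX'.mul (isLip_ofPerm _)
  have hbp0 : b.perm 0 = 1 := by
    rw [hb, mul_perm_apply, h.perm_zero]; exact Equiv.swap_apply_left _ _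
  have hbpj : b.perm (X.perm.symm 0).succ = 0 := by
    rw [hb, mul_perm_apply, h.perm_succ, Equiv.apply_symm_apply]; exact Equiv.swap_apply_right _ _
  have hbpi : ∀ i, i ≠ X.perm.symm 0 → b.perm i.succ = (X.perm i).succ := fun i hi => by
    rw [hb, mul_perm_apply, h.perm_succ]
    exact Equiv.swap_apply_of_ne_of_ne (Fin.succ_ne_zero _) fun e =>
      hi (by rw [Equiv.eq_symm_apply]; exact Fin.succ_injective _ e)
  have hl1 : ∀ c, LipOn (Icc 0 1) (fun u => loopRadius (u - c)) ∧
      LipOn (Icc 0 1) fun u => loopHeight (u - c) := fun c => by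
    simpa only [one_mul, ← sub_eq_add_neg] using lipOn_loop (s := Icc 0 1) isCompact_Icc 1 (-c)
  have hexp1 : (1 : ℝ) < Real.exp 1 := by simp
  have he2 : Real.exp 1 < Real.exp (1 + 1) := Real.exp_lt_exp.2 (by norm_num)
  -- The strings outside the loop do not move, so they stay disjoint from each other; the moving
  -- ones are kept apart from the rest by their radius.
  have hdisj : ∀ s ∈ Icc (0 : ℝ) 1, ∀ u ∈ Ico (0 : ℝ) 1, ∀ i j,
      (1 - s) * Real.exp (b.string i u).1 + s * loopedRadius X i u =
        (1 - s) * Real.exp (b.string j u).1 + s * loopedRadius X j u →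
      (1 - s) * (b.string i u).2 + s * loopedHeight X i u =
        (1 - s) * (b.string j u).2 + s * loopedHeight X j u → i = j := by
    intro s hs u hu
    have hu' : u ∈ Icc (0 : ℝ) 1 := ⟨hu.1, hu.2.le⟩
    have hs' : 0 ≤ 1 - s := sub_nonneg.2 hs.2
    have conv_lt : ∀ a b c : ℝ, a < c → b < c → (1 - s) * a + s * b < c := fun a b c h1 h2 => by
      rcases hs.1.eq_or_lt with h0 | h0
      · simpa [← h0] using h1
      · have := mul_lt_mul_of_pos_left h2 h0
        have := mul_le_mul_of_nonneg_left h1.le hs'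
        linarith
    have conv_gt : ∀ a b c : ℝ, c < a → c < b → c < (1 - s) * a + s * b := fun a b c h1 h2 => by
      rcases hs.1.eq_or_lt with h0 | h0
      · simpa [← h0] using h1
      · have := mul_lt_mul_of_pos_left h2 h0
        have := mul_le_mul_of_nonneg_left h1.le hs'
        linarith
    have hsame : ∀ i : Fin (m + 1), ¬(i = X.perm.symm 0 ∧ 1 / 2 < u) →
        (1 - s) * Real.exp (b.string i.succ u).1 + s * loopedRadius X i.succ u =
          Real.exp (((X * 1).string i u).1 + 1) ∧
        (1 - s) * (b.string i.succ u).2 + s * loopedHeight X i.succ u =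
          ((X * 1).string i u).2 := fun i hi => by
      rw [loopedRadius_succ, loopedHeight_succ, if_neg hi, if_neg hi,
        h.stabilization_string_succ hu' hi]
      constructor <;> ring
    have hinj : ∀ i j : Fin (m + 1), ¬(i = X.perm.symm 0 ∧ 1 / 2 < u) →
        ¬(j = X.perm.symm 0 ∧ 1 / 2 < u) →
        (1 - s) * Real.exp (b.string i.succ u).1 + s * loopedRadius X i.succ u =
          (1 - s) * Real.exp (b.string j.succ u).1 + s * loopedRadius X j.succ u →
        (1 - s) * (b.string i.succ u).2 + s * loopedHeight X i.succ u =
          (1 - s) * (b.string j.succ u).2 + s * loopedHeight X j.succ u → i = j := by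
      intro i j hi hj h1 h2
      rw [(hsame i hi).1, (hsame j hj).1] at h1
      rw [(hsame i hi).2, (hsame j hj).2] at h2
      have h3 := Real.exp_injective h1
      exact (X * 1).disjoint u hu' i j (Prod.ext (by linarith) h2)
    rcases le_or_gt u (1 / 2) with hu2 | hu2
    -- During the first half the string at the place 0 stays inside the cylinder of radius e, and
    -- all others stay outside or on it.
    · have h0 : (1 - s) * Real.exp (b.string 0 u).1 + s * loopedRadius X 0 u < Real.exp 1 := by
        rw [h.stabilization_string_zero hu' hu2, Real.exp_zero]
        exact conv_lt _ _ _ hexp1 (loopRadius_lt (by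
          rw [abs_lt]; constructor <;> linarith [hu.1]))
      have hS : ∀ i : Fin (m + 1), Real.exp 1 ≤
          (1 - s) * Real.exp (b.string i.succ u).1 + s * loopedRadius X i.succ u := fun i => by
        rw [(hsame i fun h => absurd h.2 (not_lt.2 hu2)).1]
        exact Real.exp_le_exp.2 (by linarith [mul_one_nonneg hX0 i hu'])
      intro i j
      refine Fin.cases ?_ (fun i => ?_) i <;> refine Fin.cases ?_ (fun j => ?_) j
      · exact fun _ _ => rfl
      · exact fun h1 _ => absurd h1 (h0.trans_le (hS j)).ne
      · exact fun h1 _ => absurd h1 (h0.trans_le (hS i)).ne'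
      · exact fun h1 h2 => congrArg _ (hinj i j (fun h => absurd h.2 (not_lt.2 hu2))
          (fun h => absurd h.2 (not_lt.2 hu2)) h1 h2)
    · set r := 2 * u - 1 with hr
      have hr0 : 0 < r := by linarith
      have hr1 : r < 1 := by linarith [hu.2]
      have hrr : 0 < r * (1 - r) := mul_pos hr0 (sub_pos.2 hr1)
      -- During the crossing the two strings involved stay inside the cylinder of radius e², the
      -- others outside or on it, and the two are separated by the signs of their heights.
      have h0 : (1 - s) * Real.exp (b.string 0 u).1 + s * loopedRadius X 0 u < Real.exp (1 + 1) := by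
        rw [h.stabilization_string_zero' hu2.le]
        refine conv_lt _ _ _ (Real.exp_lt_exp.2 (by linarith)) ((loopRadius_le ?_).trans_lt he2)
        rw [abs_le]; constructor <;> linarith [hu.2]
      have h0y : 0 < (1 - s) * (b.string 0 u).2 + s * loopedHeight X 0 u := by
        rw [h.stabilization_string_zero' hu2.le]
        exact conv_gt _ _ _ hrr (loopHeight_pos (by linarith) (by linarith [hu.2]))
      have hneg : u - 5 / 4 = -(5 / 4 - u) := by ring
      have hj : (1 - s) * Real.exp (b.string (X.perm.symm 0).succ u).1 +
          s * loopedRadius X (X.perm.symm 0).succ u < Real.exp (1 + 1) := by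
        rw [h.stabilization_string_succ' hu2.le, loopedRadius_succ, if_pos ⟨rfl, hu2⟩]
        refine conv_lt _ _ _ (Real.exp_lt_exp.2 (by linarith)) ((loopRadius_le ?_).trans_lt he2)
        rw [abs_le]; constructor <;> linarith [hu.2]
      have hjy : (1 - s) * (b.string (X.perm.symm 0).succ u).2 +
          s * loopedHeight X (X.perm.symm 0).succ u < 0 := by
        rw [h.stabilization_string_succ' hu2.le, loopedHeight_succ, if_pos ⟨rfl, hu2⟩, hneg,
          loopHeight_neg]
        refine conv_lt _ _ _ (by linarith) ?_
        have := loopHeight_pos (v := 5 / 4 - u) (by linarith [hu.2]) (by linarith)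
        linarith
      have hS : ∀ i : Fin (m + 1), i ≠ X.perm.symm 0 → Real.exp (1 + 1) ≤
          (1 - s) * Real.exp (b.string i.succ u).1 + s * loopedRadius X i.succ u := fun i hi => by
        rw [(hsame i fun h => hi h.1).1, mul_one_string_of_le X i hu2.le]
        refine Real.exp_le_exp.2 (add_le_add_left ?_ 1)
        have hne : X.perm i ≠ 0 := fun e => hi (by rw [Equiv.eq_symm_apply, e])
        have : 1 ≤ (X.perm i : ℕ) := Nat.one_le_iff_ne_zero.2 fun e => hne (Fin.ext e)
        change (1 : ℝ) ≤ ((X.perm i : ℕ) : ℝ)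
        exact_mod_cast this
      intro i j
      refine Fin.cases ?_ (fun i => ?_) i <;> refine Fin.cases ?_ (fun j => ?_) j
      · exact fun _ _ => rfl
      · intro h1 h2
        by_cases hjj : j = X.perm.symm 0
        · subst hjj
          exact absurd h2 (hjy.trans h0y).ne'
        · exact absurd h1 (h0.trans_le (hS j hjj)).ne
      · intro h1 h2
        by_cases hii : i = X.perm.symm 0
        · subst hii
          exact absurd h2 (hjy.trans h0y).ne
        · exact absurd h1 (h0.trans_le (hS i hii)).ne'
      · intro h1 h2
        by_cases hii : i = X.perm.symm 0 <;> by_cases hjj : j = X.perm.symm 0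
        · rw [hii, hjj]
        · subst hii
          exact absurd h1 (hj.trans_le (hS j hjj)).ne
        · subst hjj
          exact absurd h1 (hj.trans_le (hS i hii)).ne'
        · exact congrArg _ (hinj i j (fun h => hii h.1) (fun h => hjj h.1) h1 h2)
  -- The two pieces of the loop meet at v = -1/4, where the crossing string reaches the place 0 and
  -- the string starting there takes over.
  have hend : (1 - 5 / 4 : ℝ) = 0 - 1 / 4 := by norm_num
  have hhalf : ∀ i : Fin (m + 1), ¬(i = X.perm.symm 0 ∧ (1 / 2 : ℝ) < 0) :=
    fun i hh => absurd hh.2 (by norm_num)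
  have hone : ∀ i : Fin (m + 1), i ≠ X.perm.symm 0 → ¬(i = X.perm.symm 0 ∧ (1 / 2 : ℝ) < 1) :=
    fun i hi hh => hi hh.1
  have h34 : (1 - 1 / 4 : ℝ) = 3 / 4 := by norm_num
  have hsucc : b.perm 0 = Fin.succ 0 := hbp0
  have hρ1 : ∀ i, loopedRadius X i 1 = loopedRadius X (b.perm i) 0 := by
    refine Fin.cases ?_ fun i => ?_
    · rw [hsucc, loopedRadius_zero, loopedRadius_succ, if_neg (hhalf _), string_zero_zero, h34,
        loopRadius_end, zero_add]
    · by_cases hi : i = X.perm.symm 0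
      · rw [hi, hbpj, loopedRadius_zero, loopedRadius_succ, if_pos ⟨rfl, by norm_num⟩, hend]
      · rw [hbpi i hi, loopedRadius_succ, loopedRadius_succ, if_neg (hone i hi), if_neg (hhalf _),
          string_one, string_zero]
        rfl
  have hy1 : ∀ i, loopedHeight X i 1 = loopedHeight X (b.perm i) 0 := by
    refine Fin.cases ?_ fun i => ?_
    · rw [hsucc, loopedHeight_zero, loopedHeight_succ, if_neg (hhalf _), string_zero_zero, h34,
        loopHeight_end]
    · by_cases hi : i = X.perm.symm 0
      · rw [hi, hbpj, loopedHeight_zero, loopedHeight_succ, if_pos ⟨rfl, by norm_num⟩, hend]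
      · rw [hbpi i hi, loopedHeight_succ, loopedHeight_succ, if_neg (hone i hi), if_neg (hhalf _),
          string_one, string_zero]
        rfl
  obtain ⟨H, hH⟩ := AmbientIsotopy.exists_carries_cyl b.perm
    (fun i t => Real.exp (b.string i t).1) (fun i t => (b.string i t).2)
    (loopedRadius X) (loopedHeight X)
    (fun i => (hbl i).contDiff_comp isCompact_Icc (g := fun p : ℝ × ℝ => Real.exp p.1) (by fun_prop))
    (fun i => (hbl i).contDiff_comp isCompact_Icc (g := fun p : ℝ × ℝ => p.2) (by fun_prop))
    (Fin.cases (hl1 _).1 fun i => lipOn_ite_half (hl1 _).1 (lipOn_mul_one_exp X hX i) fun e => by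
      rw [e, mul_one_string_half, loopRadius_half, zero_add])
    (Fin.cases (hl1 _).2 fun i => lipOn_ite_half (hl1 _).2 (lipOn_mul_one_snd X hX i) fun e => by
      rw [e, mul_one_string_half, loopHeight_half])
    (fun _ _ _ => Real.exp_pos _)
    (Fin.cases (fun _ _ => loopRadius_pos _) fun i u _ => by
      rw [loopedRadius_succ]; split_ifs; exacts [loopRadius_pos _, Real.exp_pos _])
    (fun i => by rw [string_one, string_zero]) (fun i => by rw [string_one, string_zero])
    hρ1 hy1 hdisj
  exact ⟨H, fun i u hu => by rw [wrap_eq_cyl, hH i u hu]⟩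

end Destabilization

end GeometricBraid

/-- The triangle inequality for the horizontal parts, which have lengths ρ and ρ'. -/
theorem sq_add_sq_cyl_combination_le {ρ ρ' s : ℝ} (hρ : 0 ≤ ρ) (hρ' : 0 ≤ ρ')
    (hs : s ∈ Icc (0 : ℝ) 1) (θ θ' y y' : ℝ) :
    ((1 - s) • cyl ρ θ y + s • cyl ρ' θ' y').1 ^ 2 +
      ((1 - s) • cyl ρ θ y + s • cyl ρ' θ' y').2.1 ^ 2 ≤ ((1 - s) * ρ + s * ρ') ^ 2 := by
  simp only [cyl, Prod.fst_add, Prod.snd_add, Prod.smul_fst, Prod.smul_snd, smul_eq_mul]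
  set A := 2 * Real.pi * θ
  set B := 2 * Real.pi * θ'
  have h1 := Real.cos_sq_add_sin_sq A
  have h2 := Real.cos_sq_add_sin_sq B
  have h3 := Real.cos_le_one (A - B)
  rw [Real.cos_sub] at h3
  have h4 : 0 ≤ 2 * ((1 - s) * ρ) * (s * ρ') :=
    mul_nonneg (mul_nonneg zero_le_two (mul_nonneg (sub_nonneg.2 hs.2) hρ)) (mul_nonneg hs.1 hρ')
  have h5 := mul_le_mul_of_nonneg_left h3 h4
  calc _ = ((1 - s) * ρ) ^ 2 * (Real.cos A ^ 2 + Real.sin A ^ 2) +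
        (s * ρ') ^ 2 * (Real.cos B ^ 2 + Real.sin B ^ 2) +
        2 * ((1 - s) * ρ) * (s * ρ') * (Real.cos A * Real.cos B + Real.sin A * Real.sin B) := by ring
    _ ≤ _ := by rw [h1, h2]; linarith

theorem sq_add_sq_cyl (ρ θ y : ℝ) : (cyl ρ θ y).1 ^ 2 + (cyl ρ θ y).2.1 ^ 2 = ρ ^ 2 := by
  simp only [cyl]
  linear_combination ρ ^ 2 * Real.cos_sq_add_sin_sq (2 * Real.pi * θ)

theorem eq_of_eq_add_int {u v : ℝ} (hu : u ∈ Ico (0 : ℝ) 1) (hv : v ∈ Ico (0 : ℝ) 1)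
    (h : ∃ m : ℤ, u = v + m) : u = v := by
  obtain ⟨m, hm⟩ := h
  have a1 : (m : ℝ) < 1 := by linarith [hu.2, hv.1]
  have a2 : (-1 : ℝ) < m := by linarith [hu.1, hv.2]
  have a3 : m < 1 := by exact_mod_cast a1
  have a4 : -1 < m := by exact_mod_cast a2
  obtain rfl : m = 0 := by omega
  simpa using hm

/-! ### Destabilization: pulling the loop tight -/

namespace GeometricBraid

variable {m : ℕ} (X : GeometricBraid (m + 1))

/-- The string of the braid `X * 1` that ends at the place `0`, as a curve around the axis that
makes the loop of a destabilization after it has reached its end place. -/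
noncomputable def unloopedRadius (i : Fin (m + 1)) (u : ℝ) : ℝ :=
  if i = X.perm.symm 0 ∧ 1 / 2 < u then loopRadius (3 * u + -(9 / 4))
  else Real.exp (((X * 1).string i u).1 + 1)

/-- The angle that goes with `unloopedRadius`. -/
noncomputable def unloopedAngle (i : Fin (m + 1)) (u : ℝ) : ℝ :=
  if i = X.perm.symm 0 ∧ 1 / 2 < u then 3 * u - 1 else u

/-- The height that goes with `unloopedRadius`. -/
noncomputable def unloopedHeight (i : Fin (m + 1)) (u : ℝ) : ℝ :=
  if i = X.perm.symm 0 ∧ 1 / 2 < u then loopHeight (3 * u + -(9 / 4))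
  else ((X * 1).string i u).2

variable {X}

variable (X) in
theorem unlooped_of_lt {u : ℝ} (hu : 1 / 2 < u) :
    unloopedRadius X (X.perm.symm 0) u = loopRadius (3 * u + -(9 / 4)) ∧
      unloopedAngle X (X.perm.symm 0) u = 3 * u - 1 ∧
      unloopedHeight X (X.perm.symm 0) u = loopHeight (3 * u + -(9 / 4)) :=
  ⟨if_pos ⟨rfl, hu⟩, if_pos ⟨rfl, hu⟩, if_pos ⟨rfl, hu⟩⟩

variable (X) in
theorem unlooped_of_not {i : Fin (m + 1)} {u : ℝ} (hi : ¬(i = X.perm.symm 0 ∧ 1 / 2 < u)) :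
    unloopedRadius X i u = Real.exp (((X * 1).string i u).1 + 1) ∧ unloopedAngle X i u = u ∧
      unloopedHeight X i u = ((X * 1).string i u).2 :=
  ⟨if_neg hi, if_neg hi, if_neg hi⟩

/-- The value of x + z along the tightening loop: linear on the loop itself and e cos 2πu on the
final half circle, where the cosine increases from u = 1/2 to u = 1. -/
theorem cos_combination_lt {s u v c κ e : ℝ} (hs : s ∈ Icc (0 : ℝ) 1) (hu : 1 / 2 ≤ u) (huv : u < v)
    (hv : v ≤ 1) (hκ : 0 < κ) (he : 0 < e) :
    (1 - s) * (κ * (3 * u + c)) + s * (e * Real.cos (2 * Real.pi * u)) <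
      (1 - s) * (κ * (3 * v + c)) + s * (e * Real.cos (2 * Real.pi * v)) := by
  have hpi := Real.pi_pos
  have h1 : Real.cos (2 * Real.pi * u) < Real.cos (2 * Real.pi * v) := by
    have := Real.cos_lt_cos_of_nonneg_of_le_pi (x := 2 * Real.pi * u - Real.pi)
      (y := 2 * Real.pi * v - Real.pi) (by nlinarith) (by nlinarith) (by nlinarith)
    rw [Real.cos_sub_pi, Real.cos_sub_pi] at this
    linarith
  have h2 := mul_lt_mul_of_pos_left h1 he
  have h3 : κ * (3 * u + c) < κ * (3 * v + c) := mul_lt_mul_of_pos_left (by linarith) hκ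
  rcases hs.1.eq_or_lt with h0 | h0
  · simpa [← h0] using h3
  · have := mul_lt_mul_of_pos_left h2 h0
    have := mul_le_mul_of_nonneg_left h3.le (sub_nonneg.2 hs.2)
    linarith

theorem exp_one_le_mul_one (hX0 : ∀ i, ∀ t ∈ Icc (0 : ℝ) 1, 0 ≤ (X.string i t).1) (i : Fin (m + 1))
    {u : ℝ} (hu : u ∈ Icc (0 : ℝ) 1) : Real.exp 1 ≤ Real.exp (((X * 1).string i u).1 + 1) :=
  Real.exp_le_exp.2 (by linarith [mul_one_nonneg hX0 i hu])

variable (X) in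
theorem mul_one_string_symm {u : ℝ} (hu : 1 / 2 ≤ u) : (X * 1).string (X.perm.symm 0) u = (0, 0) := by
  rw [mul_one_string_of_le X _ hu, Equiv.apply_symm_apply]
  simp [basePoint]

/-- Before the last stage the moving loop lies strictly inside the cylinder of radius e, while
everything else is at rest outside or on it. Within the loop no two points coincide because x + z is
strictly increasing along it at every stage. -/
theorem unlooped_injective (hX0 : ∀ i, ∀ t ∈ Icc (0 : ℝ) 1, 0 ≤ (X.string i t).1) {s : ℝ}
    (hs : s ∈ Icc (0 : ℝ) 1) (i j : Fin (m + 1)) {u v : ℝ} (hu : u ∈ Ico (0 : ℝ) 1)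
    (hv : v ∈ Ico (0 : ℝ) 1)
    (h : (1 - s) • cyl (unloopedRadius X i u) (unloopedAngle X i u) (unloopedHeight X i u) +
        s • cyl (Real.exp (((X * 1).string i u).1 + 1)) u ((X * 1).string i u).2 =
      (1 - s) • cyl (unloopedRadius X j v) (unloopedAngle X j v) (unloopedHeight X j v) +
        s • cyl (Real.exp (((X * 1).string j v).1 + 1)) v ((X * 1).string j v).2) :
    i = j ∧ u = v := by
  set β : Fin (m + 1) → ℝ → Space := fun i u =>
    cyl (Real.exp (((X * 1).string i u).1 + 1)) u ((X * 1).string i u).2 with hβ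
  set S : Fin (m + 1) → ℝ → Space := fun i u => (1 - s) • cyl (unloopedRadius X i u)
    (unloopedAngle X i u) (unloopedHeight X i u) + s • β i u with hS
  change S i u = S j v at h
  have hu' : u ∈ Icc (0 : ℝ) 1 := ⟨hu.1, hu.2.le⟩
  have hv' : v ∈ Icc (0 : ℝ) 1 := ⟨hv.1, hv.2.le⟩
  have hneg : ∀ i u, ¬(i = X.perm.symm 0 ∧ 1 / 2 < u) → S i u = β i u := fun i u hi => by
    simp only [hS, unloopedRadius, unloopedAngle, unloopedHeight, if_neg hi]
    change (1 - s) • β i u + s • β i u = β i u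
    rw [← add_smul, sub_add_cancel, one_smul]
  have hβinj : β i u = β j v → i = j ∧ u = v := fun h => by
    obtain ⟨h1, h2, h3⟩ := cyl_injective (Real.exp_pos _) (Real.exp_pos _) h
    obtain rfl := eq_of_eq_add_int hu hv h3
    have := Real.exp_injective h1
    exact ⟨(X * 1).disjoint u hu' i j (Prod.ext (by linarith) h2), rfl⟩
  -- The last stage is treated apart: there the tightened arc lies on the cylinder itself and the
  -- strict inequality of `hlow` fails.
  rcases hs.2.eq_or_lt with rfl | hs1
  · simp only [hS, sub_self, zero_smul, one_smul, zero_add] at h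
    exact hβinj h
  have hlow : ∀ u ∈ Ico (0 : ℝ) 1, 1 / 2 < u →
      (S (X.perm.symm 0) u).1 ^ 2 + (S (X.perm.symm 0) u).2.1 ^ 2 < Real.exp 1 ^ 2 := by
    intro u hu hu2
    have h1 : unloopedRadius X (X.perm.symm 0) u < Real.exp 1 := by
      rw [unloopedRadius, if_pos ⟨rfl, hu2⟩]
      exact loopRadius_lt (by rw [abs_lt]; constructor <;> linarith [hu.2])
    have h0 : 0 < unloopedRadius X (X.perm.symm 0) u := by
      rw [unloopedRadius, if_pos ⟨rfl, hu2⟩]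
      exact loopRadius_pos _
    refine (sq_add_sq_cyl_combination_le h0.le (Real.exp_pos _).le hs _ _ _ _).trans_lt ?_
    rw [mul_one_string_symm X hu2.le, zero_add]
    have h2 := mul_lt_mul_of_pos_left h1 (sub_pos.2 hs1)
    have h3 := mul_nonneg hs.1 (Real.exp_pos 1).le
    have h4 := mul_pos (sub_pos.2 hs1) h0
    exact pow_lt_pow_left₀ (by linarith) (by linarith) two_ne_zero
  have hhigh : ∀ i, ∀ u ∈ Icc (0 : ℝ) 1, ¬(i = X.perm.symm 0 ∧ 1 / 2 < u) →
      Real.exp 1 ^ 2 ≤ (S i u).1 ^ 2 + (S i u).2.1 ^ 2 := by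
    intro i u hu hi
    rw [hneg i u hi, sq_add_sq_cyl]
    exact pow_le_pow_left₀ (Real.exp_pos _).le (exp_one_le_mul_one hX0 i hu) 2
  have hdot : ∀ u, 1 / 2 < u → dot (1, 0, 1) (S (X.perm.symm 0) u) =
      (1 - s) * (4 * Real.exp 1 / 3 * (3 * u + -(9 / 4))) +
        s * (Real.exp 1 * Real.cos (2 * Real.pi * u)) := by
    intro u hu
    have e : 3 * u - 1 = 3 * u + -(9 / 4) + 5 / 4 := by ring
    have h1 : dot (1, 0, 1) (β (X.perm.symm 0) u) = Real.exp 1 * Real.cos (2 * Real.pi * u) := by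
      simp [hβ, mul_one_string_symm X hu.le, dot, cyl]
    have h2 := dot_loop (3 * u + -(9 / 4))
    rw [← e] at h2
    obtain ⟨e1, e2, e3⟩ := unlooped_of_lt X hu
    rw [← h1, ← h2]
    simp only [hS, e1, e2, e3, dot, Prod.fst_add, Prod.snd_add, Prod.smul_fst, Prod.smul_snd, smul_eq_mul]
    ring
  by_cases hi : i = X.perm.symm 0 ∧ 1 / 2 < u <;> by_cases hj : j = X.perm.symm 0 ∧ 1 / 2 < v
  · obtain ⟨rfl, hu2⟩ := hi
    obtain ⟨rfl, hv2⟩ := hj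
    refine ⟨rfl, ?_⟩
    have h1 := congrArg (dot (1, 0, 1)) h
    rw [hdot u hu2, hdot v hv2] at h1
    have hκ : 0 < 4 * Real.exp 1 / 3 := by positivity
    rcases lt_trichotomy u v with h2 | h2 | h2
    · exact absurd h1 (cos_combination_lt hs hu2.le h2 hv.2.le hκ (Real.exp_pos 1)).ne
    · exact h2
    · exact absurd h1 (cos_combination_lt hs hv2.le h2 hu.2.le hκ (Real.exp_pos 1)).ne'
  · obtain ⟨rfl, hu2⟩ := hi
    have := (hlow u hu hu2).trans_le (hhigh j v hv' hj)
    rw [h] at this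
    exact absurd this (lt_irrefl _)
  · obtain ⟨rfl, hv2⟩ := hj
    have := (hlow v hv hv2).trans_le (hhigh i u hu' hi)
    rw [h] at this
    exact absurd this (lt_irrefl _)
  · rw [hneg i u hi, hneg j v hj] at h
    exact hβinj h

/-- The second part of a destabilization: the loop is pulled tight. -/
theorem exists_carries_unlooped (hX : X.IsLip)
    (hX0 : ∀ i, ∀ t ∈ Icc (0 : ℝ) 1, 0 ≤ (X.string i t).1) :
    ∃ H : AmbientIsotopy, ∀ i, ∀ u ∈ Icc (0 : ℝ) 1,
      H.homeo 1 (cyl (unloopedRadius X i u) (unloopedAngle X i u) (unloopedHeight X i u)) =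
        cyl (Real.exp (((X * 1).string i u).1 + 1)) u ((X * 1).string i u).2 := by
  have hid : LipOn (Icc (0 : ℝ) 1) fun u => u := LipOn.of_contDiff isCompact_Icc contDiff_id
  have v0 : (3 * (1 / 2) + -(9 / 4) : ℝ) = 1 / 2 - 5 / 4 := by norm_num
  have v1 : (3 * 1 + -(9 / 4) : ℝ) = 3 / 4 := by norm_num
  have hρ : ∀ i, LipOn (Icc 0 1) (unloopedRadius X i) := fun i =>
    lipOn_ite_half (lipOn_loop isCompact_Icc 3 _).1 (lipOn_mul_one_exp X hX i) fun e => by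
      rw [e, mul_one_string_half, v0, loopRadius_half, zero_add]
  have hy : ∀ i, LipOn (Icc 0 1) (unloopedHeight X i) := fun i =>
    lipOn_ite_half (lipOn_loop isCompact_Icc 3 _).2 (lipOn_mul_one_snd X hX i) fun e => by
      rw [e, mul_one_string_half, v0, loopHeight_half]
  have hθ : ∀ i, LipOn (Icc 0 1) (unloopedAngle X i) := fun i =>
    lipOn_ite_half (LipOn.of_contDiff isCompact_Icc (by fun_prop)) hid fun _ => by norm_num
  have hρ0 : ∀ i u, 0 < unloopedRadius X i u := fun i u => by
    rw [unloopedRadius]; split_ifs; exacts [loopRadius_pos _, Real.exp_pos _]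
  have hθm : ∀ i, ∀ a ∈ Icc (0 : ℝ) 1, ∀ b ∈ Icc (0 : ℝ) 1, a ≤ b →
      1 * (b - a) ≤ unloopedAngle X i b - unloopedAngle X i a := by
    intro i a _ b _ hab
    by_cases hi : i = X.perm.symm 0
    · rcases le_or_gt a (1 / 2) with ha | ha <;> rcases le_or_gt b (1 / 2) with hb | hb
      · simp [unloopedAngle, not_lt.2 ha, not_lt.2 hb, -one_div]
      · simp only [unloopedAngle, hi, not_lt.2 ha, hb, and_self, and_false, if_true, if_false]
        linarith
      · linarith
      · simp only [unloopedAngle, hi, ha, hb, and_self, if_true]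
        linarith
    · simp [unloopedAngle, hi]
  have hzero : ∀ i : Fin (m + 1), ¬(i = X.perm.symm 0 ∧ (1 / 2 : ℝ) < 0) :=
    fun i hh => absurd hh.2 (by norm_num)
  refine AmbientIsotopy.exists_carries_lipArcs X.perm
    (fun i u => cyl (unloopedRadius X i u) (unloopedAngle X i u) (unloopedHeight X i u))
    (fun i u => cyl (Real.exp (((X * 1).string i u).1 + 1)) u ((X * 1).string i u).2)
    (fun i => (hρ i).cyl isCompact_Icc (hθ i) (hy i))
    (fun i => (lipOn_mul_one_exp X hX i).cyl isCompact_Icc hid (lipOn_mul_one_snd X hX i))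
    (fun i => ?_) (fun i => ?_) (fun s hs i j u hu v hv h => unlooped_injective hX0 hs i j hu hv h)
    -- In the interior of the loop the angle does not serve: the loop and the tightened arc are at
    -- different angles for the same parameter. There x + z is used. At both ends the angles agree
    -- modulo whole turns, and the angular direction matches the adjoining arcs.
    (fun i u => if i = X.perm.symm 0 ∧ 1 / 2 < u ∧ u < 1 then (1, 0, 1) else angleDir u)
    (fun i => ?_) (fun i u hu => ?_) (fun i u hu => ?_)
  · by_cases hi : i = X.perm.symm 0
    · obtain ⟨e1, e2, e3⟩ := unlooped_of_lt X (by norm_num : (1 / 2 : ℝ) < 1)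
      obtain ⟨e4, e5, e6⟩ := unlooped_of_not X (hzero 0)
      simp only [hi, Equiv.apply_symm_apply, e1, e2, e3, e4, e5, e6, v1,
        loopRadius_end, loopHeight_end, string_zero_zero, zero_add]
      have := cyl_add_int (Real.exp 1) 0 0 2
      norm_num at this ⊢
      exact this
    · simp only [unloopedRadius, unloopedAngle, unloopedHeight, if_neg (hzero _), hi, false_and,
        if_false, cyl_one, string_one, string_zero]
      rfl
  · simp only [cyl_one, string_one, string_zero]
    rfl
  · simp only [lt_irrefl, and_false, if_false, angleDir_one]
    rw [if_neg fun hh => absurd hh.2.1 (by norm_num)]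
  · split_ifs with hi
    · obtain ⟨rfl, hu1, -⟩ := hi
      have h1 : IncreasingAt (fun x => 4 * Real.exp 1 / 3 * (3 * x + -(9 / 4))) u :=
        increasingAt_of_hasStrictDerivAt
          ((((hasStrictDerivAt_id u).const_mul 3).add_const _).const_mul _) (by positivity)
      refine h1.congr (mem_nhdsWithin_of_mem_nhds (Ioi_mem_nhds hu1)) fun x hx => ?_
      have h2 := dot_loop (3 * x + -(9 / 4))
      rw [show 3 * x + -(9 / 4) + 5 / 4 = 3 * x - 1 by ring] at h2
      have hx' : 1 / 2 < x := hx
      obtain ⟨e1, e2, e3⟩ := unlooped_of_lt X hx'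
      simp only [e1, e2, e3]
      exact h2
    · refine increasingAt_angleDir hu (hρ i) (hρ0 i u) (hθ i) one_pos (hθm i) ?_
      by_cases h1 : i = X.perm.symm 0 ∧ 1 / 2 < u
      · have hu1 : u = 1 := hu.2.eq_or_lt.resolve_right fun h => hi ⟨h1.1, h1.2, h⟩
        refine ⟨1, ?_⟩
        rw [unloopedAngle, if_pos h1, hu1]
        norm_num
      · exact ⟨0, by simp [unloopedAngle, h1, -one_div]⟩
  · split_ifs with hi
    · obtain ⟨rfl, hu1, hu2⟩ := hi
      have h1 : IncreasingAt (fun x => Real.exp 1 * Real.cos (2 * Real.pi * x)) u := by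
        refine increasingAt_of_hasStrictDerivAt
          (((hasStrictDerivAt_id u).const_mul (2 * Real.pi)).cos.const_mul _) ?_
        have hpi := Real.pi_pos
        have := Real.sin_pos_of_pos_of_lt_pi (x := 2 * Real.pi * u - Real.pi) (by nlinarith)
          (by nlinarith)
        rw [Real.sin_sub_pi] at this
        simp only [id, mul_one]
        positivity
      refine h1.congr (mem_nhdsWithin_of_mem_nhds (Ioi_mem_nhds hu1)) fun x hx => ?_
      have hx' : 1 / 2 < x := hx
      simp [mul_one_string_symm X hx'.le, dot, cyl]
    · exact increasingAt_angleDir hu (lipOn_mul_one_exp X hX i) (Real.exp_pos _) hid one_pos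
        (fun a _ b _ _ => by simp) ⟨0, by simp⟩

end GeometricBraid

/-! ### Destabilization of closed braids and of words -/

namespace GeometricBraid

/-- Destabilization: the closures of `a σ₁` and of the braid obtained from `a` by removing the string
at the first place are isotopic, if `a` does not move that string. -/
theorem IsShift.isotopic_closure {m : ℕ} {X : GeometricBraid (m + 1)} {X' : GeometricBraid (m + 2)}
    (h : IsShift X X') (hX : X.IsLip) (hX' : X'.IsLip)
    (hX0 : ∀ i, ∀ t ∈ Icc (0 : ℝ) 1, 0 ≤ (X.string i t).1) :
    Isotopic (X' * ofPerm (Equiv.swap 0 1)).closure (X * 1).closure := by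
  obtain ⟨H₁, h₁⟩ := h.exists_carries_looped hX hX' hX0
  obtain ⟨H₂, h₂⟩ := exists_carries_unlooped hX hX0
  obtain ⟨H₃, h₃⟩ := AmbientIsotopy.exists_scale (-1)
  have key : ∀ (i : Fin (m + 2)) (j : Fin (m + 1)), ∀ u ∈ Icc (0 : ℝ) 1, ∀ v ∈ Icc (0 : ℝ) 1,
      cyl (loopedRadius X i u) u (loopedHeight X i u) =
        cyl (unloopedRadius X j v) (unloopedAngle X j v) (unloopedHeight X j v) →
      ((H₁.trans H₂).trans H₃).homeo 1 (wrap ((X' * ofPerm (Equiv.swap 0 1)).string i u) u) =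
        (X * 1).run j v := by
    intro i j u hu v hv e
    change H₃.homeo 1 (H₂.homeo 1 (H₁.homeo 1 _)) = _
    rw [h₁ i u hu, e, h₂ j v hv, run_of_mem_Icc _ _ hv]
    have := h₃ (((X * 1).string j v).1 + 1, ((X * 1).string j v).2) v
    rw [wrap_eq_cyl] at this
    rw [this, add_neg_cancel_right]
  have keyS : ∀ i, ∀ u ∈ Icc (0 : ℝ) 1, ¬(i = X.perm.symm 0 ∧ 1 / 2 < u) →
      ((H₁.trans H₂).trans H₃).homeo 1 (wrap ((X' * ofPerm (Equiv.swap 0 1)).string i.succ u) u) =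
        (X * 1).run i u := by
    intro i u hu hi
    refine key i.succ i u hu u hu ?_
    obtain ⟨e1, e2, e3⟩ := unlooped_of_not X hi
    rw [e1, e2, e3, loopedRadius_succ, loopedHeight_succ, if_neg hi, if_neg hi]
  refine isotopic_closure_of_carries ((H₁.trans H₂).trans H₃) (Fin.cases ?_ fun i => ?_) fun j =>
    ⟨j.succ, 0, by simp, 0, keyS j 0 (by simp) fun hh => absurd hh.2 (by norm_num)⟩
  -- On the target string the loop takes the times from 1/2 to 1, run through at triple angular
  -- speed: the crossing string fills the part up to 2/3, and the former string at the place 0 the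
  -- last third.
  · refine ⟨X.perm.symm 0, fun u => u / 3 + 2 / 3, by fun_prop, fun u _ v _ huv => ?_,
      fun u hu => key _ _ u hu _ ⟨by linarith [hu.1], by linarith [hu.2]⟩ ?_⟩
    · simp only; linarith
    · obtain ⟨e1, e2, e3⟩ := unlooped_of_lt X (u := u / 3 + 2 / 3) (by linarith [hu.1])
      rw [e1, e2, e3, loopedRadius_zero, loopedHeight_zero,
        show 3 * (u / 3 + 2 / 3) + -(9 / 4) = u - 1 / 4 by ring,
        show 3 * (u / 3 + 2 / 3) - 1 = u + (1 : ℤ) by push_cast; ring, cyl_add_int]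
  · by_cases hi : i = X.perm.symm 0
    -- The minimum is u up to time 1/2 and u / 3 + 1 / 3 afterwards, where the string enters the
    -- loop.
    · refine ⟨i, fun u => min u (u / 3 + 1 / 3), by fun_prop, fun u _ v _ huv =>
        min_lt_min huv (by linarith), fun u hu => ?_⟩
      rcases le_or_gt u (1 / 2) with h1 | h1
      · simp only [min_eq_left (by linarith : u ≤ u / 3 + 1 / 3)]
        exact keyS i u hu fun hh => absurd hh.2 (not_lt.2 h1)
      · simp only [min_eq_right (by linarith : u / 3 + 1 / 3 ≤ u)]
        refine key _ _ u hu _ ⟨by linarith [hu.1], by linarith [hu.2]⟩ ?_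
        obtain ⟨e1, e2, e3⟩ := unlooped_of_lt X (u := u / 3 + 1 / 3) (by linarith)
        rw [hi, e1, e2, e3, loopedRadius_succ, loopedHeight_succ, if_pos ⟨rfl, h1⟩,
          if_pos ⟨rfl, h1⟩, show 3 * (u / 3 + 1 / 3) + -(9 / 4) = u - 5 / 4 by ring,
          show 3 * (u / 3 + 1 / 3) - 1 = u by ring]
    · exact ⟨i, id, continuousOn_id, strictMono_id.strictMonoOn _, fun u hu =>
        keyS i u hu fun hh => hi hh.1⟩

variable {n : ℕ}

/-- The permutation of the places `1, 2, …` that acts there like `σ` on the places `0, 1, …`. -/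
def shift (σ : Equiv.Perm (Fin n)) : Equiv.Perm (Fin (n + 1)) := Equiv.Perm.decomposeFin.symm (0, σ)

theorem shift_zero (σ : Equiv.Perm (Fin n)) : shift σ 0 = 0 :=
  Equiv.Perm.decomposeFin_symm_apply_zero 0 σ

theorem shift_succ (σ : Equiv.Perm (Fin n)) (i : Fin n) : shift σ i.succ = (σ i).succ := by
  rw [shift, Equiv.Perm.decomposeFin_symm_apply_succ, Equiv.swap_self]; rfl

theorem isShift_one : IsShift (1 : GeometricBraid n) 1 where
  perm_zero := rfl
  perm_succ _ := rfl
  string_zero' t _ := by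
    change basePoint (0 : Fin (n + 1)) = (0, 0)
    simp [basePoint]
  string_succ i t _ := by
    change basePoint i.succ = ((basePoint i).1 + 1, (basePoint i).2)
    simp [basePoint]

theorem isShift_ofPerm (σ : Equiv.Perm (Fin n)) : IsShift (ofPerm σ) (ofPerm (shift σ)) where
  perm_zero := shift_zero σ
  perm_succ := shift_succ σ
  string_zero' t _ := by rw [ofPerm_string, shift_zero]; simp
  string_succ i t _ := by
    rw [ofPerm_string, ofPerm_string, shift_succ]
    refine Prod.ext ?_ ?_ <;> simp <;> ring

theorem IsShift.mul {a b : GeometricBraid n} {a' b' : GeometricBraid (n + 1)} (h : IsShift a a')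
    (h' : IsShift b b') : IsShift (a * b) (a' * b') where
  perm_zero := by rw [mul_perm_apply, h.perm_zero, h'.perm_zero]
  perm_succ i := by rw [mul_perm_apply, h.perm_succ, h'.perm_succ, mul_perm_apply]
  string_zero' t ht := by
    rcases le_total t (1 / 2) with h1 | h1
    · rw [mul_string_left _ _ _ h1, h.string_zero' _ ⟨by linarith [ht.1], by linarith⟩]
    · rw [mul_string_right _ _ _ h1, h.perm_zero,
        h'.string_zero' _ ⟨by linarith, by linarith [ht.2]⟩]
  string_succ i t ht := by
    rcases le_total t (1 / 2) with h1 | h1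
    · rw [mul_string_left _ _ _ h1, mul_string_left _ _ _ h1,
        h.string_succ _ _ ⟨by linarith [ht.1], by linarith⟩]
    · rw [mul_string_right _ _ _ h1, mul_string_right _ _ _ h1, h.perm_succ,
        h'.string_succ _ _ ⟨by linarith, by linarith [ht.2]⟩]

/-- Keeps the strings, once moved one place outwards, outside or on the cylinder of radius e in
which the loop is tightened. -/
theorem IsWord.string_nonneg {b : GeometricBraid n} (h : IsWord b) :
    ∀ i, ∀ t ∈ Icc (0 : ℝ) 1, 0 ≤ (b.string i t).1 := by
  induction h with
  | one => exact fun i _ _ => Nat.cast_nonneg (i : ℕ)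
  | ofPerm σ =>
    intro i t ht
    rw [ofPerm_string]
    have h1 : (0 : ℝ) ≤ (i : ℕ) := Nat.cast_nonneg _
    have h2 : (0 : ℝ) ≤ (σ i : ℕ) := Nat.cast_nonneg _
    have h3 := mul_nonneg ht.1 h2
    have h4 := mul_nonneg (sub_nonneg.2 ht.2) h1
    simp only
    linarith
  | @mul a b _ _ iha ihb =>
    intro i t ht
    rcases le_total t (1 / 2) with h1 | h1
    · rw [mul_string_left _ _ _ h1]
      exact iha _ _ ⟨by linarith [ht.1], by linarith⟩
    · rw [mul_string_right _ _ _ h1]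
      exact ihb _ _ ⟨by linarith, by linarith [ht.2]⟩

end GeometricBraid

namespace BraidMonoid

variable {n : ℕ}

/-- The class of the braid `b` is `x`. -/
def Represents (b : GeometricBraid n) (x : BraidMonoid n) : Prop := ∃ h : IsWord b, mk b h = x

theorem Represents.one : Represents (1 : GeometricBraid n) 1 := ⟨.one, rfl⟩

theorem represents_ofPerm (σ : Equiv.Perm (Fin n)) : Represents (ofPerm σ) (of σ) := ⟨.ofPerm σ, rfl⟩

theorem Represents.mul {a b : GeometricBraid n} {x y : BraidMonoid n} (ha : Represents a x)
    (hb : Represents b y) : Represents (a * b) (x * y) := by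
  obtain ⟨ha, rfl⟩ := ha
  obtain ⟨hb, rfl⟩ := hb
  exact ⟨ha.mul hb, rfl⟩

theorem Represents.list_prod {ι : Type*} {f : ι → GeometricBraid n} {g : ι → BraidMonoid n}
    (h : ∀ i, Represents (f i) (g i)) (l : List ι) :
    Represents (l.map f).prod (l.map g).prod := by
  induction l with
  | nil => exact .one
  | cons i l ih => simp only [List.map_cons, List.prod_cons]; exact (h i).mul ih

theorem Represents.link_eq {a : GeometricBraid n} {x : BraidMonoid n} (h : Represents a x) :
    x.link = Quotient.mk linkSetoid a.closure := by
  obtain ⟨h, rfl⟩ := h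
  rfl

/-- Destabilization. -/
theorem link_prod_shift_mul_of_swap {m : ℕ} (l : List (Equiv.Perm (Fin (m + 1)))) :
    ((l.map fun σ => of (shift σ)).prod * of (Equiv.swap 0 1)).link = ((l.map of).prod).link := by
  have h1 := Represents.list_prod (fun σ => represents_ofPerm (shift σ)) l
  have h2 := Represents.list_prod represents_ofPerm l
  have hs : IsShift (l.map ofPerm).prod (l.map fun σ => ofPerm (shift σ)).prod := by
    clear h1 h2
    induction l with
    | nil => exact isShift_one
    | cons σ l ih =>
      simp only [List.map_cons, List.prod_cons]
      exact (isShift_ofPerm σ).mul ih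
  obtain ⟨w1, -⟩ := id h1
  obtain ⟨w2, -⟩ := id h2
  rw [(h1.mul (represents_ofPerm _)).link_eq, h2.link_eq]
  exact Quotient.sound ((hs.isotopic_closure w2.isLip w1.isLip w2.string_nonneg).trans
    w2.mul_one.isotopic)

end BraidMonoid

/-! ### Twists as permutation braids, and the removal of one string -/

/-- The permutation of the first `d + 1` places out of `n` that takes the place `0` to the place `d`
and keeps the order of the others. -/
def cyc (n d : ℕ) : Equiv.Perm (Fin n) := if h : d < n then (Fin.cycleRange ⟨d, h⟩).symm else 1

theorem val_cyc {n d : ℕ} (hd : d < n) (i : Fin n) :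
    (cyc n d i : ℕ) = if (i : ℕ) = 0 then d else if (i : ℕ) ≤ d then i - 1 else i := by
  obtain ⟨m, rfl⟩ : ∃ m, n = m + 1 := ⟨n - 1, by omega⟩
  rw [cyc, dif_pos hd]
  refine Fin.cases ?_ (fun i => ?_) i
  · rw [Fin.cycleRange_symm_zero]; simp
  · rw [Fin.cycleRange_symm_succ, Fin.val_succ, if_neg (Nat.succ_ne_zero _)]
    rcases lt_or_ge (i : ℕ) d with h | h
    · rw [Fin.succAbove_of_castSucc_lt _ _ h, if_pos (Nat.succ_le_of_lt h)]; rfl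
    · rw [Fin.succAbove_of_le_castSucc _ _ h, if_neg (by omega)]; rfl

theorem val_swap {n : ℕ} (a b i : Fin n) : ((Equiv.swap a b i : Fin n) : ℕ) =
    if (i : ℕ) = a then (b : ℕ) else if (i : ℕ) = b then (a : ℕ) else i := by
  rw [Equiv.swap_apply_def]
  simp only [Fin.ext_iff]
  split_ifs <;> rfl

theorem cyc_succ {n d : ℕ} (hd : d < n + 1) (i : Fin n) :
    cyc (n + 1) d i.succ = (⟨d, hd⟩ : Fin (n + 1)).succAbove i := by
  rw [cyc, dif_pos hd, Fin.cycleRange_symm_succ]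

theorem cyc_zero {n d : ℕ} (hd : d < n + 1) : cyc (n + 1) d 0 = ⟨d, hd⟩ := by
  rw [cyc, dif_pos hd, Fin.cycleRange_symm_zero]

namespace BraidMonoid

/-- The second factor crosses only pairs that contain the string at the place 0, which the first
factor leaves alone; so no pair crosses twice. -/
theorem of_shift_mul_of_cyc {n d : ℕ} (hd : d < n + 1) (σ : Equiv.Perm (Fin n)) :
    of (shift σ) * of (cyc (n + 1) d) = of (cyc (n + 1) d * shift σ) := by
  refine of_mul_of fun i j => ?_
  refine Fin.cases ?_ (fun j => ?_) j
  · exact fun h => absurd h (Fin.not_lt_zero _)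
  · refine Fin.cases ?_ (fun i => ?_) i
    · rw [shift_zero]
      exact fun _ h => absurd h (Fin.not_lt_zero _)
    · rw [shift_succ, shift_succ, cyc_succ hd, cyc_succ hd]
      exact fun _ h => Fin.strictMono_succAbove _ (Fin.succ_lt_succ_iff.1 h)

/-- The string going from the place 0 to the place d lies over all others, so a twist following it
can be slid through underneath. The places 0, …, a come from the places 1, …, a + 1 because a < d;
hence the shift. -/
theorem of_cyc_mul_of_cyc {n d a : ℕ} (hd : d < n + 1) (h : a < d) :
    of (cyc (n + 1) d) * of (cyc (n + 1) a) = of (shift (cyc n a)) * of (cyc (n + 1) d) := by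
  rw [of_shift_mul_of_cyc hd, of_mul_of]
  · congr 1
    ext i
    simp only [Equiv.Perm.mul_apply]
    refine Fin.cases ?_ (fun i => ?_) i
    · simp only [shift_zero, val_cyc hd, val_cyc (h.trans hd), Fin.val_zero]
      split_ifs <;> omega
    · simp only [shift_succ, val_cyc hd, val_cyc (h.trans hd), val_cyc (by omega : a < n),
        Fin.val_succ]
      split_ifs <;> omega
  · intro i j hij hlt
    rw [Fin.lt_def] at *
    simp only [val_cyc hd, val_cyc (h.trans hd)] at hlt ⊢
    split_ifs at * <;> omega

/-- This is σ₁ · (σ₂⋯σ_{d+1}): it isolates the one letter that touches the first place. -/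
theorem of_swap_mul_of_shift_cyc {n d : ℕ} (hd : d < n + 1) :
    of (Equiv.swap 0 1) * of (shift (cyc (n + 1) d)) = of (cyc (n + 2) (d + 1)) := by
  have hs : ∀ i : Fin (n + 2), ((Equiv.swap 0 1 i : Fin (n + 2)) : ℕ) =
      if (i : ℕ) = 0 then (1 : ℕ) else if (i : ℕ) = 1 then (0 : ℕ) else (i : ℕ) := val_swap 0 1
  have hv : ∀ i : Fin (n + 2), (shift (cyc (n + 1) d) i : ℕ) =
      if (i : ℕ) = 0 then 0 else if (i : ℕ) = 1 then d + 1 else if (i : ℕ) ≤ d + 1 then i - 1 else i := by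
    refine Fin.cases ?_ fun i => ?_
    · simp [shift_zero]
    · rw [shift_succ]
      simp only [Fin.val_succ, val_cyc hd]
      split_ifs <;> omega
  rw [of_mul_of]
  · congr 1
    ext i
    simp only [Equiv.Perm.mul_apply, hv, hs, val_cyc (by omega : d + 1 < n + 2)]
    split_ifs <;> omega
  · intro i j hij hlt
    rw [Fin.lt_def] at *
    simp only [hv, hs] at hlt ⊢
    split_ifs at * <;> omega

/-- The class of a generator. -/
noncomputable def gen (n j : ℕ) : BraidMonoid n :=
  if h : j + 1 < n then of (Equiv.swap ⟨j, by omega⟩ ⟨j + 1, h⟩) else 1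

theorem represents_gen (n j : ℕ) : Represents (GeometricBraid.gen n j) (gen n j) := by
  unfold gen GeometricBraid.gen
  split_ifs
  exacts [represents_ofPerm _, .one]

theorem prod_gen {n d : ℕ} (hd : d < n) : ((List.range d).map (gen n)).prod = of (cyc n d) := by
  induction d with
  | zero =>
    have : cyc n 0 = 1 := by
      ext i
      rw [val_cyc hd]
      simp only [Equiv.Perm.one_apply]
      split_ifs <;> omega
    rw [this, of_one]
    rfl
  | succ d ih =>
    rw [List.range_succ, List.map_append, List.prod_append, ih (by omega), List.map_singleton,
      List.prod_singleton, gen, dif_pos hd, of_mul_of]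
    · congr 1
      ext i
      simp only [Equiv.Perm.mul_apply, val_swap, val_cyc hd, val_cyc (by omega : d < n)]
      split_ifs <;> omega
    · intro i j hij hlt
      rw [Fin.lt_def] at *
      simp only [val_swap, val_cyc (by omega : d < n)] at hlt ⊢
      split_ifs at * <;> omega

/-- The product of the braids `σ₁ ⋯ σ_{a-1}` for the numbers `a` of a list. -/
noncomputable def twist (n : ℕ) (l : List ℕ) : BraidMonoid n :=
  (l.map fun a => of (cyc n (a - 1))).prod

theorem twist_append (n : ℕ) (l l' : List ℕ) : twist n (l ++ l') = twist n l * twist n l' := by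
  simp [twist]

theorem of_cyc_mul_twist {n d : ℕ} (hd : d < n + 1) (l : List ℕ) (hl : ∀ a ∈ l, 0 < a ∧ a ≤ d) :
    of (cyc (n + 1) d) * twist (n + 1) l =
      ((l.map fun a => cyc n (a - 1)).map fun σ => of (shift σ)).prod * of (cyc (n + 1) d) := by
  induction l with
  | nil => simp [twist]
  | cons a l ih =>
    have ha := hl a (by simp)
    have ih := ih fun b hb => hl b (by simp [hb])
    simp only [twist, List.map_cons, List.prod_cons] at ih ⊢
    rw [← mul_assoc, of_cyc_mul_of_cyc hd (by omega), mul_assoc, ih, mul_assoc]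

/-- Removal of the first string of a shuffle. -/
theorem link_of_mul_twist {m : ℕ} (σ : Equiv.Perm (Fin (m + 2))) (τ : Equiv.Perm (Fin (m + 1)))
    (h0 : 0 < (σ 0 : ℕ)) (h : ∀ i, σ i.succ = (σ 0).succAbove (τ i)) (l : List ℕ)
    (hl : ∀ a ∈ l, 0 < a ∧ a ≤ (σ 0 : ℕ)) :
    (of σ * twist (m + 2) l).link = (of τ * twist (m + 1) (l ++ [(σ 0 : ℕ)])).link := by
  have hd := (σ 0).isLt
  obtain ⟨e, he⟩ : ∃ e, (σ 0 : ℕ) = e + 1 := ⟨(σ 0 : ℕ) - 1, by omega⟩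
  have hσ0 : (⟨e + 1, he ▸ hd⟩ : Fin (m + 2)) = σ 0 := Fin.ext he.symm
  rw [he] at hd hl ⊢
  have hσ : σ = cyc (m + 2) (e + 1) * shift τ := by
    ext i
    refine Fin.cases ?_ (fun i => ?_) i
    · rw [Equiv.Perm.mul_apply, shift_zero, cyc_zero hd, hσ0]
    · rw [Equiv.Perm.mul_apply, shift_succ, cyc_succ hd, h, hσ0]
  -- With d = e + 1, the braid of σ times the twists becomes shift(τ) · shift(twists) · σ₁ ·
  -- shift(cyc e). Conjugating the last factor to the front leaves σ₁ at the end, ready for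
  -- destabilization; a second conjugation moves cyc e, the twist of number d on one string fewer,
  -- behind the others.
  have key := link_prod_shift_mul_of_swap (cyc (m + 1) e :: τ :: l.map fun a => cyc (m + 1) (a - 1))
  simp only [List.map_cons, List.prod_cons] at key
  rw [hσ, ← of_shift_mul_of_cyc hd, mul_assoc, of_cyc_mul_twist hd l hl,
    ← of_swap_mul_of_shift_cyc (by omega), ← mul_assoc, ← mul_assoc, link_mul_comm,
    ← mul_assoc, twist_append, ← mul_assoc (of τ), link_mul_comm (of τ * _)]
  simpa [twist, mul_assoc, Function.comp_def] using key

end BraidMonoid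

/-! ### Shuffles and their vectors -/

theorem IsShuffle.add_le {n k : ℕ} {σ : Equiv.Perm (Fin n)} (h : IsShuffle σ k) {i j : Fin n}
    (hij : i ≤ j) (hk : (j : ℕ) < k ∨ k ≤ (i : ℕ)) : (σ i : ℕ) + (j - i) ≤ σ j := by
  obtain ⟨d, hd⟩ : ∃ d, (j : ℕ) = i + d := ⟨j - i, by rw [Fin.le_def] at hij; omega⟩
  induction d generalizing j with
  | zero =>
    obtain rfl : j = i := Fin.ext hd
    simp
  | succ d ih =>
    have hj := j.isLt
    set l : Fin n := ⟨i + d, by omega⟩ with hl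
    have hlv : (l : ℕ) = i + d := rfl
    have h1 := ih (j := l) (Fin.le_def.2 (by omega)) (by omega) hlv
    have h2 : σ l < σ j := by
      rcases hk with hk | hk
      · exact h.2.1 (by simp only [mem_ofPred_eq]; omega) hk (Fin.lt_def.2 (by omega))
      · exact h.2.2 (by simp only [mem_ofPred_eq]; omega) (by simp only [mem_ofPred_eq]; omega)
          (Fin.lt_def.2 (by omega))
    rw [Fin.lt_def] at h2
    omega

theorem mem_take_finRange {n k : ℕ} {i : Fin n} : i ∈ (List.finRange n).take k ↔ (i : ℕ) < k := by
  rw [List.mem_take_iff_getElem]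
  constructor
  · rintro ⟨j, hj, rfl⟩
    simp only [List.getElem_finRange, Fin.val_cast]
    omega
  · intro h
    exact ⟨i, by simp [h], by simp⟩

theorem mem_lorenzVector {n k : ℕ} {σ : Equiv.Perm (Fin n)} {x : ℤ} :
    x ∈ lorenzVector σ k ↔ ∃ i : Fin n, (i : ℕ) < k ∧ ((σ i : ℕ) : ℤ) - ((i : ℕ) : ℤ) = x := by
  simp only [lorenzVector, List.mem_map, mem_take_finRange]

theorem lorenzVector_succ {n k : ℕ} (σ : Equiv.Perm (Fin (n + 1))) :
    lorenzVector σ (k + 1) = ((σ 0 : ℕ) : ℤ) ::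
      ((List.finRange n).take k).map fun i : Fin n => ((σ i.succ : ℕ) : ℤ) - (((i : ℕ) : ℤ) + 1) := by
  simp [lorenzVector, List.finRange_succ, List.map_take, Function.comp_def]

theorem IsShuffle.pairwise_lorenzVector {n k : ℕ} {σ : Equiv.Perm (Fin n)} (h : IsShuffle σ k) :
    (lorenzVector σ k).Pairwise (· ≤ ·) := by
  rw [lorenzVector, List.pairwise_map]
  have h1 : ((List.finRange n).take k).Pairwise (· < ·) :=
    (List.pairwise_lt_finRange n).sublist (List.take_sublist _ _)
  refine h1.imp_of_mem fun {i j} _ hj hij => ?_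
  have := h.add_le hij.le (Or.inl (mem_take_finRange.1 hj))
  rw [Fin.lt_def] at hij
  omega

/-- The first string is deleted and the gap at its end closed. The other strings of the first block
end to the right of this gap, so their starts and ends both drop by one and their entries are
unchanged. -/
theorem IsShuffle.exists_tail {n k : ℕ} {σ : Equiv.Perm (Fin (n + 1))} (h : IsShuffle σ (k + 1)) :
    ∃ τ : Equiv.Perm (Fin n), IsShuffle τ k ∧ (∀ i, σ i.succ = (σ 0).succAbove (τ i)) ∧
      lorenzVector σ (k + 1) = ((σ 0 : ℕ) : ℤ) :: lorenzVector τ k := by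
  obtain ⟨⟨d, τ⟩, hτ⟩ := Equiv.Perm.decomposeFin.symm.surjective ((cyc (n + 1) (σ 0))⁻¹ * σ)
  have h0 : d = 0 := by
    have := congrArg (fun f : Equiv.Perm (Fin (n + 1)) => f 0) hτ
    simp only [Equiv.Perm.decomposeFin_symm_apply_zero, Equiv.Perm.mul_apply] at this
    rw [this, Equiv.Perm.inv_eq_iff_eq, cyc_zero (σ 0).isLt]
  subst h0
  have hs : ∀ i, σ i.succ = (σ 0).succAbove (τ i) := fun i => by
    have := congrArg (fun f : Equiv.Perm (Fin (n + 1)) => f i.succ) hτ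
    simp only [Equiv.Perm.mul_apply] at this
    rw [← cyc_succ (σ 0).isLt, ← shift_succ, shift, this, ← Equiv.Perm.mul_apply,
      mul_inv_cancel, Equiv.Perm.one_apply]
  have hlt : ∀ i j, σ i.succ < σ j.succ → τ i < τ j := fun i j => by
    rw [hs, hs]; exact (Fin.strictMono_succAbove _).lt_iff_lt.1
  refine ⟨τ, ⟨Nat.le_of_succ_le_succ h.1, fun i hi j hj hij => hlt i j (h.2.1 ?_ ?_ ?_),
    fun i hi j hj hij => hlt i j (h.2.2 ?_ ?_ ?_)⟩, hs, ?_⟩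
  · exact Nat.succ_lt_succ hi
  · exact Nat.succ_lt_succ hj
  · exact Fin.succ_lt_succ_iff.2 hij
  · exact Nat.succ_le_succ hi
  · exact Nat.succ_le_succ hj
  · exact Fin.succ_lt_succ_iff.2 hij
  · rw [lorenzVector_succ, lorenzVector]
    congr 1
    refine List.map_congr_left fun i hi => ?_
    have h1 : σ 0 < σ i.succ := h.2.1 (Nat.succ_pos k) (Nat.succ_lt_succ (mem_take_finRange.1 hi))
      (Fin.succ_pos i)
    rw [hs, Fin.lt_succAbove_iff_le_castSucc] at h1
    rw [hs, Fin.succAbove_of_le_castSucc _ _ h1]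
    rw [Fin.val_succ]
    push_cast
    ring

/-- The link of a shuffle, multiplied by a product of twists on few strings, is the link of the
product of the twists given by these and the entries of the vector of the shuffle. -/
theorem link_shuffle_mul_twist {p k : ℕ} {n : ℕ} (hn : n = p + k) {σ : Equiv.Perm (Fin n)}
    (h : IsShuffle σ k) (l D : List ℕ) (hD : lorenzVector σ k = D.map fun a : ℕ => (a : ℤ))
    (hpos : ∀ a ∈ l ++ D, 0 < a) (hsort : (l ++ D).Pairwise (· ≤ ·)) :
    (BraidMonoid.of σ * BraidMonoid.twist n l).link = (BraidMonoid.twist p (l ++ D)).link := by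
  induction k generalizing n l D with
  | zero =>
    obtain rfl : n = p := hn
    obtain rfl : D = [] := by simpa [lorenzVector] using hD.symm
    -- With an empty first block the shuffle is increasing on all places.
    have hσ : σ = 1 := by
      have hm : StrictMono σ := fun i j hij => h.2.2 (Nat.zero_le _) (Nat.zero_le _) hij
      ext i
      have h1 := h.add_le (i := ⟨0, i.pos⟩) (j := i) (Nat.zero_le _) (Or.inr le_rfl)
      have h2 := h.add_le (i := i) (j := ⟨n - 1, by omega⟩)
        (Nat.le_sub_one_of_lt i.isLt) (Or.inr (Nat.zero_le _))
      have h3 := (σ ⟨n - 1, by omega⟩).isLt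
      have h4 := i.isLt
      simp only [Equiv.Perm.one_apply] at *
      omega
    rw [hσ, BraidMonoid.of_one, one_mul, List.append_nil]
  | succ k ih =>
    obtain ⟨n, rfl⟩ : ∃ n', n = n' + 1 := ⟨n - 1, by omega⟩
    obtain ⟨τ, hτ, hs, hv⟩ := h.exists_tail
    rw [hv] at hD
    obtain ⟨d, D, rfl⟩ : ∃ d D', D = d :: D' := by
      cases D with
      | nil => simp at hD
      | cons d D => exact ⟨d, D, rfl⟩
    rw [List.map_cons, List.cons.injEq] at hD
    have hd : (σ 0 : ℕ) = d := by exact_mod_cast hD.1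
    have hd0 := hpos d (by simp)
    have hlt := (σ 0).isLt
    obtain ⟨m, rfl⟩ : ∃ m, n = m + 1 := ⟨n - 1, by omega⟩
    have hl : l ++ d :: D = (l ++ [d]) ++ D := by simp
    rw [BraidMonoid.link_of_mul_twist σ τ (by omega) hs l fun a ha => ?_, hd,
      ih (by omega) hτ (l ++ [d]) D hD.2 (hl ▸ hpos) (hl ▸ hsort), hl]
    -- The twists collected so far belong to earlier, hence smaller or equal, entries; sortedness is
    -- what allows sliding them under the string that is removed next.
    exact ⟨hpos a (by simp [ha]), hd ▸ (List.pairwise_append.1 hsort).2.2 a ha d (by simp)⟩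

/-- The last place is reached from the last string of one of the two blocks. For the second block
that would be the last string itself, a fixed point. -/
theorem IsLorenzPerm.last {n k : ℕ} {σ : Equiv.Perm (Fin n)} (h : IsLorenzPerm σ k) :
    ∃ i : Fin n, (i : ℕ) + 1 = k ∧ (σ i : ℕ) + 1 = n := by
  obtain ⟨hn, hσ, hfix⟩ := h
  set t : Fin n := ⟨n - 1, by omega⟩ with ht
  have htv : (t : ℕ) = n - 1 := rfl
  set i := σ.symm t with hi
  have hit : σ i = t := σ.apply_symm_apply t
  have hin := i.isLt
  have hval : (σ i : ℕ) = n - 1 := by rw [hit]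
  have hk := hσ.1
  rcases lt_or_ge (i : ℕ) k with h | h
  · refine ⟨i, ?_, by omega⟩
    have h1 := hσ.add_le (i := i) (j := ⟨k - 1, by omega⟩) (Nat.le_sub_one_of_lt h)
      (Or.inl (Nat.sub_lt (by omega) one_pos))
    have h2 := (σ ⟨k - 1, by omega⟩).isLt
    simp only at h1
    omega
  · have h1 := hσ.add_le (i := i) (j := t) (Nat.le_sub_one_of_lt hin) (Or.inr h)
    have h2 := (σ t).isLt
    refine absurd (Fin.ext ?_) (hfix i)
    omega

/-- The first place is not fixed, so the first entry is positive, and the entries do not decrease.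
-/
theorem IsLorenzPerm.pos_of_mem {n k : ℕ} {σ : Equiv.Perm (Fin n)} (h : IsLorenzPerm σ k) {x : ℤ}
    (hx : x ∈ lorenzVector σ k) : 0 < x := by
  obtain ⟨i, hi, rfl⟩ := mem_lorenzVector.1 hx
  have h1 := h.2.1.add_le (i := ⟨0, h.1⟩) (j := i) (Nat.zero_le _) (Or.inl hi)
  have h2 : (σ ⟨0, h.1⟩ : ℕ) ≠ 0 := fun e => h.2.2 ⟨0, h.1⟩ (Fin.ext e)
  simp only at h1
  omega

/-- The inverse of `IsShuffle.exists_tail`: a string from the first place to d is inserted. As d is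
at most every entry, the old strings of the first block end to the right of it. -/
theorem IsShuffle.exists_of_tail {n k : ℕ} {τ : Equiv.Perm (Fin n)} (h : IsShuffle τ k) {d : ℕ}
    (hd : d < n + 1) (hdτ : ∀ x ∈ lorenzVector τ k, (d : ℤ) ≤ x) :
    ∃ σ : Equiv.Perm (Fin (n + 1)), IsShuffle σ (k + 1) ∧
      lorenzVector σ (k + 1) = (d : ℤ) :: lorenzVector τ k := by
  set σ : Equiv.Perm (Fin (n + 1)) := cyc (n + 1) d * shift τ with hσ
  have h0 : σ 0 = ⟨d, hd⟩ := by rw [hσ, Equiv.Perm.mul_apply, shift_zero, cyc_zero hd]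
  have hs : ∀ i, σ i.succ = (σ 0).succAbove (τ i) := fun i => by
    rw [h0, hσ, Equiv.Perm.mul_apply, shift_succ, cyc_succ hd]
  have hlt : ∀ i j, τ i < τ j → σ i.succ < σ j.succ := fun i j => by
    rw [hs, hs]; exact (Fin.strictMono_succAbove _).lt_iff_lt.2
  have hge : ∀ i : Fin n, (i : ℕ) < k → σ i.succ = (τ i).succ := fun i hi => by
    have h1 := hdτ _ (mem_lorenzVector.2 ⟨i, hi, rfl⟩)
    rw [hs, h0, Fin.succAbove_of_le_castSucc]
    rw [Fin.le_def]
    simp only [Fin.val_castSucc]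
    omega
  refine ⟨σ, ⟨Nat.succ_le_succ h.1, fun i hi j hj => ?_, fun i hi j hj => ?_⟩, ?_⟩
  · revert hi hj
    refine Fin.cases (fun _ => ?_) (fun i hi => ?_) i <;>
      refine Fin.cases (fun _ => ?_) (fun j hj => ?_) j
    · exact fun h => absurd h (lt_irrefl _)
    · intro _
      have hj : (j : ℕ) < k := Nat.lt_of_succ_lt_succ hj
      have h1 := hdτ _ (mem_lorenzVector.2 ⟨j, hj, rfl⟩)
      rw [hge j hj, h0, Fin.lt_def]
      simp only [Fin.val_succ]
      omega
    · exact fun h => absurd h (Fin.not_lt_zero _)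
    · exact fun hij => hlt i j (h.2.1 (Nat.lt_of_succ_lt_succ hi) (Nat.lt_of_succ_lt_succ hj)
        (Fin.succ_lt_succ_iff.1 hij))
  · revert hi hj
    refine Fin.cases (fun hi => ?_) (fun i hi => ?_) i
    · exact absurd hi (Nat.not_succ_le_zero k)
    refine Fin.cases (fun hj => ?_) (fun j hj => ?_) j
    · exact absurd hj (Nat.not_succ_le_zero k)
    exact fun hij => hlt i j (h.2.2 (Nat.le_of_succ_le_succ hi) (Nat.le_of_succ_le_succ hj)
      (Fin.succ_lt_succ_iff.1 hij))
  · rw [lorenzVector_succ, lorenzVector, h0]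
    congr 1
    refine List.map_congr_left fun i hi => ?_
    rw [hge i (mem_take_finRange.1 hi)]
    rw [Fin.val_succ]
    push_cast
    ring

theorem exists_isShuffle (P : ℕ) (D : List ℕ) (hD : D.Pairwise (· ≤ ·)) (hP : ∀ a ∈ D, a ≤ P) :
    ∃ σ : Equiv.Perm (Fin (P + D.length)), IsShuffle σ D.length ∧
      lorenzVector σ D.length = D.map fun a : ℕ => (a : ℤ) := by
  induction D with
  | nil =>
    exact ⟨1, ⟨Nat.zero_le _, fun _ _ _ _ h => h, fun _ _ _ _ h => h⟩, by simp [lorenzVector]⟩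
  | cons d D ih =>
    rw [List.pairwise_cons] at hD
    obtain ⟨τ, h1, h2⟩ := ih hD.2 fun a ha => hP a (by simp [ha])
    have hd := hP d (by simp)
    obtain ⟨σ, h3, h4⟩ := h1.exists_of_tail (d := d) (by omega) fun x hx => by
      rw [h2, List.mem_map] at hx
      obtain ⟨a, ha, rfl⟩ := hx
      exact_mod_cast hD.1 a ha
    exact ⟨σ, h3, by rw [List.map_cons, ← h2]; exact h4⟩

theorem exists_isLorenzPerm (P : ℕ) (D : List ℕ) (hD : D.Pairwise (· ≤ ·))
    (hpos : ∀ a ∈ D, 0 < a) (hP : ∀ a ∈ D, a ≤ P) (hmem : P ∈ D) :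
    ∃ σ : Equiv.Perm (Fin (P + D.length)), IsLorenzPerm σ D.length ∧
      lorenzVector σ D.length = D.map fun a : ℕ => (a : ℤ) := by
  obtain ⟨σ, h1, h2⟩ := exists_isShuffle P D hD hP
  have hP0 := hpos P hmem
  refine ⟨σ, ⟨by omega, h1, fun i hi => ?_⟩, h2⟩
  rcases lt_or_ge (i : ℕ) D.length with h | h
  · have h3 : ((σ i : ℕ) : ℤ) - ((i : ℕ) : ℤ) ∈ D.map fun a : ℕ => (a : ℤ) :=
      h2 ▸ mem_lorenzVector.2 ⟨i, h, rfl⟩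
    obtain ⟨a, ha, ha'⟩ := List.mem_map.1 h3
    have := hpos a ha
    rw [hi] at ha'
    omega
  -- A fixed point in the second block would force the last string to be fixed too. But the entry P,
  -- the largest possible, already sends the last string of the first block to the last place.
  · obtain ⟨j, hj, hj'⟩ := mem_lorenzVector.1
      (h2 ▸ List.mem_map_of_mem hmem : (P : ℤ) ∈ lorenzVector σ D.length)
    have hi' := i.isLt
    have hl : D.length - 1 < P + D.length := by omega
    have ht : P + D.length - 1 < P + D.length := by omega
    have h3 := h1.add_le (i := j) (j := ⟨D.length - 1, hl⟩) (Nat.le_sub_one_of_lt hj)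
      (Or.inl (by simp only; omega))
    have h4 := h1.add_le (i := i) (j := ⟨P + D.length - 1, ht⟩) (Nat.le_sub_one_of_lt hi') (Or.inr h)
    have h5 := (σ ⟨D.length - 1, hl⟩).isLt
    have h6 := (σ ⟨P + D.length - 1, ht⟩).isLt
    simp only at h3 h4
    rw [hi] at h4
    have h7 : σ ⟨D.length - 1, hl⟩ = σ ⟨P + D.length - 1, ht⟩ := Fin.ext (by omega)
    have h8 := congrArg Fin.val (σ.injective h7)
    simp only at h8
    omega

/-! ### From sorted lists to the data of T-links, and the conclusion -/

/-- The list in which each `pᵢ` is repeated `qᵢ` times. -/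
def powerList {s : ℕ} (p q : Fin s → ℕ) : List ℕ :=
  (List.ofFn fun i => List.replicate (q i) (p i)).flatten

theorem powerVector_eq {s : ℕ} (p q : Fin (s + 1) → ℕ) :
    powerVector p q = (powerList p q).map fun a : ℕ => (a : ℤ) := by
  simp [powerVector, powerList, List.map_flatten, List.map_ofFn, Function.comp_def]

theorem mem_powerList {s : ℕ} {p q : Fin s → ℕ} {a : ℕ} :
    a ∈ powerList p q ↔ ∃ i, q i ≠ 0 ∧ a = p i := by
  simp only [powerList, List.mem_flatten, List.mem_ofFn]
  constructor
  · rintro ⟨_, ⟨i, rfl⟩, h⟩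
    exact ⟨i, List.mem_replicate.1 h⟩
  · rintro ⟨i, h⟩
    exact ⟨_, ⟨i, rfl⟩, List.mem_replicate.2 h⟩

theorem powerList_cons {s : ℕ} (a b : ℕ) (p q : Fin s → ℕ) :
    powerList (Fin.cons a p : Fin (s + 1) → ℕ) (Fin.cons b q) =
      List.replicate b a ++ powerList p q := by
  simp [powerList, List.ofFn_succ]

theorem pairwise_powerList {s : ℕ} {p q : Fin s → ℕ} (hp : StrictMono p) :
    (powerList p q).Pairwise (· ≤ ·) := by
  rw [powerList, List.pairwise_flatten, List.pairwise_ofFn]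
  refine ⟨fun l hl => ?_, fun i j hij a ha b hb => ?_⟩
  · obtain ⟨i, rfl⟩ := List.mem_ofFn.1 hl
    exact List.pairwise_replicate.2 (Or.inr le_rfl)
  · rw [(List.mem_replicate.1 ha).2, (List.mem_replicate.1 hb).2]
    exact (hp hij).le

/-- Run-length encoding from the front: a new entry either opens a new pair or raises the
multiplicity of the first one. -/
theorem exists_powerList (L : List ℕ) (hL : L ≠ []) (hsort : L.Pairwise (· ≤ ·))
    (hpos : ∀ a ∈ L, 0 < a) :
    ∃ (s : ℕ) (p q : Fin (s + 1) → ℕ), IsTData p q ∧ powerList p q = L := by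
  induction L with
  | nil => exact absurd rfl hL
  | cons a L ih =>
    have ha := hpos a (by simp)
    rw [List.pairwise_cons] at hsort
    rcases eq_or_ne L [] with rfl | hL
    · exact ⟨0, fun _ => a, fun _ => 1, ⟨ha, fun i j hij => by rw [Fin.lt_def] at hij; omega, fun _ => one_pos⟩,
        by simp [powerList]⟩
    obtain ⟨s, p, q, ⟨h1, h2, h3⟩, rfl⟩ := ih hL hsort.2 fun b hb => hpos b (by simp [hb])
    have hle : a ≤ p 0 := hsort.1 _ (mem_powerList.2 ⟨0, (h3 0).ne', rfl⟩)
    rcases hle.lt_or_eq with hlt | rfl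
    · refine ⟨s + 1, Fin.cons a p, Fin.cons 1 q, ⟨ha, ?_, Fin.cases one_pos h3⟩,
        powerList_cons a 1 p q⟩
      rw [Fin.strictMono_iff_lt_succ]
      refine Fin.cases hlt fun i => ?_
      rw [Fin.cons_succ, ← Fin.succ_castSucc, Fin.cons_succ]
      exact h2 (Fin.castSucc_lt_succ)
    · refine ⟨s, p, Fin.cons (q 0 + 1) (Fin.tail q), ⟨h1, h2, Fin.cases (Nat.succ_pos _) fun i =>
        h3 i.succ⟩, ?_⟩
      conv_lhs => rw [← Fin.cons_self_tail p]
      conv_rhs => rw [← Fin.cons_self_tail p, ← Fin.cons_self_tail q]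
      rw [powerList_cons, powerList_cons, List.replicate_succ, Fin.cons_zero, List.cons_append]

namespace BraidMonoid

theorem Represents.replicate {n : ℕ} {a : GeometricBraid n} {x : BraidMonoid n}
    (h : Represents a x) (q : ℕ) : Represents (List.replicate q a).prod (List.replicate q x).prod := by
  simpa using Represents.list_prod (fun _ : ℕ => h) (List.range q)

theorem represents_tBraid {s : ℕ} {p q : Fin (s + 1) → ℕ} (h : IsTData p q) :
    Represents (tBraid p q) (twist (p (Fin.last s)) (powerList p q)) := by
  have hp : ∀ i, p i - 1 < p (Fin.last s) := fun i => by
    have h1 := h.2.1.monotone (Fin.zero_le i)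
    have h2 := h.2.1.monotone (Fin.le_last i)
    have h3 := h.1
    omega
  have key : ∀ i, Represents (List.replicate (q i)
      ((List.range (p i - 1)).map (GeometricBraid.gen (p (Fin.last s)))).prod).prod
      (List.replicate (q i) (of (cyc (p (Fin.last s)) (p i - 1)))).prod := fun i => by
    rw [← prod_gen (hp i)]
    exact (Represents.list_prod (represents_gen _) _).replicate _
  have := Represents.list_prod key (List.finRange (s + 1))
  simpa [tBraid, twist, powerList, List.map_flatten, List.prod_flatten, List.map_ofFn,
    Function.comp_def, List.ofFn_eq_map, -List.ofFn_succ] using this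

end BraidMonoid

theorem isotopic_lorenzLink_tLink {s : ℕ} {p q : Fin (s + 1) → ℕ} (h : IsTData p q) {n k : ℕ}
    {σ : Equiv.Perm (Fin n)} (hσ : IsLorenzPerm σ k) (hv : lorenzVector σ k = powerVector p q) :
    Isotopic (lorenzLink σ) (tLink p q) := by
  rw [powerVector_eq] at hv
  have hP : p (Fin.last s) ∈ powerList p q := mem_powerList.2 ⟨_, (h.2.2 _).ne', rfl⟩
  obtain ⟨i, hi, hi'⟩ := hσ.last
  -- The last string of the first block ends at the last place, so its entry is n - k. This is one
  -- of the pᵢ, hence at most the largest; and the largest occurs as an entry, hence is at most the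
  -- last one.
  have hn : n = p (Fin.last s) + k := by
    have h1 : ((σ i : ℕ) : ℤ) - ((i : ℕ) : ℤ) ∈ (powerList p q).map fun a : ℕ => (a : ℤ) :=
      hv ▸ mem_lorenzVector.2 ⟨i, by omega, rfl⟩
    obtain ⟨a, ha, ha'⟩ := List.mem_map.1 h1
    obtain ⟨l, -, rfl⟩ := mem_powerList.1 ha
    have h2 := h.2.1.monotone (Fin.le_last l)
    obtain ⟨j, hj, hj'⟩ := mem_lorenzVector.1
      (hv ▸ List.mem_map_of_mem hP : (p (Fin.last s) : ℤ) ∈ lorenzVector σ k)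
    have h3 := hσ.2.1.add_le (i := j) (j := i) (Fin.le_def.2 (by omega)) (Or.inl (by omega))
    omega
  have hsort := pairwise_powerList (q := q) h.2.1
  have hpos : ∀ a ∈ powerList p q, 0 < a := fun a ha => by
    have := hσ.pos_of_mem (hv ▸ List.mem_map_of_mem ha : (a : ℤ) ∈ lorenzVector σ k)
    exact_mod_cast this
  -- The induction starts without any twists and ends without any shuffle.
  have key := link_shuffle_mul_twist hn hσ.2.1 [] (powerList p q) hv hpos hsort
  rw [List.nil_append, (BraidMonoid.represents_tBraid h).link_eq] at key
  simp only [BraidMonoid.twist, List.map_nil, List.prod_nil, mul_one] at key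
  rw [(BraidMonoid.represents_ofPerm σ).link_eq] at key
  exact Quotient.exact key

theorem exists_isLorenzPerm_of_isTData {s : ℕ} {p q : Fin (s + 1) → ℕ} (h : IsTData p q) :
    ∃ (n k : ℕ) (σ : Equiv.Perm (Fin n)), IsLorenzPerm σ k ∧ lorenzVector σ k = powerVector p q := by
  have h1 : ∀ i, 0 < p i := fun i => h.1.trans_le (h.2.1.monotone (Fin.zero_le i))
  obtain ⟨σ, h2, h3⟩ := exists_isLorenzPerm (p (Fin.last s)) (powerList p q)
    (pairwise_powerList h.2.1)
    (fun a ha => by obtain ⟨i, -, rfl⟩ := mem_powerList.1 ha; exact h1 i)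
    (fun a ha => by
      obtain ⟨i, -, rfl⟩ := mem_powerList.1 ha; exact h.2.1.monotone (Fin.le_last i))
    (mem_powerList.2 ⟨_, (h.2.2 _).ne', rfl⟩)
  exact ⟨_, _, σ, h2, by rw [h3, powerVector_eq]⟩

/-- The vector is sorted and positive, and it is nonempty because some string of the first block
reaches the last place. -/
theorem IsLorenzPerm.exists_isTData {n k : ℕ} {σ : Equiv.Perm (Fin n)} (h : IsLorenzPerm σ k) :
    ∃ (s : ℕ) (p q : Fin (s + 1) → ℕ), IsTData p q ∧ lorenzVector σ k = powerVector p q := by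
  have hcast : ((lorenzVector σ k).map Int.toNat).map (fun a : ℕ => (a : ℤ)) = lorenzVector σ k := by
    rw [List.map_map]
    refine (List.map_congr_left fun x hx => ?_).trans (List.map_id _)
    exact Int.toNat_of_nonneg (h.pos_of_mem hx).le
  obtain ⟨i, hi, -⟩ := h.last
  have hmem := mem_lorenzVector (σ := σ).2 ⟨i, (by omega : (i : ℕ) < k), rfl⟩
  obtain ⟨s, p, q, h1, h2⟩ := exists_powerList ((lorenzVector σ k).map Int.toNat)
    (List.ne_nil_of_mem (List.mem_map_of_mem hmem))
    (h.2.1.pairwise_lorenzVector.map _ fun _ _ => Int.toNat_le_toNat) (fun a ha => by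
      obtain ⟨x, hx, rfl⟩ := List.mem_map.1 ha
      have := h.pos_of_mem hx
      omega)
  exact ⟨s, p, q, h1, by rw [powerVector_eq, h2, hcast]⟩

theorem mainTheorem3 :
    (∀ L : OrientedLink, IsLorenzLink L ↔ IsTwistedLink L) ∧
    (∀ (s : ℕ) (p q : Fin (s + 1) → ℕ), IsTData p q →
      (∃ (n k : ℕ) (σ : Equiv.Perm (Fin n)),
        IsLorenzPerm σ k ∧ lorenzVector σ k = powerVector p q) ∧
      (∀ (n k : ℕ) (σ : Equiv.Perm (Fin n)),
        IsLorenzPerm σ k → lorenzVector σ k = powerVector p q →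
          Isotopic (lorenzLink σ) (tLink p q))) := by
  refine ⟨fun L => ⟨?_, ?_⟩, fun s p q h => ⟨exists_isLorenzPerm_of_isTData h,
    fun n k σ hσ hv => isotopic_lorenzLink_tLink h hσ hv⟩⟩
  · rintro ⟨n, k, σ, hσ, hL⟩
    obtain ⟨s, p, q, h, hv⟩ := hσ.exists_isTData
    exact ⟨s, p, q, h, (isotopic_lorenzLink_tLink h hσ hv).symm.trans hL⟩
  · rintro ⟨s, p, q, h, hL⟩
    obtain ⟨n, k, σ, hσ, hv⟩ := exists_isLorenzPerm_of_isTData h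
    exact ⟨n, k, σ, hσ, (isotopic_lorenzLink_tLink h hσ hv).trans hL⟩
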